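/- A maximum internal spanning tree of a bipartite permutation graph can be computed in linear time. Precisely: all graphs are finite, simple and connected. A graph with $n$ vertices is a permutation graph if its vertices can be numbered $v_1,\dots,v_n$ so that, for some permutation $\sigma$ of $\{1,\dots,n\}$, the vertices $v_i$ and $v_j$ are adjacent if and only if $(i-j)(\sigma(i)-\sigma(j))<0$; a bipartite permutation graph is a permutation graph that is bipartite. A maximum internal spanning tree (MIST) of $G$ is a spanning tree of $G$ whose number of internal vertices (vertices of degree at least $2$ in the tree) is largest among all spanning trees of $G$. Then there are a deterministic algorithm (a program for a unit-cost random access machine) and a constant $c$ such that, for every connected bipartite permutation graph $G$ with $n$ vertices and $m$ edges, given by adjacency lists in any order, the algorithm halts after at most $c\,(n+m)$ steps and outputs the list of edges of a MIST of $G$. -/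

import Mathlib

/-! ### Permutation graphs, spanning trees, internal vertices -/

namespace MIST

/-- `G` is a permutation graph: its vertices can be numbered `v 0, …, v (k - 1)` so that, for some
permutation `σ` of the indices, `v i` and `v j` are adjacent iff `(i - j) (σ i - σ j) < 0`. -/
def IsPermutationGraph {V : Type*} (G : SimpleGraph V) : Prop :=
  ∃ (k : ℕ) (v : Fin k ≃ V) (σ : Equiv.Perm (Fin k)), ∀ i j : Fin k,
    G.Adj (v i) (v j) ↔
      (((i : ℕ) : ℤ) - ((j : ℕ) : ℤ)) * (((σ i : ℕ) : ℤ) - ((σ j : ℕ) : ℤ)) < 0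

/-- A bipartite permutation graph is a permutation graph that is bipartite. -/
def IsBipartitePermutationGraph {V : Type*} (G : SimpleGraph V) : Prop :=
  G.IsBipartite ∧ IsPermutationGraph G

/-- `T` is a spanning tree of `G`. -/
def IsSpanningTree {V : Type*} (G T : SimpleGraph V) : Prop :=
  T ≤ G ∧ T.IsTree

/-- The number of internal vertices (vertices of degree at least two) of `T`. -/
noncomputable def internalCount {V : Type*} (T : SimpleGraph V) : ℕ :=
  {v : V | 2 ≤ (T.neighborSet v).ncard}.ncard

/-- `T` is a maximum internal spanning tree of `G`: a spanning tree with the largest number of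
internal vertices among all spanning trees of `G`. -/
def IsMIST {V : Type*} (G T : SimpleGraph V) : Prop :=
  IsSpanningTree G T ∧ ∀ T' : SimpleGraph V, IsSpanningTree G T' →
    internalCount T' ≤ internalCount T

end MIST

/-! ### A unit-cost random access machine

Programs are structured (`while`) programs over natural-number registers and finitely many
natural-number arrays with indirect addressing. Every elementary instruction and every evaluation
of a test costs one step. The arithmetic is deliberately small: constants, successor, truncated
subtraction and comparisons. One step increases the largest number that is stored by at most one
(apart from the constants that are written in the program), so a run that takes linear time only
ever handles words of logarithmic length, and there is no hidden power in the unit-cost measure. -/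

namespace RAM

/-- A memory state: the contents of the registers, and of the cells of each array. -/
structure State where
  reg : ℕ → ℕ
  arr : ℕ → ℕ → ℕ

/-- Write `x` to register `r`. -/
def State.setReg (s : State) (r x : ℕ) : State :=
  ⟨Function.update s.reg r x, s.arr⟩

/-- Write `x` to cell `i` of array `a`. -/
def State.setArr (s : State) (a i x : ℕ) : State :=
  ⟨s.reg, Function.update s.arr a (Function.update (s.arr a) i x)⟩

/-- Comparisons of two registers. -/
inductive Test where
  | lt (p q : ℕ)
  | le (p q : ℕ)
  | eq (p q : ℕ)
  | ne (p q : ℕ)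

/-- The test succeeds in the state `s`. -/
def Test.Holds : Test → State → Prop
  | .lt p q, s => s.reg p < s.reg q
  | .le p q, s => s.reg p ≤ s.reg q
  | .eq p q, s => s.reg p = s.reg q
  | .ne p q, s => s.reg p ≠ s.reg q

/-- Programs. Names of registers and arrays are literals in the program, so a program uses only
finitely many of them; cells of arrays are addressed through registers. -/
inductive Program where
  /-- do nothing -/
  | skip
  /-- `r := k`, a constant -/
  | const (r k : ℕ)
  /-- `r := p` -/
  | move (r p : ℕ)
  /-- `r := p + 1` -/
  | succ (r p : ℕ)
  /-- `r := max (p - q) 0` -/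
  | sub (r p q : ℕ)
  /-- `r := a[i]`, where `a` is an array and `i` is a register -/
  | load (r a i : ℕ)
  /-- `a[i] := p`, where `a` is an array and `i`, `p` are registers -/
  | store (a i p : ℕ)
  /-- sequential composition -/
  | seq (P Q : Program)
  /-- conditional -/
  | ite (b : Test) (P Q : Program)
  /-- loop -/
  | loop (b : Test) (P : Program)

/-- `Exec P s t s'`: started in the state `s`, the program `P` halts after exactly `t` steps in the
state `s'`. (The rules are deterministic.) -/
inductive Exec : Program → State → ℕ → State → Prop where
  | skip (s : State) : Exec .skip s 1 s
  | const (s : State) (r k : ℕ) : Exec (.const r k) s 1 (s.setReg r k)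
  | move (s : State) (r p : ℕ) : Exec (.move r p) s 1 (s.setReg r (s.reg p))
  | succ (s : State) (r p : ℕ) : Exec (.succ r p) s 1 (s.setReg r (s.reg p + 1))
  | sub (s : State) (r p q : ℕ) : Exec (.sub r p q) s 1 (s.setReg r (s.reg p - s.reg q))
  | load (s : State) (r a i : ℕ) : Exec (.load r a i) s 1 (s.setReg r (s.arr a (s.reg i)))
  | store (s : State) (a i p : ℕ) : Exec (.store a i p) s 1 (s.setArr a (s.reg i) (s.reg p))
  | seq {P Q : Program} {s s₁ s₂ : State} {t₁ t₂ : ℕ} :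
      Exec P s t₁ s₁ → Exec Q s₁ t₂ s₂ → Exec (.seq P Q) s (t₁ + t₂) s₂
  | iteTrue {b : Test} {P Q : Program} {s s' : State} {t : ℕ} :
      b.Holds s → Exec P s t s' → Exec (.ite b P Q) s (1 + t) s'
  | iteFalse {b : Test} {P Q : Program} {s s' : State} {t : ℕ} :
      ¬ b.Holds s → Exec Q s t s' → Exec (.ite b P Q) s (1 + t) s'
  | loopTrue {b : Test} {P : Program} {s s₁ s₂ : State} {t₁ t₂ : ℕ} :
      b.Holds s → Exec P s t₁ s₁ → Exec (.loop b P) s₁ t₂ s₂ →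
        Exec (.loop b P) s (1 + t₁ + t₂) s₂
  | loopFalse {b : Test} {P : Program} {s : State} :
      ¬ b.Holds s → Exec (.loop b P) s 1 s

end RAM

/-! ### Input and output of graph algorithms -/

namespace MIST

/-- `L` is an adjacency list representation of the graph `G` on the vertices `0, …, n - 1`: the
list `L v` holds every neighbour of `v` exactly once, in any order. -/
def IsAdjacencyLists {n : ℕ} (G : SimpleGraph (Fin n)) (L : Fin n → List (Fin n)) : Prop :=
  ∀ v : Fin n, (L v).Nodup ∧ ∀ w : Fin n, w ∈ L v ↔ G.Adj v w

/-- The initial memory for the adjacency lists `L`: register `0` holds the number `n` of vertices;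
array `1` holds the lists `L 0, L 1, …, L (n - 1)` one after the other; for `v ≤ n`, cell `v` of
array `0` holds the total length of the lists `L 0, …, L (v - 1)`, so that `L v` occupies the cells
of array `1` from the one with index `arr 0 v` up to, but not including, the one with index
`arr 0 (v + 1)`. The rest of the memory is zero. -/
def inputState {n : ℕ} (L : Fin n → List (Fin n)) : RAM.State where
  reg r := if r = 0 then n else 0
  arr a i :=
    if a = 0 then (if i ≤ n then (((List.ofFn L).take i).flatten).length else 0)
    else if a = 1 then (((List.ofFn L).flatten).map Fin.val).getD i 0
    else 0

/-- The memory `s` holds the list of the edges of `T`, each edge exactly once: register `0` holds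
the number of edges, and the ends of the `k`-th edge are in cell `k` of the arrays `2` and `3`. -/
def HoldsEdgeList {n : ℕ} (T : SimpleGraph (Fin n)) (s : RAM.State) : Prop :=
  s.reg 0 = T.edgeSet.ncard ∧
    ∀ u v : Fin n, T.Adj u v ↔ ∃ k < s.reg 0,
      (s.arr 2 k = u ∧ s.arr 3 k = v) ∨ (s.arr 2 k = v ∧ s.arr 3 k = u)

end MIST

/-! ### A program logic for the random access machine -/

namespace RAM

/-! Shape. The colour classes of a bipartite permutation graph can be sorted so that the four ends
of two crossing edges always span a `K₂,₂` (`exists_strongOrder`). With the classes as rows and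
columns, the edges are the cells of a staircase: each row and each column is an interval, and from
every cell but the last one can continue down or to the right (`Stair.interval`, `Stair.advance`). A
monotone path of cells from the first corner to the last has `n - 1` cells. They are the edges of a
spanning caterpillar whose leaves are the rows and columns met in a single cell. A path turning at
every cell would have only its two ends as leaves, so the greedy path turns whenever it can and is
charged one leaf for each forced straight step.

Optimality. If all neighbours of `A` lie in a disjoint set `B`, then every spanning tree has at
least `|A| - |B| + 1` leaves in `A` (`card_add_one_le_of_isTree`). Where the path is forced straight
down, its row ends at the current column, and so do all earlier rows; hence a block of consecutive
rows sees too few columns. Each forced step raises the lower bound by one: it enlarges the current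
block if the direction is the same (`certificate_same`) and opens a new disjoint block otherwise
(`certificate_other`). The number of leaves of the path therefore never exceeds the bound. Only the
first step is a free choice; it is settled by the first diagonal cell that lacks a right or a lower
neighbour (`leaves_le_of_down`).

Finding the order. In a breadth-first search from any vertex, a vertex of smallest degree in the
last layer is an end of some strong ordering (`StrongOrder.exists_min`). Seen from such an end, each
class is sorted by layers; inside a layer the neighbourhoods in the next layer grow and those in the
previous layer shrink. A single integer, `layerKey`, therefore sorts both classes up to twins
(`StrongOrder.layerKey_mono`). The keys are below `3 * n`, so bucket sort is linear, and since rows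
and columns are intervals, storing the last neighbour of each vertex answers every question about
the next cell in constant time.

Time is tracked by weakest preconditions with a clock (`Wp`); loops carry a budget that bounds the
steps still to come. -/

@[simp] theorem State.setReg_reg (s : State) (r x p : ℕ) :
    (s.setReg r x).reg p = if p = r then x else s.reg p := by
  simp [State.setReg, Function.update_apply]

@[simp] theorem State.setReg_arr (s : State) (r x : ℕ) : (s.setReg r x).arr = s.arr := rfl

@[simp] theorem State.setArr_reg (s : State) (a i x : ℕ) : (s.setArr a i x).reg = s.reg := rfl

@[simp] theorem State.setArr_arr (s : State) (a i x b : ℕ) :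
    (s.setArr a i x).arr b = if b = a then Function.update (s.arr a) i x else s.arr b := by
  simp [State.setArr, Function.update_apply]

@[simp] theorem Test.holds_lt (p q : ℕ) (s : State) :
    (Test.lt p q).Holds s ↔ s.reg p < s.reg q := Iff.rfl

@[simp] theorem Test.holds_eq (p q : ℕ) (s : State) :
    (Test.eq p q).Holds s ↔ s.reg p = s.reg q := Iff.rfl

@[simp] theorem Test.holds_ne (p q : ℕ) (s : State) :
    (Test.ne p q).Holds s ↔ s.reg p ≠ s.reg q := Iff.rfl

/-- The registers that a program may write. -/
def Program.regs : Program → List ℕ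
  | .skip => []
  | .const r _ => [r]
  | .move r _ => [r]
  | .succ r _ => [r]
  | .sub r _ _ => [r]
  | .load r _ _ => [r]
  | .store _ _ _ => []
  | .seq P Q => P.regs ++ Q.regs
  | .ite _ P Q => P.regs ++ Q.regs
  | .loop _ P => P.regs

/-- The arrays that a program may write. -/
def Program.arrs : Program → List ℕ
  | .skip => []
  | .const _ _ => []
  | .move _ _ => []
  | .succ _ _ => []
  | .sub _ _ _ => []
  | .load _ _ _ => []
  | .store a _ _ => [a]
  | .seq P Q => P.arrs ++ Q.arrs
  | .ite _ P Q => P.arrs ++ Q.arrs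
  | .loop _ P => P.arrs

/-- `s` and `s'` agree on everything that `P` does not write. -/
structure Frame (P : Program) (s s' : State) : Prop where
  reg : ∀ r, r ∉ P.regs → s'.reg r = s.reg r
  arr : ∀ a, a ∉ P.arrs → s'.arr a = s.arr a

theorem Frame.refl (P : Program) (s : State) : Frame P s s := ⟨fun _ _ => rfl, fun _ _ => rfl⟩

theorem Frame.trans {P : Program} {s s' s'' : State} (h : Frame P s s') (h' : Frame P s' s'') :
    Frame P s s'' :=
  ⟨fun r hr => (h'.reg r hr).trans (h.reg r hr), fun a ha => (h'.arr a ha).trans (h.arr a ha)⟩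

theorem Exec.frame {P : Program} {s s' : State} {t : ℕ} (h : Exec P s t s') : Frame P s s' := by
  induction h with
  | skip s => exact Frame.refl _ _
  | const s r k => exact ⟨fun p hp => by simp_all [Program.regs], fun _ _ => rfl⟩
  | move s r q => exact ⟨fun p hp => by simp_all [Program.regs], fun _ _ => rfl⟩
  | succ s r q => exact ⟨fun p hp => by simp_all [Program.regs], fun _ _ => rfl⟩
  | sub s r q q' => exact ⟨fun p hp => by simp_all [Program.regs], fun _ _ => rfl⟩
  | load s r a i => exact ⟨fun p hp => by simp_all [Program.regs], fun _ _ => rfl⟩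
  | store s a i p => exact ⟨fun _ _ => rfl, fun b hb => by simp_all [Program.arrs]⟩
  | seq _ _ h₁ h₂ =>
    refine ⟨fun r hr => ?_, fun a ha => ?_⟩
    · simp only [Program.regs, List.mem_append, not_or] at hr
      rw [h₂.reg r hr.2, h₁.reg r hr.1]
    · simp only [Program.arrs, List.mem_append, not_or] at ha
      rw [h₂.arr a ha.2, h₁.arr a ha.1]
  | iteTrue _ _ h =>
    refine ⟨fun r hr => h.reg r ?_, fun a ha => h.arr a ?_⟩
    · exact fun h' => hr (by simp [Program.regs, h'])
    · exact fun h' => ha (by simp [Program.arrs, h'])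
  | iteFalse _ _ h =>
    refine ⟨fun r hr => h.reg r ?_, fun a ha => h.arr a ?_⟩
    · exact fun h' => hr (by simp [Program.regs, h'])
    · exact fun h' => ha (by simp [Program.arrs, h'])
  | loopTrue _ _ _ h₁ h₂ =>
    exact ⟨fun r hr => (h₂.reg r hr).trans (h₁.reg r hr),
      fun a ha => (h₂.arr a ha).trans (h₁.arr a ha)⟩
  | loopFalse _ => exact Frame.refl _ _

/-- `Wp P Q τ s`: started in `s` after `τ` steps, `P` halts in a state and at a time that
satisfy `Q`. -/
def Wp (P : Program) (Q : ℕ → State → Prop) (τ : ℕ) (s : State) : Prop :=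
  ∃ t s', Exec P s t s' ∧ Q (τ + t) s'

variable {P P' : Program} {Q Q' : ℕ → State → Prop} {τ : ℕ} {s : State} {b : Test}

@[simp] theorem wp_skip : Wp .skip Q τ s ↔ Q (τ + 1) s :=
  ⟨by rintro ⟨t, s', ⟨⟩, h⟩; exact h, fun h => ⟨_, _, .skip _, h⟩⟩

@[simp] theorem wp_const {r k : ℕ} : Wp (.const r k) Q τ s ↔ Q (τ + 1) (s.setReg r k) :=
  ⟨by rintro ⟨t, s', ⟨⟩, h⟩; exact h, fun h => ⟨_, _, .const _ _ _, h⟩⟩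

@[simp] theorem wp_move {r p : ℕ} : Wp (.move r p) Q τ s ↔ Q (τ + 1) (s.setReg r (s.reg p)) :=
  ⟨by rintro ⟨t, s', ⟨⟩, h⟩; exact h, fun h => ⟨_, _, .move _ _ _, h⟩⟩

@[simp] theorem wp_succ {r p : ℕ} :
    Wp (.succ r p) Q τ s ↔ Q (τ + 1) (s.setReg r (s.reg p + 1)) :=
  ⟨by rintro ⟨t, s', ⟨⟩, h⟩; exact h, fun h => ⟨_, _, .succ _ _ _, h⟩⟩

@[simp] theorem wp_sub {r p q : ℕ} :
    Wp (.sub r p q) Q τ s ↔ Q (τ + 1) (s.setReg r (s.reg p - s.reg q)) :=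
  ⟨by rintro ⟨t, s', ⟨⟩, h⟩; exact h, fun h => ⟨_, _, .sub _ _ _ _, h⟩⟩

@[simp] theorem wp_load {r a i : ℕ} :
    Wp (.load r a i) Q τ s ↔ Q (τ + 1) (s.setReg r (s.arr a (s.reg i))) :=
  ⟨by rintro ⟨t, s', ⟨⟩, h⟩; exact h, fun h => ⟨_, _, .load _ _ _ _, h⟩⟩

@[simp] theorem wp_store {a i p : ℕ} :
    Wp (.store a i p) Q τ s ↔ Q (τ + 1) (s.setArr a (s.reg i) (s.reg p)) :=
  ⟨by rintro ⟨t, s', ⟨⟩, h⟩; exact h, fun h => ⟨_, _, .store _ _ _ _, h⟩⟩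

@[simp] theorem wp_seq : Wp (.seq P P') Q τ s ↔ Wp P (Wp P' Q) τ s := by
  constructor
  · rintro ⟨t, s', h, hQ⟩
    cases h with
    | seq h₁ h₂ => exact ⟨_, _, h₁, _, _, h₂, by rwa [Nat.add_assoc]⟩
  · rintro ⟨t, s', h, t', s'', h', hQ⟩
    exact ⟨_, _, .seq h h', by rwa [← Nat.add_assoc]⟩

@[simp] theorem wp_ite : Wp (.ite b P P') Q τ s ↔
    (b.Holds s → Wp P Q (τ + 1) s) ∧ (¬ b.Holds s → Wp P' Q (τ + 1) s) := by
  constructor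
  · rintro ⟨t, s', h, hQ⟩
    cases h with
    | iteTrue hb h => exact ⟨fun _ => ⟨_, _, h, by rwa [Nat.add_assoc]⟩, fun h' => (h' hb).elim⟩
    | iteFalse hb h => exact ⟨fun h' => (hb h').elim, fun _ => ⟨_, _, h, by rwa [Nat.add_assoc]⟩⟩
  · rintro ⟨h₁, h₂⟩
    by_cases hb : b.Holds s
    · obtain ⟨t, s', h, hQ⟩ := h₁ hb
      exact ⟨_, _, .iteTrue hb h, by rwa [← Nat.add_assoc]⟩
    · obtain ⟨t, s', h, hQ⟩ := h₂ hb
      exact ⟨_, _, .iteFalse hb h, by rwa [← Nat.add_assoc]⟩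

/-- The frame condition is handed to the continuation, so that no phase has to restate what it
leaves untouched. -/
theorem Wp.mono (h : Wp P Q τ s) (hQ : ∀ τ' s', τ ≤ τ' → Frame P s s' → Q τ' s' → Q' τ' s') :
    Wp P Q' τ s := by
  obtain ⟨t, s', h, hq⟩ := h
  exact ⟨t, s', h, hQ _ _ (Nat.le_add_right _ _) h.frame hq⟩

/-- A loop, with an invariant that keeps a time budget. -/
theorem wp_loop (I : ℕ → State → Prop) (B : ℕ) (hI : I B s)
    (hbody : ∀ B' s' τ', Frame P s s' → I B' s' → b.Holds s' →
      Wp P (fun τ'' s'' => ∃ B'', I B'' s'' ∧ τ'' + 1 + B'' ≤ τ' + B') τ' s')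
    (hQ : ∀ s' τ' B', Frame P s s' → I B' s' → ¬ b.Holds s' → τ' ≤ τ + B + 1 → Q τ' s') :
    Wp (.loop b P) Q τ s := by
  have key : ∀ B' s', Frame P s s' → I B' s' →
      ∃ t s'', Exec (.loop b P) s' t s'' ∧ t ≤ B' + 1 ∧ Frame P s s'' ∧ (∃ B'', I B'' s'') ∧
        ¬ b.Holds s'' := by
    intro B'
    -- The successful test already costs one step, so the budget drops strictly: it is the
    -- termination measure as well as the time bound.
    induction B' using Nat.strong_induction_on with
    | _ B' ih =>
      intro s' hf hI'
      by_cases hb : b.Holds s'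
      · obtain ⟨t, s'', h, B'', hI'', hB⟩ := hbody B' s' 0 hf hI' hb
        obtain ⟨t', s₃, h', ht', hf', hI₃, hb'⟩ :=
          ih B'' (by omega) s'' (hf.trans h.frame) hI''
        exact ⟨_, s₃, .loopTrue hb h h', by omega, hf', hI₃, hb'⟩
      · exact ⟨1, s', .loopFalse hb, by omega, hf, ⟨_, hI'⟩, hb⟩
  obtain ⟨t, s', h, ht, hf, ⟨B', hI'⟩, hb⟩ := key B s (Frame.refl _ _) hI
  exact ⟨t, s', h, hQ s' _ B' hf hI' hb (by omega)⟩

/-- The loop `while i < m do P; i := i + 1`. -/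
def forUp (i m : ℕ) (P : Program) : Program := .loop (.lt i m) (.seq P (.succ i i))

/-- In `c k + 2` the extra steps are the test and the increment; the final `+ 1` is the failing
test. -/
theorem wp_forUp {i m N k₀ : ℕ} (I : ℕ → State → Prop) (c : ℕ → ℕ) (him : m ≠ i)
    (hi : i ∉ P.regs) (hm : m ∉ P.regs) (hN : s.reg m = N) (hk₀ : s.reg i = k₀) (hle : k₀ ≤ N)
    (hI : I k₀ s)
    (hbody : ∀ k s' τ', Frame (forUp i m P) s s' → s'.reg i = k → k₀ ≤ k → k < N → I k s' →
      Wp P (fun τ'' s'' => τ'' ≤ τ' + c k ∧ I (k + 1) (s''.setReg i (k + 1))) τ' s')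
    (hQ : ∀ s' τ', Frame (forUp i m P) s s' → s'.reg i = N → I N s' →
      τ' ≤ τ + ∑ k ∈ Finset.Ico k₀ N, (c k + 2) + 1 → Q τ' s') :
    Wp (forUp i m P) Q τ s := by
  have hreg : ∀ s', Frame (forUp i m P) s s' → s'.reg m = N := by
    intro s' hf
    rw [hf.reg m (by simp [forUp, Program.regs, him, hm]), hN]
  refine wp_loop (fun B s' => ∃ k, s'.reg i = k ∧ k₀ ≤ k ∧ k ≤ N ∧ I k s' ∧
    B = ∑ k ∈ Finset.Ico k N, (c k + 2)) _ ⟨k₀, hk₀, le_rfl, hle, hI, rfl⟩ ?_ ?_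
  · rintro B' s' τ' hf ⟨k, hk, hk', hkN, hIk, rfl⟩ hb
    have hf' : Frame (forUp i m P) s s' := ⟨hf.reg, hf.arr⟩
    have hlt : k < N := by
      have := hreg s' hf'
      simp only [Test.holds_lt] at hb
      omega
    rw [wp_seq]
    refine (hbody k s' τ' hf' hk hk' hlt hIk).mono ?_
    rintro τ'' s'' - hf'' ⟨hτ, hI'⟩
    have hk'' : s''.reg i = k := (hf''.reg i hi).trans hk
    rw [wp_succ, hk'']
    refine ⟨_, ⟨k + 1, by simp, by omega, hlt, hI', rfl⟩, ?_⟩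
    rw [Finset.sum_eq_sum_Ico_succ_bot hlt]
    omega
  · rintro s' τ' B' hf ⟨k, hk, hk', hkN, hIk, rfl⟩ hb hτ
    have hf' : Frame (forUp i m P) s s' := ⟨hf.reg, hf.arr⟩
    have : k = N := by
      have := hreg s' hf'
      simp only [Test.holds_lt] at hb
      omega
    subst this
    exact hQ s' τ' hf' hk hIk hτ

/-- Offsets `A` and contents `C` represent the lists `nb v`, `v < n`. -/
structure Lists (A C : ℕ → ℕ) (n : ℕ) (nb : ℕ → List ℕ) : Prop where
  off : ∀ v < n, A (v + 1) = A v + (nb v).length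
  get : ∀ v < n, ∀ i (h : i < (nb v).length), C (A v + i) = (nb v)[i]

/-- Run `P` for every entry (in register `6`) of the list of the vertex in register `3`. -/
def forList (P : Program) : Program :=
  .seq (.succ 5 3) (.seq (.load 4 0 3) (.seq (.load 5 0 5)
    (forUp 4 5 (.seq (.load 6 1 4) P))))

/-- The loop uses registers 4, 5 and 6 for itself, which is why `hset` asks the invariant to ignore
them. In the cost, `C + 3` adds load, test and increment to each entry, and `4` is the set-up with
the last test. -/
theorem wp_forList {n v : ℕ} {nb : ℕ → List ℕ} (I : List ℕ → State → Prop) (C : ℕ)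
    (hL : Lists (s.arr 0) (s.arr 1) n nb) (hv : s.reg 3 = v) (hvn : v < n)
    (h4 : 4 ∉ P.regs) (h5 : 5 ∉ P.regs) (h1 : 1 ∉ P.arrs)
    (hset : ∀ l s' x r, r ∈ [4, 5, 6] → I l s' → I l (s'.setReg r x))
    (hI : I [] s)
    (hbody : ∀ l w l' s' τ', nb v = l ++ w :: l' → Frame (forList P) s s' → s'.reg 6 = w →
      I l s' → Wp P (fun τ'' s'' => τ'' ≤ τ' + C ∧ I (l ++ [w]) s'') τ' s')
    (hQ : ∀ s' τ', Frame (forList P) s s' → I (nb v) s' →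
      τ' ≤ τ + (C + 3) * (nb v).length + 4 → Q τ' s') :
    Wp (forList P) Q τ s := by
  have hfr : ∀ s₀ s', Frame (forList P) s s₀ →
      Frame (forUp 4 5 (.seq (.load 6 1 4) P)) s₀ s' → Frame (forList P) s s' := by
    intro s₀ s' h₀ h
    refine h₀.trans ⟨fun r hr => h.reg r fun h' => hr ?_, fun a ha => h.arr a fun h' => ha ?_⟩
    · simp [forList, Program.regs, h']
    · simp [forList, Program.arrs, h']
  unfold forList
  simp only [wp_seq, wp_succ, wp_load]
  set s₀ := ((s.setReg 5 (s.reg 3 + 1)).setReg 4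
    ((s.setReg 5 (s.reg 3 + 1)).arr 0 ((s.setReg 5 (s.reg 3 + 1)).reg 3))) with hs₀
  set s₁ := s₀.setReg 5 (s₀.arr 0 (s₀.reg 5)) with hs₁
  have hF : Frame (forList P) s s₁ := by
    refine ⟨fun r hr => ?_, fun a ha => rfl⟩
    simp only [forList, Program.regs, forUp, List.mem_append, List.mem_cons, not_or] at hr
    simp [hs₁, hs₀, hr]
  have r4 : s₁.reg 4 = s.arr 0 v := by simp [hs₁, hs₀, hv]
  have r5 : s₁.reg 5 = s.arr 0 v + (nb v).length := by simp [hs₁, hs₀, hv, hL.off v hvn]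
  refine wp_forUp (fun k s' => I ((nb v).take (k - s.arr 0 v)) s') (fun _ => C + 1) (by decide)
    (by simp [Program.regs, h4]) (by simp [Program.regs, h5]) r5 r4 (by omega) ?_ ?_ ?_
  · simp only [Nat.sub_self, List.take_zero]
    exact hset _ _ _ _ (by simp) (hset _ _ _ _ (by simp) (hset _ _ _ _ (by simp) hI))
  · intro k s' τ' hf hk hk0 hkN hIk
    obtain ⟨i, rfl⟩ := Nat.exists_eq_add_of_le hk0
    have hi : i < (nb v).length := by omega
    have hF' := hfr _ _ hF hf
    have ha1 : s'.arr 1 = s.arr 1 := by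
      refine hF'.arr 1 ?_
      simp [forList, Program.arrs, forUp, h1]
    have hw : s'.arr 1 (s'.reg 4) = (nb v)[i] := by rw [ha1, hk, hL.get v hvn i hi]
    simp only [Nat.add_sub_cancel_left, wp_seq, wp_load, hw] at hIk ⊢
    refine (hbody ((nb v).take i) (nb v)[i] ((nb v).drop (i + 1)) _ _ ?_ ?_ ?_
      (hset _ _ _ 6 (by simp) hIk)).mono ?_
    · rw [← List.drop_eq_getElem_cons hi, List.take_append_drop]
    · refine hF'.trans ⟨fun r hr => ?_, fun a ha => rfl⟩
      simp only [forList, Program.regs, forUp, List.mem_append, List.mem_cons, not_or] at hr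
      simp [hr]
    · simp
    · rintro τ'' s'' - - ⟨hτ, hI'⟩
      refine ⟨by omega, hset _ _ _ 4 (by simp) ?_⟩
      rw [Nat.add_assoc, Nat.add_sub_cancel_left, List.take_succ_eq_append_getElem hi]
      exact hI'
  · intro s' τ' hf hk hIk hτ
    refine hQ s' τ' (hfr _ _ hF hf) (by simpa using hIk) (hτ.trans ?_)
    simp only [Finset.sum_const, Nat.card_Ico, Nat.add_sub_cancel_left, smul_eq_mul]
    nlinarith

end RAM

/-! ### Strong orderings of bipartite permutation graphs -/

namespace MIST

variable {V : Type*} {G : SimpleGraph V} {c : V → Bool} {f : V → ℤ}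

/-- A two-colouring `c` and a ranking `f` of the vertices such that the pairs of crossing edges of
`G` (drawn with the colour classes on two parallel lines, sorted by `f`) span a `K₂,₂`. -/
structure StrongOrder (G : SimpleGraph V) (c : V → Bool) (f : V → ℤ) : Prop where
  proper : ∀ {u v}, G.Adj u v → c u ≠ c v
  cross : ∀ {x x' y y'}, c x = c x' → c y = c y' → f x ≤ f x' → f y ≤ f y' →
    G.Adj x y' → G.Adj x' y → G.Adj x y ∧ G.Adj x' y'

/-- Two inversions `u < w < z` would make `u` and `z` adjacent and give a triangle, so every vertex
has all its neighbours after it or all before it. Vertices of equal colour are not adjacent, hence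
ordered alike by both numberings; the inequalities of two crossing edges then chain to those of the
other two edges. -/
theorem exists_strongOrder (hG : IsBipartitePermutationGraph G) :
    ∃ (c : V → Bool) (f : V → ℤ), StrongOrder G c f := by
  classical
  obtain ⟨⟨col⟩, k, v, σ, h⟩ := hG
  set a : V → ℤ := fun u => ((v.symm u : ℕ) : ℤ) with ha
  set b : V → ℤ := fun u => ((σ (v.symm u) : ℕ) : ℤ) with hb
  have hadj : ∀ u w, G.Adj u w ↔ (a u - a w) * (b u - b w) < 0 := by
    intro u w
    have := h (v.symm u) (v.symm w)
    simpa using this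
  have hadj' : ∀ u w, G.Adj u w ↔ (a u < a w ∧ b w < b u) ∨ (a w < a u ∧ b u < b w) := by
    intro u w
    rw [hadj, mul_neg_iff]
    constructor <;> rintro (h | h) <;> [right; left; right; left] <;> constructor <;> linarith [h.1, h.2]
  have htri : ∀ u w z, G.Adj u w → G.Adj w z → G.Adj u z → False := by
    intro u w z h₁ h₂ h₃
    have e₁ := col.valid h₁
    have e₂ := col.valid h₂
    have e₃ := col.valid h₃
    generalize col u = p at *
    generalize col w = q at *
    generalize col z = r at *
    revert p q r
    decide
  -- The given colouring may be flipped from one component to another; this one records the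
  -- direction of the edges, which the crossing argument needs.
  set c : V → Bool := fun u => decide (∃ w, G.Adj u w ∧ a u < a w) with hc
  have hct : ∀ u, c u = true ↔ ∃ w, G.Adj u w ∧ a u < a w := by simp [hc]
  have hlt : ∀ u w, G.Adj u w → a u < a w → c u = true ∧ c w = false := by
    intro u w h₁ h₂
    refine ⟨(hct u).2 ⟨w, h₁, h₂⟩, ?_⟩
    by_contra hw
    obtain ⟨z, h₃, h₄⟩ := (hct w).1 (by simpa using hw)
    refine htri u w z h₁ h₃ ((hadj' u z).2 (Or.inl ⟨by omega, ?_⟩))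
    rcases (hadj' u w).1 h₁ with h | h <;> rcases (hadj' w z).1 h₃ with h' | h' <;> omega
  have hproper : ∀ u w, G.Adj u w → c u ≠ c w := by
    intro u w h₁
    rcases (hadj' u w).1 h₁ with h | h
    · simp [hlt u w h₁ h.1]
    · simp [hlt w u h₁.symm h.1]
  have hup : ∀ u w, G.Adj u w → c u = true → a u < a w ∧ b w < b u := by
    intro u w h₁ h₂
    rcases (hadj' u w).1 h₁ with h | h
    · exact h
    · simp [hlt w u h₁.symm h.1] at h₂
  have hinj : ∀ u w, b u = b w → a u = a w := by
    intro u w h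
    simp only [hb, Nat.cast_inj, Fin.val_inj, EmbeddingLike.apply_eq_iff_eq] at h
    rw [h]
  have hmono : ∀ u w, c u = c w → a u ≤ a w → b u ≤ b w := by
    intro u w h₁ h₂
    by_contra! h₃
    have h₄ : a u < a w := by
      refine lt_of_le_of_ne h₂ fun h => ?_
      simp only [ha, Nat.cast_inj, Fin.val_inj, EmbeddingLike.apply_eq_iff_eq] at h
      rw [h] at h₃
      exact lt_irrefl _ h₃
    exact hproper u w ((hadj' u w).2 (Or.inl ⟨h₄, h₃⟩)) h₁
  have hcross : ∀ x x' y y', c x = true → c x = c x' → c y = c y' → a x ≤ a x' → a y ≤ a y' →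
      G.Adj x y' → G.Adj x' y → G.Adj x y ∧ G.Adj x' y' := by
    intro x x' y y' hx hxx hyy hxa hya h₁ h₂
    obtain ⟨p₁, p₂⟩ := hup x y' h₁ hx
    obtain ⟨q₁, q₂⟩ := hup x' y h₂ (hxx ▸ hx)
    have r₁ := hmono x x' hxx hxa
    have r₂ := hmono y y' hyy hya
    exact ⟨(hadj' _ _).2 (Or.inl ⟨by omega, by omega⟩),
      (hadj' _ _).2 (Or.inl ⟨by omega, by omega⟩)⟩
  refine ⟨c, a, fun {u w} h => hproper u w h, ?_⟩
  intro x x' y y' hxx hyy hxa hya h₁ h₂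
  cases hx : c x with
  | true => exact hcross x x' y y' hx hxx hyy hxa hya h₁ h₂
  | false =>
    have hy : c y = true := by
      have := hproper x y' h₁
      rw [hx, ← hyy] at this
      simpa using this.symm
    obtain ⟨h₃, h₄⟩ := hcross y y' x x' hy hyy hxx hya hxa h₂.symm h₁.symm
    exact ⟨h₃.symm, h₄.symm⟩

theorem StrongOrder.neg (h : StrongOrder G c f) : StrongOrder G c (fun v => -f v) where
  proper := h.proper
  cross hx hy hfx hfy h₁ h₂ := by
    obtain ⟨h₃, h₄⟩ := h.cross hx.symm hy.symm (neg_le_neg_iff.1 hfx) (neg_le_neg_iff.1 hfy) h₂ h₁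
    exact ⟨h₄, h₃⟩

/-- `d` is the distance from `r` in a connected graph. -/
structure Layering (G : SimpleGraph V) (r : V) (d : V → ℕ) : Prop where
  root : d r = 0
  eq_root : ∀ {v}, d v = 0 → v = r
  le : ∀ {u v}, G.Adj u v → d v ≤ d u + 1
  pred : ∀ {v}, d v ≠ 0 → ∃ u, G.Adj u v ∧ d v = d u + 1

variable {r : V} {d : V → ℕ}

theorem Layering.color_eq_iff (hd : Layering G r d) (hf : StrongOrder G c f) (v : V) :
    c v = c r ↔ Even (d v) := by
  induction h : d v using Nat.strong_induction_on generalizing v with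
  | _ k ih =>
    rcases Nat.eq_zero_or_pos k with rfl | hk
    · simp [hd.eq_root h]
    · obtain ⟨u, hu, hv⟩ := hd.pred (v := v) (by omega)
      have h₁ := ih (d u) (by omega) u rfl
      have h₂ := hf.proper hu
      have h₃ : c v = c r ↔ ¬ (c u = c r) := by
        revert h₂; cases c v <;> cases c u <;> cases c r <;> decide
      rw [h₃, h₁, ← h, hv, Nat.even_add_one]

theorem Layering.adj_ne (hd : Layering G r d) (hf : StrongOrder G c f) {u v : V}
    (h : G.Adj u v) : d v = d u + 1 ∨ d u = d v + 1 := by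
  have h₁ := hd.le h
  have h₂ := hd.le h.symm
  have h₃ := hf.proper h
  have h₄ : d u ≠ d v := by
    intro h'
    have hu := hd.color_eq_iff hf u
    have hv := hd.color_eq_iff hf v
    rw [h'] at hu
    revert h₃
    generalize Even (d v) = p at hu hv
    revert hu hv
    cases c u <;> cases c v <;> cases c r <;> simp
  omega

theorem Layering.mod_two_eq_iff (hd : Layering G r d) (hf : StrongOrder G c f) (u v : V) :
    c u = c v ↔ d u % 2 = d v % 2 := by
  have hu := hd.color_eq_iff hf u
  have hv := hd.color_eq_iff hf v
  rw [Nat.even_iff] at hu hv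
  have h₁ := Nat.mod_two_eq_zero_or_one (d u)
  have h₂ := Nat.mod_two_eq_zero_or_one (d v)
  revert hu hv
  rcases h₁ with h₁ | h₁ <;> rcases h₂ with h₂ | h₂ <;> rw [h₁, h₂] <;>
    cases c u <;> cases c v <;> cases c r <;> simp

/-- `u` lies to the right of the closed neighbourhood of `v`. -/
def RightOf (G : SimpleGraph V) (c : V → Bool) (f : V → ℤ) (v u : V) : Prop :=
  (c u = c v ∧ f v < f u) ∨ (c u ≠ c v ∧ ∀ z, G.Adj v z → f z < f u)

/-- Follow a shortest path from `u` back to the root. By the crossing property each predecessor is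
again to the right of `v` or is adjacent to `v`. Since the root is not to the right, the second case
must occur, and there the distance of `v` is bounded. -/
theorem StrongOrder.le_of_rightOf (hf : StrongOrder G c f) (hd : Layering G r d) {v : V}
    (hv : d v ≠ 0) (hr : ¬ RightOf G c f v r) {u : V} (hu : RightOf G c f v u) : d v ≤ d u := by
  induction h : d u using Nat.strong_induction_on generalizing u with
  | _ k ih =>
    have hu0 : d u ≠ 0 := fun h0 => hr (hd.eq_root h0 ▸ hu)
    obtain ⟨z, hz, hzu⟩ := hd.pred hu0
    obtain ⟨y, hy, -⟩ := hd.pred hv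
    have hzc := hf.proper hz
    rcases hu with ⟨hc, hfu⟩ | ⟨hc, hfu⟩
    · by_cases hvz : G.Adj v z
      · have := hd.le hvz.symm
        omega
      · have : RightOf G c f v z := by
          refine Or.inr ⟨by rwa [← hc], fun y hy => ?_⟩
          by_contra! hle
          have hcy := hf.proper hy
          refine hvz (hf.cross hc.symm ?_ hfu.le hle hy hz.symm).1
          revert hcy hzc
          rw [hc]
          cases c v <;> cases c y <;> cases c z <;> simp
        have := ih (d z) (by omega) this rfl
        omega
    · have hcz : c z = c v := by
        revert hzc hc
        cases c v <;> cases c u <;> cases c z <;> simp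
      have : RightOf G c f v z := by
        refine Or.inl ⟨hcz, ?_⟩
        by_contra! hle
        have hcy := hf.proper hy
        have := (hf.cross (y := y) (y' := u) hcz ?_ hle (hfu y hy.symm).le hz hy.symm).2
        · exact lt_irrefl _ (hfu u this)
        · revert hcy hc
          cases c v <;> cases c y <;> cases c u <;> simp
      have := ih (d z) (by omega) this rfl
      omega

/-- Let `M` be the last vertex in the class of `v`. A neighbour of `M` not adjacent to `v` would lie
right of `v`, hence in the last layer, which has the wrong parity. So the neighbours of `M` are
among those of `v`, and the minimality of the degree makes `v` and `M` twins, which may be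
exchanged. -/
theorem StrongOrder.exists_min_of_not_rightOf [Finite V] (hf : StrongOrder G c f)
    (hd : Layering G r d) {v : V} (hv : d v ≠ 0) (hmax : ∀ u, d u ≤ d v)
    (hdeg : ∀ u, d u = d v → (G.neighborSet v).ncard ≤ (G.neighborSet u).ncard)
    (hr : ¬ RightOf G c f v r) :
    ∃ f' : V → ℤ, StrongOrder G c f' ∧ ∀ u, c u = c v → f' v ≤ f' u := by
  classical
  obtain ⟨M, hMc, hM⟩ := Set.exists_max_image {u | c u = c v} f (Set.toFinite _) ⟨v, rfl⟩
  simp only [Set.mem_ofPred_eq] at hMc hM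
  rcases (hM v rfl).eq_or_lt with heq | hlt
  · exact ⟨_, hf.neg, fun u hu => neg_le_neg (by rw [heq]; exact hM u hu)⟩
  have hMr : RightOf G c f v M := Or.inl ⟨hMc, hlt⟩
  have hsub : ∀ s, G.Adj M s → G.Adj v s := by
    intro s hs
    by_contra hvs
    have hcs := hf.proper hs
    have hsr : RightOf G c f v s := by
      refine Or.inr ⟨by rw [← hMc]; exact hcs.symm, fun y hy => ?_⟩
      by_contra! hle
      have hcy := hf.proper hy
      refine hvs (hf.cross hMc.symm ?_ hlt.le hle hy hs).1
      revert hcy hcs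
      rw [hMc]
      cases c v <;> cases c y <;> cases c s <;> simp
    have h₁ := hf.le_of_rightOf hd hv hr hsr
    have h₂ := hmax s
    have h₃ := (hd.mod_two_eq_iff hf s M)
    have h₄ := (hd.mod_two_eq_iff hf M v).1 hMc
    exact hcs (h₃.2 (by rw [h₄, le_antisymm h₁ h₂])).symm
  have hdM : d M = d v := le_antisymm (hmax M) (hf.le_of_rightOf hd hv hr hMr)
  have hN : G.neighborSet M = G.neighborSet v :=
    Set.eq_of_subset_of_ncard_le (fun s hs => hsub s hs) (hdeg M hdM) (Set.toFinite _)
  have hN' : ∀ s, G.Adj M s ↔ G.Adj v s := fun s => by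
    rw [← SimpleGraph.mem_neighborSet, hN, SimpleGraph.mem_neighborSet]
  -- `v` takes the rank of its twin `M`. The resulting tie is harmless, because rankings need not be
  -- injective.
  set π : V → V := fun u => if u = v then M else u with hπ
  have hπc : ∀ u, c (π u) = c u := by
    intro u
    by_cases hu : u = v <;> simp [hπ, hu, hMc]
  have hπ1 : ∀ u w, G.Adj (π u) w ↔ G.Adj u w := by
    intro u w
    by_cases hu : u = v <;> simp [hπ, hu, hN']
  have hπ2 : ∀ u w, G.Adj (π u) (π w) ↔ G.Adj u w := fun u w => by
    rw [hπ1, G.adj_comm, hπ1, G.adj_comm]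
  refine ⟨fun u => - f (π u), ⟨hf.proper, ?_⟩, fun u hu => ?_⟩
  · intro x x' y y' hx hy hfx hfy h₁ h₂
    rw [← hπ2] at h₁ h₂ ⊢
    rw [← hπ2 x' y']
    rw [← hπc x, ← hπc x'] at hx
    rw [← hπc y, ← hπc y'] at hy
    exact hf.neg.cross hx hy hfx hfy h₁ h₂
  · have : π v = M := by simp [hπ]
    simp only [this, neg_le_neg_iff]
    exact hM _ (by rw [hπc, hu])

/-- A vertex of smallest degree in the last layer is an end of a strong ordering. -/
theorem StrongOrder.exists_min [Finite V] (hf : StrongOrder G c f)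
    (hd : Layering G r d) {v : V} (hmax : ∀ u, d u ≤ d v)
    (hdeg : ∀ u, d u = d v → (G.neighborSet v).ncard ≤ (G.neighborSet u).ncard) :
    ∃ f' : V → ℤ, StrongOrder G c f' ∧ ∀ u, c u = c v → f' v ≤ f' u := by
  by_cases hv : d v = 0
  · refine ⟨f, hf, fun u _ => ?_⟩
    have hu : d u = 0 := by have := hmax u; omega
    rw [hd.eq_root hv, hd.eq_root hu]
  -- A root to the right of `v` is moved to the left by reversing the order; it cannot be on both
  -- sides because `v` has a neighbour.
  by_cases hr : RightOf G c f v r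
  · refine hf.neg.exists_min_of_not_rightOf hd hv hmax hdeg fun hr' => ?_
    obtain ⟨y, hy, -⟩ := hd.pred hv
    rcases hr with ⟨h₁, h₂⟩ | ⟨h₁, h₂⟩ <;> rcases hr' with ⟨h₃, h₄⟩ | ⟨h₃, h₄⟩
    · simp only at h₄; omega
    · exact h₃ h₁
    · exact h₁ h₃
    · have := h₂ y hy.symm
      have := h₄ y hy.symm
      simp only at this; omega
  · exact hf.exists_min_of_not_rightOf hd hv hmax hdeg hr

/-- Twice the number of vertices in earlier layers, plus the number of neighbours in the next
layer, minus the number of neighbours in the previous layer. -/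
noncomputable def layerKey (G : SimpleGraph V) (d : V → ℕ) (v : V) : ℤ :=
  2 * ({u | d u < d v}.ncard : ℤ) + ({u | G.Adj v u ∧ d v < d u}.ncard : ℤ) -
    ({u | G.Adj v u ∧ d u < d v}.ncard : ℤ)

/-- Compare predecessors `z` of `u` and `w` of `v`. If `w` is not after `z`, the crossing property
makes `u` adjacent to `w`; otherwise the claim for `z` and `w` is one layer closer to the root,
where minimality of the root settles it. -/
theorem StrongOrder.layer_mono (hf : StrongOrder G c f) (hd : Layering G r d)
    (hmin : ∀ u, c u = c r → f r ≤ f u) {u v : V} (hc : c u = c v) (h : f u < f v) :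
    d u ≤ d v := by
  induction hk : d v using Nat.strong_induction_on generalizing u v with
  | _ k ih =>
    rcases Nat.eq_zero_or_pos k with rfl | hpos
    · obtain rfl := hd.eq_root hk
      exact absurd (hmin u hc) (by omega)
    obtain ⟨w, hw, hwv⟩ := hd.pred (v := v) (by omega)
    by_cases hu : d u = 0
    · omega
    obtain ⟨z, hz, hzu⟩ := hd.pred hu
    have hcw := hf.proper hw
    have hcz := hf.proper hz
    have hwz : c w = c z := by
      revert hcw hcz
      rw [hc]
      cases c w <;> cases c z <;> cases c v <;> simp
    rcases le_or_gt (f w) (f z) with hle | hlt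
    · have := hd.le (hf.cross hc hwz h.le hle hz.symm hw.symm).1.symm
      omega
    · have := ih (d w) (by omega) hwz.symm hlt rfl
      omega

/-- Inside a layer the next neighbourhoods increase and the previous ones decrease along `f`, so
equal keys force both inclusions to be equalities and the vertices are twins. Between different
layers of one class the doubled layer count dominates both corrections. -/
theorem StrongOrder.layerKey_mono [Finite V] (hf : StrongOrder G c f) (hd : Layering G r d)
    (hmin : ∀ u, c u = c r → f r ≤ f u) {u v : V} (hc : c u = c v) (h : f u < f v) :
    layerKey G d u ≤ layerKey G d v ∧
      (layerKey G d u = layerKey G d v → ∀ w, G.Adj u w ↔ G.Adj v w) := by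
  have hle := hf.layer_mono hd hmin hc h
  have hmono : ∀ {u v}, c u = c v → d u < d v → f u ≤ f v := by
    intro u v hc h
    by_contra! h'
    have := hf.layer_mono hd hmin hc.symm h'
    omega
  have hcol : ∀ {u v w z}, c u = c v → G.Adj u w → G.Adj v z → c w = c z := by
    intro u v w z huv h₁ h₂
    have hcw := hf.proper h₁
    have hcz := hf.proper h₂
    revert hcw hcz
    rw [huv]
    cases c w <;> cases c z <;> cases c v <;> simp
  rcases hle.eq_or_lt with heq | hlt
  · have hnext : {w | G.Adj u w ∧ d u < d w} ⊆ {w | G.Adj v w ∧ d v < d w} := by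
      rintro w ⟨hw, hdw⟩
      refine ⟨?_, by omega⟩
      by_cases hv : d v = 0
      · rw [hd.eq_root hv, ← hd.eq_root (heq.trans hv)]
        exact hw
      obtain ⟨z, hz, hzv⟩ := hd.pred hv
      have hzw := hcol hc hw hz.symm
      exact (hf.cross hc hzw.symm h.le (hmono hzw.symm (by omega)) hw hz.symm).2
    have hprev : {w | G.Adj v w ∧ d w < d v} ⊆ {w | G.Adj u w ∧ d w < d u} := by
      rintro w ⟨hw, hdw⟩
      refine ⟨?_, by omega⟩
      obtain ⟨z, hz, hzu⟩ := hd.pred (v := u) (by omega)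
      have hwz := hcol hc.symm hw hz.symm
      have hdw' := hd.le hw.symm
      rcases le_or_gt (f w) (f z) with hle | hlt
      · exact (hf.cross hc hwz h.le hle hz.symm hw).1
      · by_cases hw0 : d w = 0
        · rw [hd.eq_root hw0, hd.eq_root (v := z) (by omega)] at hlt
          omega
        obtain ⟨t, ht, htw⟩ := hd.pred hw0
        have hct : c t = c u := hcol hwz ht.symm hz
        exact (hf.cross (x := z) (x' := w) (y := t) (y' := u) hwz.symm hct hlt.le
          (hmono hct (by omega)) hz ht.symm).2.symm
    have h₁ := Set.ncard_le_ncard hnext (Set.toFinite _)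
    have h₂ := Set.ncard_le_ncard hprev (Set.toFinite _)
    have hS : {w | d w < d u} = {w | d w < d v} := by rw [heq]
    unfold layerKey
    rw [hS]
    refine ⟨by omega, fun hkey w => ?_⟩
    have e₁ := Set.eq_of_subset_of_ncard_le hnext (by omega) (Set.toFinite _)
    have e₂ := Set.eq_of_subset_of_ncard_le hprev (by omega) (Set.toFinite _)
    have f₁ := Set.ext_iff.1 e₁ w
    have f₂ := Set.ext_iff.1 e₂ w
    simp only [Set.mem_ofPred_eq] at f₁ f₂
    constructor
    · intro hw
      rcases hd.adj_ne hf hw with h' | h'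
      · exact (f₁.1 ⟨hw, by omega⟩).1
      · exact (f₂.2 ⟨hw, by omega⟩).1
    · intro hw
      rcases hd.adj_ne hf hw with h' | h'
      · exact (f₁.2 ⟨hw, by omega⟩).1
      · exact (f₂.1 ⟨hw, by omega⟩).1
  · have hmod := (hd.mod_two_eq_iff hf u v).1 hc
    have hlt2 : d u + 2 ≤ d v := by omega
    suffices hs : layerKey G d u < layerKey G d v from ⟨hs.le, fun h => absurd h hs.ne⟩
    -- Below layer `d u + 2` lie the layers before `u`, the next neighbours of `u`, and `u` itself;
    -- below layer `d v` lie the layers before `d v - 1` and the previous neighbours of `v`. The sum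
    -- of the two estimates gives the strict inequality of the keys, with `u` as the extra one.
    have hup : {w | d w < d u}.ncard + {w | G.Adj u w ∧ d u < d w}.ncard + 1 ≤
        {w | d w < d u + 2}.ncard := by
      have hdisj : Disjoint {w | d w < d u} {w | G.Adj u w ∧ d u < d w} := by
        rw [Set.disjoint_left]
        rintro w hw ⟨-, hw'⟩
        exact absurd hw' (not_lt.2 (le_of_lt hw))
      rw [← Set.ncard_union_eq hdisj (Set.toFinite _) (Set.toFinite _),
        ← Set.ncard_insert_of_notMem (a := u) (by simp) (Set.toFinite _)]
      refine Set.ncard_le_ncard ?_ (Set.toFinite _)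
      rintro w (rfl | hw | ⟨hw, -⟩)
      · simp
      · simp only [Set.mem_ofPred_eq] at hw ⊢; omega
      · have := hd.le hw
        simp only [Set.mem_ofPred_eq]; omega
    have hlow : {w | d w + 1 < d v}.ncard + {w | G.Adj v w ∧ d w < d v}.ncard ≤
        {w | d w < d v}.ncard := by
      have hdisj : Disjoint {w | d w + 1 < d v} {w | G.Adj v w ∧ d w < d v} := by
        rw [Set.disjoint_left]
        rintro w hw ⟨hw', -⟩
        have := hd.le hw'.symm
        simp only [Set.mem_ofPred_eq] at hw
        omega
      rw [← Set.ncard_union_eq hdisj (Set.toFinite _) (Set.toFinite _)]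
      refine Set.ncard_le_ncard ?_ (Set.toFinite _)
      rintro w (hw | ⟨-, hw⟩)
      · simp only [Set.mem_ofPred_eq] at hw ⊢; omega
      · exact hw
    have h₁ : {w | d w < d u + 2}.ncard ≤ {w | d w < d v}.ncard :=
      Set.ncard_le_ncard (fun w hw => lt_of_lt_of_le hw hlt2) (Set.toFinite _)
    have h₂ : {w | d w < d u}.ncard ≤ {w | d w + 1 < d v}.ncard := by
      refine Set.ncard_le_ncard (fun w hw => ?_) (Set.toFinite _)
      simp only [Set.mem_ofPred_eq] at hw ⊢; omega
    unfold layerKey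
    omega

/-- Sorting by `layerKey` gives a strong ordering, if the root is an end of one. -/
theorem StrongOrder.strongOrder_layerKey [Finite V] (hf : StrongOrder G c f) (hd : Layering G r d)
    (hmin : ∀ u, c u = c r → f r ≤ f u) : StrongOrder G c (layerKey G d) where
  proper := hf.proper
  cross {x x' y y'} hx hy hkx hky h₁ h₂ := by
    by_cases hfx : f x ≤ f x'
    · by_cases hfy : f y ≤ f y'
      · exact hf.cross hx hy hfx hfy h₁ h₂
      -- Where the key order contradicts `f`, the keys are tied and the two vertices are twins, so
      -- each edge can be moved from one to the other.
      · obtain ⟨h₃, h₄⟩ := hf.layerKey_mono hd hmin hy.symm (not_le.1 hfy)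
        have hN := h₄ (le_antisymm h₃ hky)
        exact ⟨((hN x).1 h₁.symm).symm, ((hN x').2 h₂.symm).symm⟩
    · obtain ⟨h₃, h₄⟩ := hf.layerKey_mono hd hmin hx.symm (not_le.1 hfx)
      have hN := h₄ (le_antisymm h₃ hkx)
      exact ⟨(hN y).1 h₂, (hN y').2 h₁⟩

end MIST

/-! ### Greedy lattice paths and the optimality of their caterpillars -/

namespace MIST

/-- `v` is internal in `T`. -/
def Internal {V : Type*} (T : SimpleGraph V) (v : V) : Prop := 2 ≤ (T.neighborSet v).ncard

theorem Internal.of_adj {V : Type*} [Finite V] {T : SimpleGraph V} {u v w : V} (hu : T.Adj v u)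
    (hw : T.Adj v w) (h : u ≠ w) : Internal T v :=
  (Set.one_lt_ncard (Set.toFinite _)).2 ⟨u, hu, w, hw, h⟩

theorem exists_adj_of_connected {V : Type*} {G : SimpleGraph V} (h : G.Connected) {u v : V}
    (huv : u ≠ v) : ∃ w, G.Adj u w := by
  obtain ⟨p⟩ := h.preconnected u v
  cases p with
  | nil => exact absurd rfl huv
  | cons h _ => exact ⟨_, h⟩

/-- In a tree, an independent set `A` with neighbours in `B` has at least `|A| - |B| + 1` leaves. -/
theorem card_add_one_le_of_isTree {V : Type*} [Finite V] {T : SimpleGraph V} (hT : T.IsTree)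
    (A B : Finset V) (hAB : Disjoint A B) (hA : A.Nonempty) (hN : ∀ a ∈ A, ∀ w, T.Adj a w → w ∈ B)
    (hdeg : ∀ a ∈ A, ∃ w, T.Adj a w) [DecidablePred (Internal T)] :
    A.card + 1 ≤ B.card + (A.filter fun a => ¬ Internal T a).card := by
  classical
  have := Fintype.ofFinite V
  have hne : Nonempty ↥(A ∪ B) := ⟨⟨hA.choose, Finset.mem_union_left _ hA.choose_spec⟩⟩
  -- The induced forest on `A ∪ B` extends to a tree inside the complete graph, which gives the
  -- bound `|A| + |B| - 1` for its number of edges.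
  obtain ⟨F, hF, -, hFT⟩ := (SimpleGraph.connected_top (V := ↥(A ∪ B))).exists_isTree_le_of_le_of_isAcyclic
    (H := T.comap Subtype.val) le_top (hT.isAcyclic.of_comap (Function.Embedding.subtype _))
  have hFc := hFT.card_edgeFinset
  rw [Fintype.card_coe, Finset.card_union_of_disjoint hAB] at hFc
  set P : Finset (Σ _ : V, V) := A.sigma fun a => T.neighborFinset a with hP
  have h₁ : P.card ≤ F.edgeFinset.card := by
    calc P.card ≤ (F.edgeFinset.image (Sym2.map Subtype.val)).card := by
          refine Finset.card_le_card_of_injOn (fun z => s(z.1, z.2)) ?_ ?_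
          · rintro ⟨a, w⟩ h
            simp only [hP, Finset.coe_sigma, Set.mem_sigma_iff, Finset.mem_coe,
              SimpleGraph.mem_neighborFinset] at h
            have ha : a ∈ A ∪ B := Finset.mem_union_left _ h.1
            have hw : w ∈ A ∪ B := Finset.mem_union_right _ (hN a h.1 w h.2)
            rw [Finset.mem_coe, Finset.mem_image]
            refine ⟨s(⟨a, ha⟩, ⟨w, hw⟩), ?_, by simp⟩
            rw [SimpleGraph.mem_edgeFinset, SimpleGraph.mem_edgeSet]
            exact hF h.2
          · rintro ⟨a, w⟩ h ⟨a', w'⟩ h' heq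
            simp only [hP, Finset.coe_sigma, Set.mem_sigma_iff, Finset.mem_coe,
              SimpleGraph.mem_neighborFinset] at h h'
            simp only [Sym2.eq_iff] at heq
            rcases heq with ⟨rfl, rfl⟩ | ⟨rfl, rfl⟩
            · rfl
            · exact (Finset.disjoint_left.1 hAB h.1 (hN _ h'.1 _ h'.2)).elim
      _ ≤ F.edgeFinset.card := Finset.card_image_le
  -- Each vertex of `A` has degree at least one, and at least two unless it is a leaf.
  have h₂ : 2 * A.card ≤ P.card + (A.filter fun a => ¬ Internal T a).card := by
    rw [hP, Finset.card_sigma, Finset.card_filter, ← Finset.sum_add_distrib, mul_comm,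
      ← smul_eq_mul, ← Finset.sum_const]
    refine Finset.sum_le_sum fun a ha => ?_
    have hn : (T.neighborSet a).ncard = (T.neighborFinset a).card := by
      rw [Set.ncard_eq_toFinset_card']; rfl
    obtain ⟨w, hw⟩ := hdeg a ha
    have hpos : 0 < (T.neighborFinset a).card :=
      Finset.card_pos.2 ⟨w, by rwa [SimpleGraph.mem_neighborFinset]⟩
    by_cases hi : Internal T a
    · have hi' := hi
      unfold Internal at hi'
      rw [hn] at hi'
      simp only [hi, not_true_eq_false, if_false]
      omega
    · simp only [hi, not_false_eq_true, if_true]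
      omega
  omega

/-! ### Staircase shapes. -/

variable {V : Type*} {G : SimpleGraph V} {p q : ℕ} {x y : ℕ → V}

/-- The colour classes of a connected bipartite graph, sorted by a strong ordering. -/
structure Stair (G : SimpleGraph V) (p q : ℕ) (x y : ℕ → V) : Prop where
  x_inj : ∀ i < p, ∀ i' < p, x i = x i' → i = i'
  y_inj : ∀ j < q, ∀ j' < q, y j = y j' → j = j'
  x_ne_y : ∀ i < p, ∀ j < q, x i ≠ y j
  cover : ∀ v, (∃ i < p, x i = v) ∨ (∃ j < q, y j = v)
  not_adj_x : ∀ i < p, ∀ i' < p, ¬ G.Adj (x i) (x i')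
  not_adj_y : ∀ j < q, ∀ j' < q, ¬ G.Adj (y j) (y j')
  cross : ∀ i i' j j', i ≤ i' → i' < p → j ≤ j' → j' < q → G.Adj (x i) (y j') →
    G.Adj (x i') (y j) → G.Adj (x i) (y j) ∧ G.Adj (x i') (y j')
  conn : G.Connected
  p_pos : 0 < p
  q_pos : 0 < q

/-- `(i, j)` is a cell of the staircase shape of `G`. -/
def Cell (G : SimpleGraph V) (p q : ℕ) (x y : ℕ → V) (i j : ℕ) : Prop :=
  i < p ∧ j < q ∧ G.Adj (x i) (y j)

theorem Cell.swap {i j : ℕ} (h : Cell G p q x y i j) : Cell G q p y x j i :=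
  ⟨h.2.1, h.1, h.2.2.symm⟩

theorem cell_swap {i j : ℕ} : Cell G q p y x j i ↔ Cell G p q x y i j :=
  ⟨fun h => h.swap, fun h => h.swap⟩

namespace Stair

theorem swap (S : Stair G p q x y) : Stair G q p y x where
  x_inj := S.y_inj
  y_inj := S.x_inj
  x_ne_y i hi j hj := (S.x_ne_y j hj i hi).symm
  cover v := (S.cover v).symm
  not_adj_x := S.not_adj_y
  not_adj_y := S.not_adj_x
  cross i i' j j' hi hi' hj hj' h h' := by
    obtain ⟨h₁, h₂⟩ := S.cross j j' i i' hj hj' hi hi' h'.symm h.symm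
    exact ⟨h₁.symm, h₂.symm⟩
  conn := S.conn
  p_pos := S.q_pos
  q_pos := S.p_pos

theorem exists_row (S : Stair G p q x y) {j : ℕ} (hj : j < q) : ∃ i, Cell G p q x y i j := by
  obtain ⟨w, hw⟩ := exists_adj_of_connected S.conn (S.x_ne_y 0 S.p_pos j hj).symm
  rcases S.cover w with ⟨i, hi, rfl⟩ | ⟨j', hj', rfl⟩
  · exact ⟨i, hi, hj, hw.symm⟩
  · exact (S.not_adj_y j hj j' hj' hw).elim

theorem exists_col (S : Stair G p q x y) {i : ℕ} (hi : i < p) : ∃ j, Cell G p q x y i j := by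
  obtain ⟨j, hj⟩ := S.swap.exists_row hi
  exact ⟨j, hj.swap⟩

theorem cell_cross (S : Stair G p q x y) {i i' j j' : ℕ} (hi : i ≤ i') (hj : j ≤ j')
    (h : Cell G p q x y i j') (h' : Cell G p q x y i' j) :
    Cell G p q x y i j ∧ Cell G p q x y i' j' := by
  obtain ⟨h₁, h₂⟩ := S.cross i i' j j' hi h'.1 hj h.2.1 h.2.2 h'.2.2
  exact ⟨⟨h.1, h'.2.1, h₁⟩, ⟨h'.1, h.2.1, h₂⟩⟩

/-- Column `j` contains some cell because no vertex is isolated; crossing it with `(i, b)` or with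
`(i, a)`, according to which side of row `i` it is on, fills `(i, j)`. -/
theorem interval (S : Stair G p q x y) {i a j b : ℕ} (ha : a ≤ j) (hb : j ≤ b)
    (h : Cell G p q x y i a) (h' : Cell G p q x y i b) : Cell G p q x y i j := by
  obtain ⟨i', hi'⟩ := S.exists_row (lt_of_le_of_lt hb h'.2.1)
  rcases le_total i i' with hle | hle
  · exact (S.cell_cross hle hb h' hi').1
  · exact (S.cell_cross hle ha hi' h).2

/-- If the cell to the right of `(i, j)` is missing, then the rows up to `i` end at column `j`. -/
theorem not_cell_of_not_cell (S : Stair G p q x y) {i j : ℕ} (h : Cell G p q x y i j)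
    (h' : ¬ Cell G p q x y i (j + 1)) {a b : ℕ} (ha : a ≤ i) (hb : j < b) :
    ¬ Cell G p q x y a b := fun hab =>
  h' (S.interval (Nat.le_succ j) hb h (S.cell_cross ha hb.le hab h).2)

theorem cell_zero (S : Stair G p q x y) : Cell G p q x y 0 0 := by
  obtain ⟨i, hi⟩ := S.exists_row S.q_pos
  obtain ⟨j, hj⟩ := S.exists_col S.p_pos
  exact (S.cell_cross (Nat.zero_le _) (Nat.zero_le _) hj hi).1

/-- If both cells were missing, the rows up to `i` and the columns up to `j` would be closed under
adjacency. By connectedness they would be all vertices, and `(i, j)` would be the last cell. -/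
theorem advance (S : Stair G p q x y) {i j : ℕ} (h : Cell G p q x y i j)
    (hlast : i + j + 2 < p + q) : Cell G p q x y (i + 1) j ∨ Cell G p q x y i (j + 1) := by
  by_contra! hcon
  obtain ⟨h₁, h₂⟩ := hcon
  have key : ∀ {u v}, G.Adj u v → ((∃ a ≤ i, x a = u) ∨ (∃ b ≤ j, y b = u)) →
      ((∃ a ≤ i, x a = v) ∨ (∃ b ≤ j, y b = v)) := by
    rintro u v huv (⟨a, ha, rfl⟩ | ⟨b, hb, rfl⟩)
    · rcases S.cover v with ⟨a', ha', rfl⟩ | ⟨b, hb, rfl⟩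
      · exact (S.not_adj_x a (by have := h.1; omega) a' ha' huv).elim
      · refine Or.inr ⟨b, ?_, rfl⟩
        by_contra! hlt
        exact S.not_cell_of_not_cell h h₂ ha hlt ⟨by have := h.1; omega, hb, huv⟩
    · rcases S.cover v with ⟨a, ha, rfl⟩ | ⟨b', hb', rfl⟩
      · refine Or.inl ⟨a, ?_, rfl⟩
        by_contra! hlt
        exact S.swap.not_cell_of_not_cell h.swap (fun h' => h₁ h'.swap) hb hlt
          ⟨by have := h.2.1; omega, ha, huv⟩
      · exact (S.not_adj_y b (by have := h.2.1; omega) b' hb' huv).elim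
  have hall : ∀ v, (∃ a ≤ i, x a = v) ∨ (∃ b ≤ j, y b = v) := by
    intro v
    obtain ⟨w⟩ := S.conn.preconnected (x i) v
    have hstart : (∃ a ≤ i, x a = x i) ∨ (∃ b ≤ j, y b = x i) := Or.inl ⟨i, le_rfl, rfl⟩
    generalize x i = u at w hstart
    induction w with
    | nil => exact hstart
    | cons hadj _ ih => exact ih (key hadj hstart)
  have hi : i + 1 = p := by
    by_contra hne
    have hip : i + 1 < p := by have := h.1; omega
    rcases hall (x (i + 1)) with ⟨a, ha, hxa⟩ | ⟨b, hb, hyb⟩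
    · have := S.x_inj _ (by omega) _ hip hxa
      omega
    · exact S.x_ne_y _ hip b (by have := h.2.1; omega) hyb.symm
  have hj : j + 1 = q := by
    by_contra hne
    have hjq : j + 1 < q := by have := h.2.1; omega
    rcases hall (y (j + 1)) with ⟨a, ha, hxa⟩ | ⟨b, hb, hyb⟩
    · exact S.x_ne_y a (by have := h.1; omega) _ hjq hxa
    · have := S.y_inj _ (by omega) _ hjq hyb
      omega
  omega

end Stair

/-! ### Leaves in initial segments of rows and columns, and lower bounds for them. -/

open Classical in
/-- The number of `i < a` such that `x i` is a leaf of `T`. -/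
noncomputable def leaves (T : SimpleGraph V) (x : ℕ → V) (a : ℕ) : ℕ :=
  ((Finset.range a).filter fun i => ¬ Internal T (x i)).card

theorem leaves_mono (T : SimpleGraph V) (x : ℕ → V) : Monotone (leaves T x) := fun a b h => by
  classical
  exact Finset.card_le_card (Finset.filter_subset_filter _ (Finset.range_mono h))

theorem leaves_succ_le (T : SimpleGraph V) (x : ℕ → V) (a : ℕ) :
    leaves T x (a + 1) ≤ leaves T x a + 1 := by
  classical
  unfold leaves
  rw [Finset.range_add_one, Finset.filter_insert]
  split_ifs
  · exact Nat.le_succ _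
  · exact Finset.card_insert_le _ _

theorem leaves_succ_of_internal {T : SimpleGraph V} {x : ℕ → V} {a : ℕ} (h : Internal T (x a)) :
    leaves T x (a + 1) = leaves T x a := by
  classical
  unfold leaves
  rw [Finset.range_add_one, Finset.filter_insert, if_neg (not_not.2 h)]

theorem leaves_zero (T : SimpleGraph V) (x : ℕ → V) : leaves T x 0 = 0 := by
  simp [leaves]

namespace Stair

theorem finite (S : Stair G p q x y) : Finite V := by
  refine Finite.of_surjective (α := Fin p ⊕ Fin q)
    (Sum.elim (fun i => x i) (fun j => y j)) fun v => ?_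
  rcases S.cover v with ⟨i, hi, rfl⟩ | ⟨j, hj, rfl⟩
  · exact ⟨.inl ⟨i, hi⟩, rfl⟩
  · exact ⟨.inr ⟨j, hj⟩, rfl⟩

open Classical in
theorem card_filter (S : Stair G p q x y) [Fintype V] (φ : V → Prop) :
    (Finset.univ.filter φ).card = ((Finset.range p).filter fun i => φ (x i)).card +
      ((Finset.range q).filter fun j => φ (y j)).card := by
  have h : (Finset.univ.filter φ) = ((Finset.range p).filter fun i => φ (x i)).image x ∪
      ((Finset.range q).filter fun j => φ (y j)).image y := by
    ext v
    simp only [Finset.mem_filter, Finset.mem_univ, true_and, Finset.mem_union, Finset.mem_image,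
      Finset.mem_range]
    constructor
    · intro hv
      rcases S.cover v with ⟨i, hi, rfl⟩ | ⟨j, hj, rfl⟩
      · exact Or.inl ⟨i, ⟨hi, hv⟩, rfl⟩
      · exact Or.inr ⟨j, ⟨hj, hv⟩, rfl⟩
    · rintro (⟨i, ⟨-, hi⟩, rfl⟩ | ⟨i, ⟨-, hi⟩, rfl⟩) <;> exact hi
  rw [h, Finset.card_union_of_disjoint, Finset.card_image_of_injOn, Finset.card_image_of_injOn]
  · intro i hi j hj hij
    simp only [Finset.coe_filter, Finset.mem_range, Set.mem_ofPred_eq] at hi hj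
    exact S.y_inj i hi.1 j hj.1 hij
  · intro i hi j hj hij
    simp only [Finset.coe_filter, Finset.mem_range, Set.mem_ofPred_eq] at hi hj
    exact S.x_inj i hi.1 j hj.1 hij
  · rw [Finset.disjoint_left]
    simp only [Finset.mem_image, Finset.mem_filter, Finset.mem_range]
    rintro _ ⟨i, hi, rfl⟩ ⟨j, hj, hij⟩
    exact S.x_ne_y i hi.1 j hj.1 hij.symm

theorem card_eq (S : Stair G p q x y) : Nat.card V = p + q := by
  classical
  have := S.finite
  have := Fintype.ofFinite V
  have h := S.card_filter fun _ => True
  simpa using h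

theorem internalCount_add (S : Stair G p q x y) (T : SimpleGraph V) :
    internalCount T + (leaves T x p + leaves T y q) = p + q := by
  classical
  have := S.finite
  have := Fintype.ofFinite V
  have h : internalCount T = (Finset.univ.filter fun v => Internal T v).card := by
    rw [← Set.ncard_coe_finset]
    unfold internalCount
    congr 1
    ext v
    rw [Finset.coe_filter]
    simp only [Finset.mem_univ, true_and]
    rfl
  rw [h, S.card_filter, leaves, leaves]
  have h₁ := Finset.card_filter_add_card_filter_not (s := Finset.range p)
    (fun i => Internal T (x i))
  have h₂ := Finset.card_filter_add_card_filter_not (s := Finset.range q)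
    (fun i => Internal T (y i))
  rw [Finset.card_range] at h₁ h₂
  omega

/-- This is `card_add_one_le_of_isTree` for a block of rows `[a₀, a)` and columns `[c₀, c)`, written
without subtraction. -/
theorem leaves_add (S : Stair G p q x y) {T : SimpleGraph V} (hT : IsSpanningTree G T)
    {a₀ a c₀ c : ℕ} (ha : a₀ < a) (hap : a ≤ p) (hc : c₀ ≤ c) (hcq : c ≤ q)
    (hN : ∀ i, a₀ ≤ i → i < a → ∀ j, Cell G p q x y i j → c₀ ≤ j ∧ j < c) :
    a + c₀ + 1 + leaves T x a₀ ≤ c + a₀ + leaves T x a := by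
  classical
  have := S.finite
  have hxi : Set.InjOn x (Finset.Ico a₀ a) := fun i hi j hj hij => by
    simp only [Finset.coe_Ico, Set.mem_Ico] at hi hj
    exact S.x_inj i (by omega) j (by omega) hij
  have hyi : Set.InjOn y (Finset.Ico c₀ c) := fun i hi j hj hij => by
    simp only [Finset.coe_Ico, Set.mem_Ico] at hi hj
    exact S.y_inj i (by omega) j (by omega) hij
  have h := card_add_one_le_of_isTree hT.2 ((Finset.Ico a₀ a).image x) ((Finset.Ico c₀ c).image y)
    ?_ ?_ ?_ ?_
  · rw [Finset.card_image_of_injOn hxi, Finset.card_image_of_injOn hyi, Nat.card_Ico, Nat.card_Ico,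
      Finset.filter_image, Finset.card_image_of_injOn
        (hxi.mono (by exact_mod_cast Finset.filter_subset _ _))] at h
    have hl : leaves T x a = leaves T x a₀ +
        ((Finset.Ico a₀ a).filter fun i => ¬ Internal T (x i)).card := by
      unfold leaves
      rw [← Finset.card_union_of_disjoint, ← Finset.filter_union]
      · congr 2
        ext i
        simp only [Finset.mem_range, Finset.mem_union, Finset.mem_Ico]
        omega
      · refine Finset.disjoint_filter_filter ?_
        rw [Finset.disjoint_left]
        simp only [Finset.mem_range, Finset.mem_Ico]
        omega
    omega
  · rw [Finset.disjoint_left]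
    simp only [Finset.mem_image, Finset.mem_Ico]
    rintro _ ⟨i, hi, rfl⟩ ⟨j, hj, hij⟩
    exact S.x_ne_y i (by omega) j (by omega) hij.symm
  · exact ⟨x a₀, Finset.mem_image_of_mem _ (by simpa using ha)⟩
  · simp only [Finset.mem_image, Finset.mem_Ico]
    rintro _ ⟨i, hi, rfl⟩ w hw
    rcases S.cover w with ⟨i', hi', rfl⟩ | ⟨j, hj, rfl⟩
    · exact (S.not_adj_x i (by omega) i' hi' (hT.1 hw)).elim
    · exact ⟨j, hN i hi.1 hi.2 j ⟨by omega, hj, hT.1 hw⟩, rfl⟩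
  · simp only [Finset.mem_image, Finset.mem_Ico]
    rintro _ ⟨i, hi, rfl⟩
    exact exists_adj_of_connected hT.2.connected (S.x_ne_y i (by omega) 0 S.q_pos)

end Stair

/-- A certificate that every spanning tree has at least `l` leaves among the rows up to `i` and the
columns up to `j`, where the rows up to `i` end at column `j`; it uses a block of rows that ends
at row `i`. -/
def Certificate (G : SimpleGraph V) (p q : ℕ) (x y : ℕ → V) (i j l : ℕ) : Prop :=
  ∃ a₀ c₀, a₀ ≤ i ∧ c₀ ≤ j + 1 ∧ i < p ∧ j < q ∧
    (∀ a, a₀ ≤ a → a ≤ i → ∀ b, Cell G p q x y a b → c₀ ≤ b) ∧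
    (∀ a ≤ i, ∀ b, j < b → ¬ Cell G p q x y a b) ∧
    ∀ T, IsSpanningTree G T →
      l + (j + 1) + a₀ ≤ leaves T x a₀ + leaves T y (j + 1) + (i + 1) + 1 + c₀

namespace Stair

/-- The last clause of the certificate counts the leaves outside the block of rows; `leaves_add`
supplies those inside it. -/
theorem le_leaves (S : Stair G p q x y) {i j l : ℕ} (h : Certificate G p q x y i j l)
    {T : SimpleGraph V} (hT : IsSpanningTree G T) :
    l ≤ leaves T x (i + 1) + leaves T y (j + 1) := by
  obtain ⟨a₀, c₀, ha, hc, hi, hj, h₁, h₂, h₃⟩ := h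
  have h₄ := S.leaves_add hT (a₀ := a₀) (a := i + 1) (c₀ := c₀) (c := j + 1) (by omega) (by omega)
    hc (by omega) fun a ha₀ hai b hab => ⟨h₁ a ha₀ (by omega) b hab, by
      by_contra! hlt
      exact h₂ a (by omega) b (by omega) hab⟩
  have := h₃ T hT
  omega

/-- The first `k + 1` rows see only the first `k + 1` columns, so one of these rows is a leaf. -/
theorem certificate_diag (S : Stair G p q x y) {k : ℕ} (h : Cell G p q x y k k)
    (h' : ¬ Cell G p q x y k (k + 1)) : Certificate G p q x y k k 1 :=
  ⟨0, 0, by omega, by omega, h.1, h.2.1, fun _ _ _ _ _ => Nat.zero_le _,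
    fun _ ha _ hb => S.not_cell_of_not_cell h h' ha hb, fun T _ => by omega⟩

/-- By `hij` the block gains one more row than columns, which raises its bound by one. Its left
border persists: a cell further left in a later row would, by crossing, give one in row `a₀`. -/
theorem certificate_same (S : Stair G p q x y) {i j i' j' l : ℕ}
    (hc : Certificate G p q x y i' j' l) (hi : i' < i) (hj : j' ≤ j) (hij : i + j' = j + i' + 1)
    (h : Cell G p q x y i j) (h' : ¬ Cell G p q x y i (j + 1)) :
    Certificate G p q x y i j (l + 1) := by
  obtain ⟨a₀, c₀, ha, hc, hip, hjq, h₁, h₂, h₃⟩ := hc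
  refine ⟨a₀, c₀, by omega, by omega, h.1, h.2.1, fun a ha₀ hai b hab => ?_,
    fun a ha b hb => S.not_cell_of_not_cell h h' ha hb, fun T hT => ?_⟩
  · by_contra! hlt
    obtain ⟨b₀, hb₀⟩ := S.exists_col (i := a₀) (by omega)
    have h₅ := h₁ a₀ le_rfl ha b₀ hb₀
    have h₆ := h₁ a₀ le_rfl ha b (S.cell_cross ha₀ (by omega) hb₀ hab).1
    omega
  · have h₅ := h₃ T hT
    have h₆ := leaves_mono T y (Nat.succ_le_succ hj)
    simp only [Nat.succ_eq_add_one] at h₆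
    omega

/-- The rows up to `i'` end at column `j'`, so the columns `j' + 1, …, j` see only the rows `i' + 1,
…, i`. By `hij` there are equally many of both, which yields one leaf among these columns, disjoint
from everything that was counted before. -/
theorem certificate_other (S : Stair G p q x y) {i j i' j' l : ℕ}
    (hc : Certificate G p q x y i' j' l) (hi : i' < i) (hij : i + j' = j + i')
    (h : Cell G p q x y i j) (h' : ¬ Cell G p q x y (i + 1) j) :
    Certificate G q p y x j i (l + 1) := by
  have hle := fun T hT => S.le_leaves hc (T := T) hT
  obtain ⟨a₀, c₀, ha, hc, hip, hjq, h₁, h₂, h₃⟩ := hc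
  refine ⟨j' + 1, i' + 1, by omega, by omega, h.2.1, h.1, fun b hb₀ hbj a hab => ?_,
    fun b hb a ha => S.swap.not_cell_of_not_cell h.swap (fun h'' => h' h''.swap) hb ha,
    fun T hT => ?_⟩
  · by_contra! hlt
    exact h₂ a (by omega) b (by omega) hab.swap
  · have h₅ := hle T hT
    have h₆ := leaves_mono T x (Nat.succ_le_succ hi.le)
    simp only [Nat.succ_eq_add_one] at h₆
    omega

end Stair

/-! ### The greedy path, its caterpillar, and its optimality. -/

/-- The path `e ↦ (I e, J e)` through the first `N` of its cells starts at `(0, 0)` and turns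
whenever it can: `B e` tells whether it would like to go down next. -/
structure IsGreedy (C : ℕ → ℕ → Prop) (N : ℕ) (I J : ℕ → ℕ) (B : ℕ → Bool) : Prop where
  I_zero : I 0 = 0
  J_zero : J 0 = 0
  down : ∀ e, e + 1 < N → (B e = true ∧ C (I e + 1) (J e)) ∨ (B e = false ∧ ¬ C (I e) (J e + 1)) →
    I (e + 1) = I e + 1 ∧ J (e + 1) = J e ∧ B (e + 1) = false
  right : ∀ e, e + 1 < N → (B e = false ∧ C (I e) (J e + 1)) ∨ (B e = true ∧ ¬ C (I e + 1) (J e)) →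
    I (e + 1) = I e ∧ J (e + 1) = J e + 1 ∧ B (e + 1) = true

variable {I J : ℕ → ℕ} {B : ℕ → Bool}

theorem IsGreedy.swap (h : IsGreedy (Cell G p q x y) (p + q - 1) I J B) :
    IsGreedy (Cell G q p y x) (q + p - 1) J I (fun e => !B e) where
  I_zero := h.J_zero
  J_zero := h.I_zero
  down e he hc := by
    obtain ⟨h₁, h₂, h₃⟩ := h.right e (by omega) (by simpa [cell_swap] using hc)
    exact ⟨h₂, h₁, by simp [h₃]⟩
  right e he hc := by
    obtain ⟨h₁, h₂, h₃⟩ := h.down e (by omega) (by simpa [cell_swap] using hc)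
    exact ⟨h₂, h₁, by simp [h₃]⟩

/-- The graph whose edges are the cells of the path. -/
def pathGraph (x y : ℕ → V) (N : ℕ) (I J : ℕ → ℕ) : SimpleGraph V :=
  SimpleGraph.fromRel fun u v => ∃ e < N, u = x (I e) ∧ v = y (J e)

namespace Stair

theorem greedy_cases (h : IsGreedy (Cell G p q x y) (p + q - 1) I J B) {e : ℕ}
    (he : e + 1 < p + q - 1) :
    (I (e + 1) = I e + 1 ∧ J (e + 1) = J e ∧ B (e + 1) = false ∧
      ((B e = true ∧ Cell G p q x y (I e + 1) (J e)) ∨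
        (B e = false ∧ ¬ Cell G p q x y (I e) (J e + 1)))) ∨
    (I (e + 1) = I e ∧ J (e + 1) = J e + 1 ∧ B (e + 1) = true ∧
      ((B e = false ∧ Cell G p q x y (I e) (J e + 1)) ∨
        (B e = true ∧ ¬ Cell G p q x y (I e + 1) (J e)))) := by
  by_cases h₁ : (B e = true ∧ Cell G p q x y (I e + 1) (J e)) ∨
        (B e = false ∧ ¬ Cell G p q x y (I e) (J e + 1))
  · obtain ⟨a, b, c⟩ := h.down e he h₁
    exact Or.inl ⟨a, b, c, h₁⟩
  · have h₂ : (B e = false ∧ Cell G p q x y (I e) (J e + 1)) ∨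
        (B e = true ∧ ¬ Cell G p q x y (I e + 1) (J e)) := by
      cases hB : B e <;> simp only [hB] at h₁ ⊢ <;> simpa using h₁
    obtain ⟨a, b, c⟩ := h.right e he h₂
    exact Or.inr ⟨a, b, c, h₂⟩

/-- When the preferred neighbour is missing, `advance` guarantees the other one, so the path never
leaves the shape. -/
theorem greedy_cell (S : Stair G p q x y) (h : IsGreedy (Cell G p q x y) (p + q - 1) I J B)
    (e : ℕ) (he : e < p + q - 1) : Cell G p q x y (I e) (J e) ∧ I e + J e = e := by
  induction e with
  | zero => rw [h.I_zero, h.J_zero]; exact ⟨S.cell_zero, rfl⟩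
  | succ e ih =>
    obtain ⟨hc, hs⟩ := ih (by omega)
    have ha := S.advance hc (by omega)
    rcases greedy_cases h he with ⟨h₁, h₂, -, h₃⟩ | ⟨h₁, h₂, -, h₃⟩ <;> rw [h₁, h₂] <;>
      refine ⟨?_, by omega⟩ <;> tauto

theorem pathGraph_adj (S : Stair G p q x y) (h : IsGreedy (Cell G p q x y) (p + q - 1) I J B)
    (u v : V) : (pathGraph x y (p + q - 1) I J).Adj u v ↔
      ∃ e < p + q - 1, (x (I e) = u ∧ y (J e) = v) ∨ (x (I e) = v ∧ y (J e) = u) := by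
  rw [pathGraph, SimpleGraph.fromRel_adj]
  constructor
  · rintro ⟨-, ⟨e, he, rfl, rfl⟩ | ⟨e, he, rfl, rfl⟩⟩
    · exact ⟨e, he, Or.inl ⟨rfl, rfl⟩⟩
    · exact ⟨e, he, Or.inr ⟨rfl, rfl⟩⟩
  · rintro ⟨e, he, ⟨rfl, rfl⟩ | ⟨rfl, rfl⟩⟩ <;> have hc := (S.greedy_cell h e he).1
    · exact ⟨S.x_ne_y _ hc.1 _ hc.2.1, Or.inl ⟨e, he, rfl, rfl⟩⟩
    · exact ⟨(S.x_ne_y _ hc.1 _ hc.2.1).symm, Or.inr ⟨e, he, rfl, rfl⟩⟩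

theorem pathGraph_adj_self (S : Stair G p q x y)
    (h : IsGreedy (Cell G p q x y) (p + q - 1) I J B) {e : ℕ} (he : e < p + q - 1) :
    (pathGraph x y (p + q - 1) I J).Adj (x (I e)) (y (J e)) :=
  (S.pathGraph_adj h _ _).2 ⟨e, he, Or.inl ⟨rfl, rfl⟩⟩

theorem pathGraph_swap (S : Stair G p q x y) (h : IsGreedy (Cell G p q x y) (p + q - 1) I J B) :
    pathGraph y x (q + p - 1) J I = pathGraph x y (p + q - 1) I J := by
  ext u v
  rw [S.pathGraph_adj h, S.swap.pathGraph_adj h.swap, Nat.add_comm q p]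
  constructor <;> rintro ⟨e, he, ⟨h₁, h₂⟩ | ⟨h₁, h₂⟩⟩ <;> exact ⟨e, he, by tauto⟩

theorem greedy_last (S : Stair G p q x y) (h : IsGreedy (Cell G p q x y) (p + q - 1) I J B) :
    I (p + q - 2) = p - 1 ∧ J (p + q - 2) = q - 1 := by
  have hp := S.p_pos
  have hq := S.q_pos
  obtain ⟨h₁, h₂⟩ := S.greedy_cell h (p + q - 2) (by omega)
  have := h₁.1
  have := h₁.2.1
  omega

theorem pathGraph_connected (S : Stair G p q x y)
    (h : IsGreedy (Cell G p q x y) (p + q - 1) I J B) :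
    (pathGraph x y (p + q - 1) I J).Connected := by
  set T := pathGraph x y (p + q - 1) I J with hT
  have hp := S.p_pos
  have hq := S.q_pos
  have key : ∀ e < p + q - 1, (∀ i ≤ I e, T.Reachable (x 0) (x i)) ∧
      ∀ j ≤ J e, T.Reachable (x 0) (y j) := by
    intro e
    induction e with
    | zero =>
      intro he
      have := S.pathGraph_adj_self h he
      rw [h.I_zero, h.J_zero] at this ⊢
      constructor
      · rintro i hi
        rw [Nat.le_zero.1 hi]
      · rintro j hj
        rw [Nat.le_zero.1 hj]
        exact this.reachable
    | succ e ih =>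
      intro he
      obtain ⟨h₁, h₂⟩ := ih (by omega)
      have hadj := S.pathGraph_adj_self h he
      rcases greedy_cases h he with ⟨e₁, e₂, -⟩ | ⟨e₁, e₂, -⟩ <;> rw [e₁, e₂] at hadj ⊢
      · refine ⟨fun i hi => ?_, h₂⟩
        rcases hi.lt_or_eq with hlt | rfl
        · exact h₁ i (by omega)
        · exact (h₂ _ le_rfl).trans hadj.symm.reachable
      · refine ⟨h₁, fun j hj => ?_⟩
        rcases hj.lt_or_eq with hlt | rfl
        · exact h₂ j (by omega)
        · exact (h₁ _ le_rfl).trans hadj.reachable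
  obtain ⟨h₁, h₂⟩ := key (p + q - 2) (by omega)
  obtain ⟨e₁, e₂⟩ := S.greedy_last h
  rw [SimpleGraph.connected_iff_exists_forall_reachable]
  refine ⟨x 0, fun v => ?_⟩
  rcases S.cover v with ⟨i, hi, rfl⟩ | ⟨j, hj, rfl⟩
  · exact h₁ i (by omega)
  · exact h₂ j (by omega)

/-- The graph is connected on `p + q` vertices and has at most one edge for each of the `p + q - 1`
cells. -/
theorem pathGraph_isSpanningTree (S : Stair G p q x y)
    (h : IsGreedy (Cell G p q x y) (p + q - 1) I J B) :
    IsSpanningTree G (pathGraph x y (p + q - 1) I J) := by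
  classical
  have := S.finite
  have hp := S.p_pos
  have hconn := S.pathGraph_connected h
  refine ⟨fun u v huv => ?_, SimpleGraph.isTree_iff_connected_and_card.2 ⟨hconn, ?_⟩⟩
  · obtain ⟨e, he, ⟨rfl, rfl⟩ | ⟨rfl, rfl⟩⟩ := (S.pathGraph_adj h u v).1 huv
    · exact (S.greedy_cell h e he).1.2.2
    · exact (S.greedy_cell h e he).1.2.2.symm
  · refine le_antisymm ?_ hconn.card_vert_le_card_edgeSet_add_one
    rw [S.card_eq]
    have hsub : (pathGraph x y (p + q - 1) I J).edgeSet ⊆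
        ((Finset.range (p + q - 1)).image fun e => s(x (I e), y (J e)) : Finset (Sym2 V)) := by
      intro z
      induction z with
      | _ u v =>
        rw [SimpleGraph.mem_edgeSet, S.pathGraph_adj h]
        rintro ⟨e, he, ⟨rfl, rfl⟩ | ⟨rfl, rfl⟩⟩ <;> rw [Finset.mem_coe, Finset.mem_image] <;>
          refine ⟨e, Finset.mem_range.2 he, ?_⟩
        · rfl
        · exact Sym2.eq_swap
    have h₁ := Set.ncard_le_ncard hsub (Set.toFinite _)
    rw [Set.ncard_coe_finset] at h₁
    have h₂ := h₁.trans Finset.card_image_le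
    rw [Finset.card_range] at h₂
    rw [Nat.card_coe_set_eq]
    omega

/-- The optimality invariant of the greedy path at the cell `(i, j)`. -/
def Invariant (G T : SimpleGraph V) (p q : ℕ) (x y : ℕ → V) (i j : ℕ) (b : Bool) : Prop :=
  -- Here `l` bounds the leaves of the path from above and, through the certificate, those of every
  -- spanning tree from below. Since `(i', j')`, the cell of the last certificate, the path has
  -- zigzagged, so the two displacements differ by at most one; `b` tells which it is.
  ∃ l, leaves T x i + leaves T y j ≤ l ∧
    (b = true → Internal T (x i)) ∧ (b = false → Internal T (y j)) ∧
    ∃ i' j', i' ≤ i ∧ j' ≤ j ∧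
      ((Certificate G p q x y i' j' l ∧ i' < i ∧ i + j' = j + i' + (if b then 0 else 1)) ∨
      (Certificate G q p y x j' i' l ∧ j' < j ∧ j + i' = i + j' + (if b then 1 else 0)))

theorem Invariant.swap {T : SimpleGraph V} {i j : ℕ} {b : Bool}
    (h : Invariant G T p q x y i j b) : Invariant G T q p y x j i (!b) := by
  obtain ⟨l, h₁, h₂, h₃, i', j', hi, hj, h₄⟩ := h
  refine ⟨l, by omega, by simpa using h₃, by simpa using h₂, j', i', hj, hi, ?_⟩
  rcases h₄ with ⟨a, b', c⟩ | ⟨a, b', c⟩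
  · exact Or.inr ⟨a, b', by cases b <;> simpa using c⟩
  · exact Or.inl ⟨a, b', by cases b <;> simpa using c⟩

/-- The certificate after a forced straight step to the right. -/
theorem certificate_of_invariant (S : Stair G p q x y) {i j l i' j' : ℕ} (hi : i' ≤ i)
    (hcert : (Certificate G p q x y i' j' l ∧ i' < i ∧ i + j' = j + i') ∨
      (Certificate G q p y x j' i' l ∧ j' < j ∧ j + i' = i + j' + 1))
    (hc : Cell G p q x y i j) (hn : ¬ Cell G p q x y (i + 1) j) :
    Certificate G q p y x j i (l + 1) := by
  rcases hcert with ⟨a, b', c⟩ | ⟨a, b', c⟩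
  · exact S.certificate_other a b' c hc hn
  · exact S.swap.certificate_same a b' hi c hc.swap (fun h => hn h.swap)

/-- A step down or to the right from a cell where the path would like to go down. -/
theorem Invariant.step (S : Stair G p q x y) {T : SimpleGraph V} {i j : ℕ}
    (h : Invariant G T p q x y i j true) (hc : Cell G p q x y i j) (hij : T.Adj (x i) (y j)) :
    (Cell G p q x y (i + 1) j → T.Adj (x (i + 1)) (y j) →
      Invariant G T p q x y (i + 1) j false) ∧
    (¬ Cell G p q x y (i + 1) j → Invariant G T p q x y i (j + 1) true) := by
  have := S.finite
  obtain ⟨l, h₁, h₂, -, i', j', hi, hj, h₄⟩ := h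
  have hx := h₂ rfl
  constructor
  · intro hd hd'
    refine ⟨l, by rwa [leaves_succ_of_internal hx], by simp, fun _ => ?_, i', j', by omega, hj, ?_⟩
    · refine Internal.of_adj hij.symm hd'.symm fun heq => ?_
      have := S.x_inj i hc.1 (i + 1) hd.1 heq
      omega
    · simp only [if_true, Bool.false_eq_true, if_false] at h₄ ⊢
      rcases h₄ with ⟨a, b', c⟩ | ⟨a, b', c⟩
      · exact Or.inl ⟨a, by omega, by omega⟩
      · exact Or.inr ⟨a, by omega, by omega⟩
  · intro hn
    -- The column left by a forced straight step may be a new leaf, and the missing cell below it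
    -- pays for it with a new certificate at `(i, j)`.
    refine ⟨l + 1, ?_, fun _ => hx, by simp, i, j, le_rfl, by omega, Or.inr ⟨?_, by omega, ?_⟩⟩
    · have := leaves_succ_le T y j
      omega
    · exact S.certificate_of_invariant hi (by simpa using h₄) hc hn
    · simp only [if_true]; omega

/-- The invariant at the last cell bounds the number of leaves of the path. -/
theorem Invariant.last (S : Stair G p q x y) {T : SimpleGraph V}
    (h : Invariant G T p q x y (p - 1) (q - 1) true) (hc : Cell G p q x y (p - 1) (q - 1))
    {T' : SimpleGraph V} (hT' : IsSpanningTree G T') :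
    leaves T x p + leaves T y q ≤ leaves T' x p + leaves T' y q := by
  obtain ⟨l, h₁, h₂, -, i', j', hi, hj, h₄⟩ := h
  have hp := S.p_pos
  have hq := S.q_pos
  -- There is no cell below the last row, so the last cell counts as one more forced step. It pays
  -- for the last column, the only possible further leaf since the last row is internal.
  have hcert := S.certificate_of_invariant hi (by simpa using h₄) hc
    (fun h => by have := h.1; omega)
  have h₅ := S.swap.le_leaves hcert hT'
  have h₆ := leaves_succ_of_internal (h₂ rfl)
  have h₇ := leaves_succ_le T y (q - 1)
  rw [Nat.sub_add_cancel hp] at h₅ h₆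
  rw [Nat.sub_add_cancel hq] at h₅ h₇
  omega

/-- The path zigzags along the diagonal as long as both neighbours of the diagonal cell exist. -/
theorem greedy_diag (S : Stair G p q x y) (h : IsGreedy (Cell G p q x y) (p + q - 1) I J B)
    (h0 : B 0 = true) {k : ℕ}
    (hk : ∀ t < k, Cell G p q x y (t + 1) t ∧ Cell G p q x y t (t + 1)) {t : ℕ} (ht : t ≤ k) :
    Cell G p q x y t t ∧ I (2 * t) = t ∧ J (2 * t) = t ∧ B (2 * t) = true ∧
      leaves (pathGraph x y (p + q - 1) I J) x (t + 1) +
        leaves (pathGraph x y (p + q - 1) I J) y t ≤ 1 := by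
  have := S.finite
  set T := pathGraph x y (p + q - 1) I J with hT
  induction t with
  | zero =>
    refine ⟨S.cell_zero, h.I_zero, h.J_zero, h0, ?_⟩
    have := leaves_succ_le T x 0
    rw [leaves_zero] at this ⊢
    omega
  | succ t ih =>
    obtain ⟨hc, hI, hJ, hB, hl⟩ := ih (by omega)
    obtain ⟨c₁, c₂⟩ := hk t (by omega)
    have c₃ := (S.cell_cross (Nat.le_succ t) (Nat.le_succ t) c₂ c₁).2
    have hp : t + 1 < p := c₁.1
    have hq : t + 1 < q := c₂.2.1
    obtain ⟨i₁, j₁, b₁⟩ := h.down (2 * t) (by omega) (Or.inl ⟨hB, by rwa [hI, hJ]⟩)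
    rw [hI] at i₁
    rw [hJ] at j₁
    obtain ⟨i₂, j₂, b₂⟩ := h.right (2 * t + 1) (by omega) (Or.inl ⟨b₁, by rwa [i₁, j₁]⟩)
    rw [i₁] at i₂
    rw [j₁] at j₂
    refine ⟨c₃, i₂, j₂, b₂, ?_⟩
    have a₀ := S.pathGraph_adj_self h (e := 2 * t) (by omega)
    have a₁ := S.pathGraph_adj_self h (e := 2 * t + 1) (by omega)
    have a₂ := S.pathGraph_adj_self h (e := 2 * t + 1 + 1) (by omega)
    rw [hI, hJ] at a₀
    rw [i₁, j₁] at a₁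
    rw [i₂, j₂] at a₂
    have hy : Internal T (y t) := Internal.of_adj a₀.symm a₁.symm fun heq => by
      have := S.x_inj t (by omega) (t + 1) hp heq
      omega
    have hx : Internal T (x (t + 1)) := Internal.of_adj a₁ a₂ fun heq => by
      have := S.y_inj t (by omega) (t + 1) hq heq
      omega
    rw [leaves_succ_of_internal hx, leaves_succ_of_internal hy]
    exact hl

/-- Going down first, the path reaches `(k, k)` wanting to go down, with at most one leaf so far;
the rows that end at column `k` account for that leaf. If a lower cell exists, the invariant starts
there and is carried along to the last cell. -/
theorem leaves_le_of_down (S : Stair G p q x y)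
    (h : IsGreedy (Cell G p q x y) (p + q - 1) I J B) (h0 : B 0 = true) {k : ℕ}
    (hk : ∀ t < k, Cell G p q x y (t + 1) t ∧ Cell G p q x y t (t + 1))
    (hk' : ¬ Cell G p q x y k (k + 1)) {T' : SimpleGraph V} (hT' : IsSpanningTree G T') :
    leaves (pathGraph x y (p + q - 1) I J) x p + leaves (pathGraph x y (p + q - 1) I J) y q ≤
      leaves T' x p + leaves T' y q := by
  have := S.finite
  obtain ⟨hc, hI, hJ, hB, hl⟩ := S.greedy_diag h h0 hk le_rfl
  set T := pathGraph x y (p + q - 1) I J with hT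
  by_cases hd : Cell G p q x y (k + 1) k
  · have hp := hd.1
    have hq := hd.2.1
    obtain ⟨i₁, j₁, b₁⟩ := h.down (2 * k) (by omega) (Or.inl ⟨hB, by rwa [hI, hJ]⟩)
    rw [hI] at i₁
    rw [hJ] at j₁
    have key : ∀ e, 2 * k + 1 ≤ e → e < p + q - 1 → Invariant G T p q x y (I e) (J e) (B e) := by
      intro e he
      induction e, he using Nat.le_induction with
      | base =>
        intro he
        rw [i₁, j₁, b₁]
        have a₀ := S.pathGraph_adj_self h (e := 2 * k) (by omega)
        have a₁ := S.pathGraph_adj_self h he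
        rw [hI, hJ] at a₀
        rw [i₁, j₁] at a₁
        refine ⟨1, hl, by simp, fun _ => Internal.of_adj a₀.symm a₁.symm fun heq => ?_, k, k,
          by omega, le_rfl, Or.inl ⟨S.certificate_diag hc hk', by omega, ?_⟩⟩
        · have := S.x_inj k (by omega) (k + 1) hp heq
          omega
        · simp only [Bool.false_eq_true, if_false]; omega
      | succ e hke ih =>
        intro he
        have hinv := ih (by omega)
        have hcell := (S.greedy_cell h e (by omega)).1
        have a₀ := S.pathGraph_adj_self h (e := e) (by omega)
        have a₁ := S.pathGraph_adj_self h he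
        rcases greedy_cases h he with ⟨e₁, e₂, e₃, hb | hb⟩ | ⟨e₁, e₂, e₃, hb | hb⟩ <;>
          rw [e₁, e₂] at a₁ <;> rw [e₁, e₂, e₃] <;> rw [hb.1] at hinv
        · exact (Invariant.step S hinv hcell a₀).1 hb.2 a₁
        · exact ((Invariant.step S.swap hinv.swap hcell.swap a₀.symm).2
            (fun hc => hb.2 hc.swap)).swap
        · exact ((Invariant.step S.swap hinv.swap hcell.swap a₀.symm).1 hb.2.swap a₁.symm).swap
        · exact (Invariant.step S hinv hcell a₀).2 hb.2
    have hlast := key (p + q - 2) (by omega) (by omega)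
    have hcell := (S.greedy_cell h (p + q - 2) (by omega)).1
    obtain ⟨e₁, e₂⟩ := S.greedy_last h
    rw [e₁, e₂] at hlast hcell
    cases hb : B (p + q - 2) with
    | true => rw [hb] at hlast; exact Invariant.last S hlast hcell hT'
    | false =>
      rw [hb] at hlast
      have := Invariant.last S.swap hlast.swap hcell.swap hT'
      omega
  -- Now `(k, k)` is the last cell and both sides have `k + 1` vertices. Every spanning tree then
  -- has a leaf on each side, and the path has at most two leaves.
  · have hlast : ¬ k + k + 2 < p + q := fun hlt => by
      rcases S.advance hc hlt with h | h
      · exact hd h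
      · exact hk' h
    have hp := hc.1
    have hq := hc.2.1
    obtain rfl : p = k + 1 := by omega
    obtain rfl : q = k + 1 := by omega
    have h₁ := S.leaves_add hT' (a₀ := 0) (a := k + 1) (c₀ := 0) (c := k + 1) (by omega) le_rfl
      (by omega) le_rfl fun i _ _ j hj => ⟨Nat.zero_le _, hj.2.1⟩
    have h₂ := S.swap.leaves_add hT' (a₀ := 0) (a := k + 1) (c₀ := 0) (c := k + 1) (by omega) le_rfl
      (by omega) le_rfl fun i _ _ j hj => ⟨Nat.zero_le _, hj.2.1⟩
    have h₃ := leaves_succ_le T y k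
    omega

/-- The greedy path that starts in the right direction gives a maximum internal spanning tree. -/
theorem isMIST_pathGraph (S : Stair G p q x y)
    (h : IsGreedy (Cell G p q x y) (p + q - 1) I J B) {k : ℕ}
    (hk : ∀ t < k, Cell G p q x y (t + 1) t ∧ Cell G p q x y t (t + 1))
    (hk' : (B 0 = true ∧ ¬ Cell G p q x y k (k + 1)) ∨
      (B 0 = false ∧ ¬ Cell G p q x y (k + 1) k)) :
    IsMIST G (pathGraph x y (p + q - 1) I J) := by
  refine ⟨S.pathGraph_isSpanningTree h, fun T' hT' => ?_⟩
  have h₁ := S.internalCount_add T'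
  have h₂ := S.internalCount_add (pathGraph x y (p + q - 1) I J)
  suffices hs : leaves (pathGraph x y (p + q - 1) I J) x p +
      leaves (pathGraph x y (p + q - 1) I J) y q ≤ leaves T' x p + leaves T' y q by omega
  rcases hk' with ⟨h0, hn⟩ | ⟨h0, hn⟩
  · exact S.leaves_le_of_down h h0 hk hn hT'
  -- A path that starts to the right is one that starts downwards in the transposed shape.
  · have h₃ := S.swap.leaves_le_of_down h.swap (by simp [h0])
      (fun t ht => ⟨(hk t ht).2.swap, (hk t ht).1.swap⟩) (fun hc => hn hc.swap) hT'
    rw [S.pathGraph_swap h] at h₃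
    omega

end Stair

end MIST

/-! ### Breadth-first search -/

namespace RAM

/-- The invariant of breadth-first search while it scans the list of the vertex `Q h`, of which
the entries in `l` have been seen: `Q` is the queue, with entries up to `t`, and `D` is one more
than the distance from `r`, or zero. -/
structure BFSInv (n : ℕ) (nb : ℕ → List ℕ) (r : ℕ) (Q D : ℕ → ℕ) (h t : ℕ) (l : List ℕ) : Prop where
  le : h ≤ t
  pos : 0 < t
  lt : ∀ i < t, Q i < n
  inj : ∀ i < t, ∀ j < t, Q i = Q j → i = j
  ne_zero : ∀ i < t, D (Q i) ≠ 0
  mem : ∀ v, D v ≠ 0 → ∃ i < t, Q i = v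
  mono : ∀ i j, i ≤ j → j < t → D (Q i) ≤ D (Q j)
  near : ∀ i < t, ∀ j < t, h ≤ j → D (Q i) ≤ D (Q j) + 1
  done : ∀ i < h, ∀ w ∈ nb (Q i), D w ≠ 0 ∧ D w ≤ D (Q i) + 1
  seen : h < t → ∀ w ∈ l, D w ≠ 0 ∧ D w ≤ D (Q h) + 1
  root : D r = 1
  eq_root : ∀ v, D v = 1 → v = r
  pred : ∀ v, 1 < D v → ∃ u < n, v ∈ nb u ∧ D v = D u + 1 ∧ D u ≠ 0

namespace BFSInv

variable {n r h t w : ℕ} {nb : ℕ → List ℕ} {Q D : ℕ → ℕ} {l : List ℕ}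

theorem size_le (H : BFSInv n nb r Q D h t l) : t ≤ n := by
  have := Finset.card_le_card_of_injOn (s := Finset.range t) (t := Finset.range n) Q
    (fun i hi => by simpa using H.lt i (by simpa using hi))
    (fun i hi j hj hij => H.inj i (by simpa using hi) j (by simpa using hj) hij)
  simpa using this

theorem initial (hr : r < n) : BFSInv n nb r (Function.update (fun _ => 0) 0 r)
    (Function.update (fun _ => 0) r 1) 0 1 [] where
  le := Nat.zero_le _
  pos := Nat.one_pos
  lt i hi := by obtain rfl : i = 0 := by omega
                simpa using hr
  inj i hi j hj _ := by omega
  ne_zero i hi := by obtain rfl : i = 0 := by omega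
                     simp
  mem v hv := ⟨0, Nat.one_pos, by
    by_contra hne
    simp only [Function.update_self] at hne
    exact hv (Function.update_of_ne (Ne.symm hne) _ _)⟩
  mono i j hij hj := by obtain rfl : j = 0 := by omega
                        obtain rfl : i = 0 := by omega
                        exact le_rfl
  near i hi j hj _ := by obtain rfl : j = 0 := by omega
                         obtain rfl : i = 0 := by omega
                         omega
  done i hi := by omega
  seen _ w hw := by simp at hw
  root := by simp
  eq_root v hv := by
    by_contra hne
    rw [Function.update_of_ne hne] at hv
    omega
  pred v hv := by
    by_cases hne : v = r
    · subst hne; simp at hv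
    · rw [Function.update_of_ne hne] at hv
      omega

/-- The bound for a vertex that is already marked is the invariant `near`, applied to the head of
the queue. -/
theorem skip (H : BFSInv n nb r Q D h t l) (ht : h < t) (hw : D w ≠ 0) :
    BFSInv n nb r Q D h t (l ++ [w]) :=
  { H with
    seen := fun _ u hu => by
      rw [List.mem_append, List.mem_singleton] at hu
      rcases hu with hu | rfl
      · exact H.seen ht u hu
      · obtain ⟨i, hi, rfl⟩ := H.mem u hw
        exact ⟨hw, H.near i hi h ht le_rfl⟩ }

/-- The value of the new vertex is one more than that of the head; by `near` no value in the queue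
is larger, so the queue stays sorted and within distance one of its unprocessed part. -/
theorem push (H : BFSInv n nb r Q D h t l) (ht : h < t) (hw : D w = 0) (hwn : w < n)
    (hmem : w ∈ nb (Q h)) :
    BFSInv n nb r (Function.update Q t w) (Function.update D w (D (Q h) + 1)) h (t + 1)
      (l ++ [w]) := by
  have hQ : ∀ i < t, Function.update Q t w i = Q i := fun i hi =>
    Function.update_of_ne (by omega) _ _
  have hQt : Function.update Q t w t = w := Function.update_self _ _ _
  have hD : ∀ v, D v ≠ 0 → Function.update D w (D (Q h) + 1) v = D v := fun v hv =>
    Function.update_of_ne (fun h' => hv (by rw [h']; exact hw)) _ _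
  have hDw : Function.update D w (D (Q h) + 1) w = D (Q h) + 1 := Function.update_self _ _ _
  have hDQ : ∀ i < t, Function.update D w (D (Q h) + 1) (Q i) = D (Q i) := fun i hi =>
    hD _ (H.ne_zero i hi)
  have hcase : ∀ i < t + 1, i < t ∨ i = t := fun i hi => by omega
  have hQh := H.ne_zero h ht
  refine ⟨by omega, by omega, ?_, ?_, ?_, ?_, ?_, ?_, ?_, ?_, ?_, ?_, ?_⟩
  · intro i hi
    rcases hcase i hi with hi | rfl
    · rw [hQ i hi]; exact H.lt i hi
    · rwa [hQt]
  · intro i hi j hj hij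
    rcases hcase i hi with hi | rfl <;> rcases hcase j hj with hj | rfl
    · rw [hQ i hi, hQ j hj] at hij
      exact H.inj i hi j hj hij
    · rw [hQ i hi, hQt] at hij
      exact absurd (hij ▸ hw) (H.ne_zero i hi)
    · rw [hQ j hj, hQt] at hij
      exact absurd (hij ▸ hw) (H.ne_zero j hj)
    · rfl
  · intro i hi
    rcases hcase i hi with hi | rfl
    · rw [hQ i hi, hDQ i hi]; exact H.ne_zero i hi
    · rw [hQt, hDw]; omega
  · intro v hv
    by_cases hvw : v = w
    · exact ⟨t, by omega, by rw [hQt, hvw]⟩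
    · rw [Function.update_of_ne hvw] at hv
      obtain ⟨i, hi, rfl⟩ := H.mem v hv
      exact ⟨i, by omega, hQ i hi⟩
  · intro i j hij hj
    rcases hcase j hj with hj | rfl
    · rw [hQ i (by omega), hQ j hj, hDQ i (by omega), hDQ j hj]
      exact H.mono i j hij hj
    · rcases hcase i (by omega) with hi | rfl
      · rw [hQ i hi, hQt, hDQ i hi, hDw]
        exact H.near i hi h ht le_rfl
      · exact le_rfl
  · intro i hi j hj hhj
    rcases hcase i hi with hi | rfl <;> rcases hcase j hj with hj | rfl
    · rw [hQ i hi, hQ j hj, hDQ i hi, hDQ j hj]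
      exact H.near i hi j hj hhj
    · rw [hQ i hi, hQt, hDQ i hi, hDw]
      have := H.near i hi h ht le_rfl
      omega
    · rw [hQ j hj, hQt, hDQ j hj, hDw]
      have := H.mono h j hhj hj
      omega
    · omega
  · intro i hi u hu
    rw [hQ i (by omega)] at hu ⊢
    obtain ⟨h₁, h₂⟩ := H.done i hi u hu
    rw [hD u h₁, hDQ i (by omega)]
    exact ⟨h₁, h₂⟩
  · intro _ u hu
    rw [hQ h ht, hDQ h ht]
    rw [List.mem_append, List.mem_singleton] at hu
    rcases hu with hu | rfl
    · obtain ⟨h₁, h₂⟩ := H.seen ht u hu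
      rw [hD u h₁]
      exact ⟨h₁, h₂⟩
    · rw [hDw]
      omega
  · rw [hD r (by rw [H.root]; omega)]
    exact H.root
  · intro v hv
    by_cases hvw : v = w
    · subst hvw
      rw [hDw] at hv
      omega
    · rw [Function.update_of_ne hvw] at hv
      exact H.eq_root v hv
  · intro v hv
    by_cases hvw : v = w
    · subst hvw
      exact ⟨Q h, H.lt h ht, hmem, by rw [hDw, hDQ h ht], by rwa [hDQ h ht]⟩
    · rw [Function.update_of_ne hvw] at hv ⊢
      obtain ⟨u, h₁, h₂, h₃, h₄⟩ := H.pred v hv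
      exact ⟨u, h₁, h₂, by rw [hD u h₄, h₃], by rwa [hD u h₄]⟩

theorem next (H : BFSInv n nb r Q D h t (nb (Q h))) (ht : h < t) :
    BFSInv n nb r Q D (h + 1) t [] :=
  { H with
    le := ht
    near := fun i hi j hj hhj => H.near i hi j hj (by omega)
    done := fun i hi w hw => by
      rcases Nat.lt_succ_iff_lt_or_eq.1 hi with hi | rfl
      · exact H.done i hi w hw
      · exact H.seen ht w hw
    seen := fun _ w hw => by simp at hw }

end BFSInv

/-- The result of breadth-first search: the queue `Q` lists all vertices by increasing `D`, which
is one more than the distance from `r`. -/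
structure BFSResult (n : ℕ) (nb : ℕ → List ℕ) (r : ℕ) (Q D : ℕ → ℕ) : Prop where
  lt : ∀ i < n, Q i < n
  inj : ∀ i < n, ∀ j < n, Q i = Q j → i = j
  surj : ∀ v < n, ∃ i < n, Q i = v
  mono : ∀ i j, i ≤ j → j < n → D (Q i) ≤ D (Q j)
  pos : ∀ v < n, 0 < D v
  le : ∀ v < n, ∀ w ∈ nb v, D w ≤ D v + 1
  root : D r = 1
  eq_root : ∀ v, D v = 1 → v = r
  pred : ∀ v, 1 < D v → ∃ u < n, v ∈ nb u ∧ D v = D u + 1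

/-- Once the queue is exhausted, the marked vertices contain `r` and are closed under adjacency;
`hconn` is connectedness in this form. -/
theorem BFSInv.result {n r t : ℕ} {nb : ℕ → List ℕ} {Q D : ℕ → ℕ}
    (H : BFSInv n nb r Q D t t [])
    (hconn : ∀ φ : ℕ → Prop, φ r → (∀ u < n, φ u → ∀ w ∈ nb u, φ w) → ∀ v < n, φ v) :
    BFSResult n nb r Q D := by
  have hall : ∀ v < n, D v ≠ 0 := by
    refine hconn (fun v => D v ≠ 0) (by rw [H.root]; omega) fun u _ hu w hw => ?_
    obtain ⟨i, hi, rfl⟩ := H.mem u hu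
    exact (H.done i hi w hw).1
  have htn : t = n := by
    refine le_antisymm H.size_le ?_
    have := Finset.card_le_card_of_surjOn (s := Finset.range t) (t := Finset.range n) Q
      (fun v hv => by
        obtain ⟨i, hi, rfl⟩ := H.mem v (hall v (by simpa using hv))
        exact ⟨i, by simpa using hi, rfl⟩)
    simpa using this
  subst htn
  refine ⟨H.lt, H.inj, fun v hv => H.mem v (hall v hv), H.mono,
    fun v hv => Nat.pos_of_ne_zero (hall v hv), fun v hv w hw => ?_, H.root, H.eq_root,
    fun v hv => ?_⟩
  · obtain ⟨i, hi, rfl⟩ := H.mem v (hall v hv)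
    exact (H.done i hi w hw).2
  · obtain ⟨u, h₁, h₂, h₃, -⟩ := H.pred v hv
    exact ⟨u, h₁, h₂, h₃⟩

/-- The part of the memory that all phases of the algorithm share. -/
structure Context (n : ℕ) (nb : ℕ → List ℕ) (s : State) : Prop where
  size : s.reg 0 = n
  zero : s.reg 1 = 0
  lists : Lists (s.arr 0) (s.arr 1) n nb

theorem Context.of_frame {n : ℕ} {nb : ℕ → List ℕ} {s s' : State} {P : Program}
    (h : Context n nb s) (hf : Frame P s s') (h0 : 0 ∉ P.regs) (h1 : 1 ∉ P.regs)
    (ha0 : 0 ∉ P.arrs) (ha1 : 1 ∉ P.arrs) : Context n nb s' :=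
  ⟨by rw [hf.reg 0 h0, h.size], by rw [hf.reg 1 h1, h.zero], by
    rw [hf.arr 0 ha0, hf.arr 1 ha1]; exact h.lists⟩

/-- The size of the input. -/
def inputSize (n : ℕ) (nb : ℕ → List ℕ) : ℕ := ∑ v ∈ Finset.range n, ((nb v).length + 1)

/-- The vertices scanned are distinct, so their lists together are no longer than the input. This
turns the cost per list into a linear bound. -/
theorem sum_le_inputSize {n h : ℕ} {nb : ℕ → List ℕ} {Q : ℕ → ℕ} (hlt : ∀ i < h, Q i < n)
    (hinj : ∀ i < h, ∀ j < h, Q i = Q j → i = j) :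
    ∑ i ∈ Finset.range h, ((nb (Q i)).length + 1) ≤ inputSize n nb := by
  rw [← Finset.sum_image (s := Finset.range h) (g := Q) (f := fun v => (nb v).length + 1)]
  · refine Finset.sum_le_sum_of_subset fun v hv => ?_
    obtain ⟨i, hi, rfl⟩ := Finset.mem_image.1 hv
    exact Finset.mem_range.2 (hlt i (Finset.mem_range.1 hi))
  · intro i hi j hj hij
    exact hinj i (by simpa using hi) j (by simpa using hj) hij

/-- The body of the inner loop of breadth-first search. -/
def bfsVisit (a b : ℕ) : Program :=
  .seq (.load 10 b 6) (.ite (.eq 10 1) (.seq (.store b 6 9) (.seq (.store a 8 6) (.succ 8 8))) .skip)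

/-- The body of the outer loop of breadth-first search. -/
def bfsScan (a b : ℕ) : Program :=
  .seq (.load 3 a 7) (.seq (.load 9 b 3) (.seq (.succ 9 9)
    (.seq (forList (bfsVisit a b)) (.succ 7 7))))

/-- Breadth-first search from the vertex in register `12`, with the queue in the array `a` and the
distances (plus one) in the array `b`. -/
def bfs (a b : ℕ) : Program :=
  .seq (.const 2 1) (.seq (.const 7 0) (.seq (.store a 7 12) (.seq (.const 8 1)
    (.seq (.store b 12 2) (.loop (.lt 7 8) (bfsScan a b))))))

theorem wp_bfsScan {a b n r h t : ℕ} {nb : ℕ → List ℕ} {s : State} {τ : ℕ}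
    {R : ℕ → State → Prop} (ha1 : a ≠ 1)
    (hb1 : b ≠ 1) (hab : a ≠ b) (hs : Context n nb s)
    (hnb : ∀ v < n, ∀ w ∈ nb v, w < n) (h7 : s.reg 7 = h) (h8 : s.reg 8 = t) (ht : h < t)
    (H : BFSInv n nb r (s.arr a) (s.arr b) h t [])
    (hR : ∀ s' τ' t', Frame (bfsScan a b) s s' → s'.reg 7 = h + 1 → s'.reg 8 = t' →
      BFSInv n nb r (s'.arr a) (s'.arr b) (h + 1) t' [] → (∀ i ≤ h, s'.arr a i = s.arr a i) →
      τ' ≤ τ + 10 * ((nb (s.arr a h)).length + 1) → R τ' s') :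
    Wp (bfsScan a b) R τ s := by
  have hv := H.lt h ht
  refine Wp.mono (Q := fun τ' s' => ∃ t', s'.reg 7 = h + 1 ∧ s'.reg 8 = t' ∧
      BFSInv n nb r (s'.arr a) (s'.arr b) (h + 1) t' [] ∧ (∀ i ≤ h, s'.arr a i = s.arr a i) ∧
      τ' ≤ τ + 10 * ((nb (s.arr a h)).length + 1)) ?_
    fun τ' s' _ hf ⟨t', h₁, h₂, h₃, h₄, h₅⟩ => hR s' τ' t' hf h₁ h₂ h₃ h₄ h₅
  unfold bfsScan
  simp only [wp_seq, wp_load, wp_succ]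
  refine wp_forList (n := n) (v := s.arr a h) (nb := nb)
    (fun l s' => ∃ t', s'.reg 8 = t' ∧ h < t' ∧ BFSInv n nb r (s'.arr a) (s'.arr b) h t' l ∧
      (∀ i ≤ h, s'.arr a i = s.arr a i) ∧ s'.arr b (s.arr a h) = s.arr b (s.arr a h)) 5
    (by simpa using hs.lists) (by simp [h7]) hv
    (by simp [bfsVisit, Program.regs]) (by simp [bfsVisit, Program.regs])
    (by simp [bfsVisit, Program.arrs, ha1.symm, hb1.symm]) ?_ ?_ ?_ ?_
  · rintro l s' x r hr ⟨t', h₁, h₂, h₃, h₄⟩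
    have h8r : (8 : ℕ) ≠ r := by
      simp only [List.mem_cons, List.not_mem_nil, or_false] at hr
      omega
    exact ⟨t', by simp [h8r, h₁], h₂, h₃, h₄⟩
  · exact ⟨t, by simp [h8], ht, by simpa using H, by simp, by simp⟩
  · rintro l w l' s' τ' hl hf hw ⟨t', h₁, h₂, h₃, h₄, h₅⟩
    have e1 : s'.reg 1 = 0 := by
      rw [hf.reg 1 (by simp [forList, forUp, bfsVisit, Program.regs])]
      simp [hs.zero]
    have e9 : s'.reg 9 = s.arr b (s.arr a h) + 1 := by
      rw [hf.reg 9 (by simp [forList, forUp, bfsVisit, Program.regs])]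
      simp [h7]
    have e7 : s'.reg 7 = h := by
      rw [hf.reg 7 (by simp [forList, forUp, bfsVisit, Program.regs])]
      simp [h7]
    have hmem : w ∈ nb (s.arr a h) := by simp [hl]
    have hQh := h₄ h le_rfl
    simp only [bfsVisit, wp_seq, wp_load, wp_ite, wp_store, wp_succ, wp_skip, Test.holds_eq,
      State.setReg_reg, State.setReg_arr, State.setArr_arr, State.setArr_reg, hw, e1, e9, h₁,
      if_true, if_neg hab, if_neg hab.symm, OfNat.one_ne_ofNat,
      Nat.reduceEqDiff, if_false]
    refine ⟨fun h0 => ⟨by omega, t' + 1, rfl, by omega, ?_, fun i hi => ?_, ?_⟩,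
      fun h0 => ⟨by omega, t', rfl, h₂, h₃.skip h₂ h0, h₄, h₅⟩⟩
    · have := h₃.push h₂ h0 (hnb _ hv w hmem) (by rwa [hQh])
      rwa [hQh, h₅] at this
    · rw [Function.update_of_ne (by omega)]
      exact h₄ i hi
    · rw [Function.update_of_ne, h₅]
      rintro rfl
      have := h₃.ne_zero h h₂
      rw [hQh] at this
      exact this h0
  · rintro s' τ' hf ⟨t', h₁, h₂, h₃, h₄, h₅⟩ hτ
    have e7 : s'.reg 7 = h := by
      rw [hf.reg 7 (by simp [forList, forUp, bfsVisit, Program.regs])]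
      simp [h7]
    rw [wp_succ, e7]
    refine ⟨t', by simp, by simp [h₁], ?_, by simpa using h₄, by omega⟩
    rw [← h₄ h le_rfl] at h₃
    exact h₃.next h₂

theorem wp_bfs {a b n r : ℕ} {nb : ℕ → List ℕ} {s : State} {τ : ℕ} {R : ℕ → State → Prop}
    (ha0 : a ≠ 0) (ha1 : a ≠ 1) (hb0 : b ≠ 0) (hb1 : b ≠ 1) (hab : a ≠ b) (hs : Context n nb s)
    (hnb : ∀ v < n, ∀ w ∈ nb v, w < n) (h12 : s.reg 12 = r) (hr : r < n)
    (ha : s.arr a = fun _ => 0) (hb : s.arr b = fun _ => 0)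
    (hconn : ∀ φ : ℕ → Prop, φ r → (∀ u < n, φ u → ∀ w ∈ nb u, φ w) → ∀ v < n, φ v)
    (hR : ∀ s' τ', Frame (bfs a b) s s' → s'.reg 2 = 1 →
      BFSResult n nb r (s'.arr a) (s'.arr b) → τ' ≤ τ + 11 * inputSize n nb + 6 → R τ' s') :
    Wp (bfs a b) R τ s := by
  refine Wp.mono (Q := fun τ' s' => s'.reg 2 = 1 ∧ BFSResult n nb r (s'.arr a) (s'.arr b) ∧
      τ' ≤ τ + 11 * inputSize n nb + 6) ?_
    fun τ' s' _ hf ⟨h₁, h₂, h₃⟩ => hR s' τ' hf h₁ h₂ h₃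
  unfold bfs
  simp only [wp_seq, wp_const, wp_store]
  -- The budget is what the lists of the processed vertices leave of `11 * inputSize n nb`: ten
  -- units for a scan and one for the test.
  refine wp_loop (fun B s' => ∃ h t, s'.reg 7 = h ∧ s'.reg 8 = t ∧
      BFSInv n nb r (s'.arr a) (s'.arr b) h t [] ∧
      B + 11 * ∑ i ∈ Finset.range h, ((nb (s'.arr a i)).length + 1) = 11 * inputSize n nb)
    (11 * inputSize n nb) ?_ ?_ ?_
  · refine ⟨0, 1, by simp, by simp, ?_, by simp⟩
    have := BFSInv.initial (nb := nb) hr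
    simpa [ha, hb, h12, hab, hab.symm] using this
  · rintro B s' τ' hf ⟨h, t, h₁, h₂, h₃, h₄⟩ hlt
    rw [Test.holds_lt, h₁, h₂] at hlt
    have hc : Context n nb s' := by
      refine Context.of_frame (n := n) (nb := nb) ?_ hf ?_ ?_ ?_ ?_
      · refine ⟨?_, ?_, ?_⟩
        · simp [hs.size]
        · simp [hs.zero]
        · simpa [ha0.symm, ha1.symm, hb0.symm, hb1.symm] using hs.lists
      all_goals simp [bfsScan, bfsVisit, forList, forUp, Program.regs, Program.arrs,
        ha0.symm, ha1.symm, hb0.symm, hb1.symm]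
    refine wp_bfsScan ha1 hb1 hab hc hnb h₁ h₂ hlt h₃ ?_
    intro s'' τ'' t' _ g₁ g₂ g₃ g₄ g₅
    have hsum : ∑ i ∈ Finset.range (h + 1), ((nb (s''.arr a i)).length + 1) =
        ∑ i ∈ Finset.range h, ((nb (s'.arr a i)).length + 1) + ((nb (s'.arr a h)).length + 1) := by
      rw [Finset.sum_range_succ, g₄ h le_rfl]
      congr 1
      refine Finset.sum_congr rfl fun i hi => ?_
      rw [g₄ i (Finset.mem_range.1 hi).le]
    have hle := sum_le_inputSize (nb := nb) (h := h + 1) (Q := s''.arr a)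
      (fun i hi => g₃.lt i (lt_of_lt_of_le hi g₃.le))
      (fun i hi j hj => g₃.inj i (lt_of_lt_of_le hi g₃.le) j (lt_of_lt_of_le hj g₃.le))
    rw [hsum] at hle
    refine ⟨B - 11 * ((nb (s'.arr a h)).length + 1), ⟨h + 1, t', g₁, g₂, g₃, ?_⟩, ?_⟩
    · rw [hsum]; omega
    · omega
  · rintro s' τ' B hf ⟨h, t, h₁, h₂, h₃, h₄⟩ hlt hτ
    rw [Test.holds_lt, h₁, h₂] at hlt
    obtain rfl : h = t := le_antisymm h₃.le (not_lt.1 hlt)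
    refine ⟨?_, h₃.result hconn, by omega⟩
    rw [hf.reg 2 (by simp [bfsScan, bfsVisit, forList, forUp, Program.regs])]
    simp

end RAM

/-! ### The end vertex and the sorting keys -/

namespace RAM

variable {n : ℕ} {nb : ℕ → List ℕ} {s : State} {τ : ℕ} {R : ℕ → State → Prop}

/-- The body of the loop of `selectEnd`. -/
def selectStep : Program :=
  .seq (.load 9 5 7) (.ite (.eq 9 14) (.seq (.load 10 0 7) (.seq (.succ 11 7) (.seq (.load 11 0 11)
    (.seq (.sub 10 11 10) (.ite (.lt 10 15) (.seq (.move 15 10) (.move 12 7)) .skip))))) .skip)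

/-- Find a vertex of smallest degree in the last layer of the search in the arrays `4`, `5`. -/
def selectEnd : Program :=
  .seq (.sub 13 0 2) (.seq (.load 14 4 13) (.seq (.load 14 5 14) (.seq (.move 15 0)
    (.seq (.const 7 0) (forUp 7 0 selectStep)))))

theorem wp_selectEnd {r : ℕ} (hs : Context n nb s) (h2 : s.reg 2 = 1)
    (hbfs : BFSResult n nb r (s.arr 4) (s.arr 5)) (hn : 0 < n) (hdeg : ∀ v < n, (nb v).length < n)
    (hR : ∀ s' τ' v, Frame selectEnd s s' → s'.reg 12 = v → v < n →
      (∀ u < n, s.arr 5 u ≤ s.arr 5 v) →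
      (∀ u < n, s.arr 5 u = s.arr 5 v → (nb v).length ≤ (nb u).length) →
      τ' ≤ τ + 11 * n + 6 → R τ' s') :
    Wp selectEnd R τ s := by
  refine Wp.mono (Q := fun τ' s' => ∃ v, s'.reg 12 = v ∧ v < n ∧
      (∀ u < n, s.arr 5 u ≤ s.arr 5 v) ∧
      (∀ u < n, s.arr 5 u = s.arr 5 v → (nb v).length ≤ (nb u).length) ∧
      τ' ≤ τ + 11 * n + 6) ?_
    fun τ' s' _ hf ⟨v, h₁, h₂, h₃, h₄, h₅⟩ => hR s' τ' v hf h₁ h₂ h₃ h₄ h₅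
  -- The queue is sorted by distance, so its final entry lies in the last layer.
  set K := s.arr 5 (s.arr 4 (n - 1)) with hK
  have hKmax : ∀ u < n, s.arr 5 u ≤ K := fun u hu => by
    obtain ⟨i, hi, rfl⟩ := hbfs.surj u hu
    exact hbfs.mono i (n - 1) (by omega) (by omega)
  have hKn := hbfs.lt (n - 1) (by omega)
  unfold selectEnd
  simp only [wp_seq, wp_const, wp_move, wp_load, wp_sub]
  -- Register 15 holds the smallest degree so far. It starts with `n`, which exceeds every degree,
  -- so the first vertex of the last layer is always accepted.
  refine wp_forUp (N := n) (k₀ := 0) (fun k s' => s'.reg 14 = K ∧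
    ((s'.reg 15 = n ∧ ∀ u < k, s.arr 5 u ≠ K) ∨
      (s'.reg 12 < n ∧ s.arr 5 (s'.reg 12) = K ∧ s'.reg 15 = (nb (s'.reg 12)).length ∧
        ∀ u < k, s.arr 5 u = K → s'.reg 15 ≤ (nb u).length))) (fun _ => 9) (by decide) (by decide)
    (by decide) (by simp [hs.size]) (by simp) (by omega) ?_ ?_ ?_
  · refine ⟨by simp [hs.size, h2, hK], Or.inl ⟨by simp [hs.size], by omega⟩⟩
  · rintro k s' τ' hf hk - hkn ⟨h₁, h₃⟩
    have ea : ∀ a, s'.arr a = s.arr a := fun a => hf.arr a (by simp [forUp, selectStep, Program.arrs])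
    have hoff := hs.lists.off k hkn
    simp only [selectStep, wp_seq, wp_load, wp_ite, wp_move, wp_succ, wp_sub, wp_skip,
      Test.holds_eq, Test.holds_lt, State.setReg_reg, State.setReg_arr, hk, h₁, ea, if_true,
      Nat.reduceEqDiff, if_false, hoff, Nat.add_sub_cancel_left]
    refine ⟨fun hKk => ⟨fun hlt => ⟨by omega, trivial, Or.inr ⟨hkn, hKk, trivial, ?_⟩⟩,
      fun hlt => ⟨by omega, trivial, ?_⟩⟩, fun hKk => ⟨by omega, trivial, ?_⟩⟩
    · intro u hu huK
      rcases Nat.lt_succ_iff_lt_or_eq.1 hu with hu | rfl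
      · rcases h₃ with ⟨-, h⟩ | ⟨-, -, -, h⟩
        · exact absurd huK (h u hu)
        · exact hlt.le.trans (h u hu huK)
      · exact le_rfl
    · rcases h₃ with ⟨h, -⟩ | ⟨g₁, g₂, g₃, g₄⟩
      · exact absurd (hdeg k hkn) (by omega)
      · refine Or.inr ⟨g₁, g₂, g₃, fun u hu huK => ?_⟩
        rcases Nat.lt_succ_iff_lt_or_eq.1 hu with hu | rfl
        · exact g₄ u hu huK
        · omega
    · rcases h₃ with ⟨g₁, g₂⟩ | ⟨g₁, g₂, g₃, g₄⟩
      · refine Or.inl ⟨g₁, fun u hu => ?_⟩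
        rcases Nat.lt_succ_iff_lt_or_eq.1 hu with hu | rfl
        · exact g₂ u hu
        · exact hKk
      · refine Or.inr ⟨g₁, g₂, g₃, fun u hu huK => ?_⟩
        rcases Nat.lt_succ_iff_lt_or_eq.1 hu with hu | rfl
        · exact g₄ u hu huK
        · exact absurd huK hKk
  · rintro s' τ' hf hk ⟨h₁, h₃⟩ hτ
    simp only [Finset.sum_const, Nat.card_Ico, smul_eq_mul] at hτ
    rcases h₃ with ⟨-, h⟩ | ⟨g₁, g₂, g₃, g₄⟩
    · exact absurd rfl (h _ hKn)
    · refine ⟨_, rfl, g₁, fun u hu => by rw [g₂]; exact hKmax u hu, fun u hu huK => ?_, by omega⟩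
      rw [← g₃]
      exact g₄ u hu (huK.trans g₂)

/-- The number of vertices with a smaller value of `D`. -/
def below (n : ℕ) (D : ℕ → ℕ) (v : ℕ) : ℕ := ((Finset.range n).filter fun u => D u < D v).card

/-- The number of entries of the list of `v` with a larger value of `D`. -/
def ahead (nb : ℕ → List ℕ) (D : ℕ → ℕ) (v : ℕ) : ℕ := (nb v).countP fun w => D v < D w

/-- The number of entries of the list of `v` without a larger value of `D`. -/
def behind (nb : ℕ → List ℕ) (D : ℕ → ℕ) (v : ℕ) : ℕ := (nb v).countP fun w => ¬ D v < D w

/-- The earlier layers form an initial segment of the queue, so their size is the position at which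
the current layer starts. -/
theorem BFSResult.below_eq {r j₀ δ i : ℕ} {Q D : ℕ → ℕ} (H : BFSResult n nb r Q D)
    (h₁ : ∀ j < j₀, D (Q j) < δ) (h₂ : ∀ j, j₀ ≤ j → j < n → δ ≤ D (Q j)) (hj : j₀ ≤ n)
    (hi : D (Q i) = δ) : below n D (Q i) = j₀ := by
  have : (Finset.range n).filter (fun u => D u < D (Q i)) = (Finset.range j₀).image Q := by
    ext u
    simp only [Finset.mem_filter, Finset.mem_range, Finset.mem_image, hi]
    constructor
    · rintro ⟨hu, hlt⟩
      obtain ⟨j, hj, rfl⟩ := H.surj u hu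
      refine ⟨j, ?_, rfl⟩
      by_contra! hle
      exact absurd (h₂ j hle hj) (by omega)
    · rintro ⟨j, hj', rfl⟩
      exact ⟨H.lt j (by omega), h₁ j hj'⟩
  rw [below, this, Finset.card_image_of_injOn, Finset.card_range]
  intro a ha b hb hab
  simp only [Finset.coe_range, Set.mem_Iio] at ha hb
  exact H.inj a (by omega) b (by omega) hab

/-- Go to the next vertex of the queue in the array `6`, and note whether a new layer starts. -/
def keyHead : Program :=
  .seq (.load 3 6 7) (.seq (.load 9 7 3) (.seq
    (.ite (.ne 9 15) (.seq (.move 14 13) (.seq (.move 15 9) (.sub 16 2 16))) .skip) (.move 10 14)))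

/-- Count an entry of the list of the current vertex. -/
def keyVisit : Program :=
  .seq (.load 11 7 6) (.ite (.lt 9 11) (.succ 10 10) (.sub 10 10 2))

/-- Store the key in the array `8` and the side in the array `9`. -/
def keyStore : Program :=
  .seq (.store 8 3 10) (.seq (.store 9 3 16) (.seq (.succ 13 13) (.seq (.succ 13 13)
    (.seq (.succ 17 17) (.seq (.succ 17 17) (.succ 17 17))))))

/-- The body of the loop of `keys`. -/
def keyStep : Program := .seq keyHead (.seq (forList keyVisit) keyStore)

/-- Compute the sorting keys from the search in the arrays `6`, `7`. -/
def keys : Program :=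
  .seq (.const 13 0) (.seq (.const 14 0) (.seq (.const 15 1) (.seq (.const 16 0) (.seq (.const 17 0)
    (.seq (.const 7 0) (forUp 7 0 keyStep))))))

/-- The invariant of `keys` before the vertex number `i` of the queue is processed. -/
structure KeyInv (n : ℕ) (Q D : ℕ → ℕ) (i j₀ base prev par : ℕ) : Prop where
  le : j₀ ≤ i
  base_eq : base = 2 * j₀
  lt : ∀ j < j₀, D (Q j) < prev
  ge : ∀ j, j₀ ≤ j → j < n → prev ≤ D (Q j)
  prev_ge : ∀ j < i, D (Q j) ≤ prev
  prev_pos : 0 < prev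
  par_lt : par < 2
  par_add : (par + prev) % 2 = 1

theorem wp_keyHead {r i j₀ : ℕ} (h2 : s.reg 2 = 1)
    (hbfs : BFSResult n nb r (s.arr 6) (s.arr 7)) (hi : i < n) (h7 : s.reg 7 = i)
    (h13 : s.reg 13 = 2 * i)
    (hk : KeyInv n (s.arr 6) (s.arr 7) i j₀ (s.reg 14) (s.reg 15) (s.reg 16))
    (hR : ∀ s' τ' j₁, Frame keyHead s s' → s'.reg 3 = s.arr 6 i → s'.reg 9 = s.arr 7 (s.arr 6 i) →
      s'.reg 10 = 2 * j₁ → s'.reg 15 = s.arr 7 (s.arr 6 i) →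
      KeyInv n (s.arr 6) (s.arr 7) (i + 1) j₁ (s'.reg 14) (s'.reg 15) (s'.reg 16) →
      τ' ≤ τ + 8 → R τ' s') :
    Wp keyHead R τ s := by
  refine Wp.mono (Q := fun τ' s' => ∃ j₁, s'.reg 3 = s.arr 6 i ∧ s'.reg 9 = s.arr 7 (s.arr 6 i) ∧
      s'.reg 10 = 2 * j₁ ∧ s'.reg 15 = s.arr 7 (s.arr 6 i) ∧
      KeyInv n (s.arr 6) (s.arr 7) (i + 1) j₁ (s'.reg 14) (s'.reg 15) (s'.reg 16) ∧
      τ' ≤ τ + 8) ?_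
    fun τ' s' _ hf ⟨j₁, g₁, g₂, g₃, g₄, g₅, g₆⟩ => hR s' τ' j₁ hf g₁ g₂ g₃ g₄ g₅ g₆
  have hge := hk.ge i hk.le hi
  simp only [keyHead, wp_seq, wp_load, wp_ite, wp_move, wp_sub, wp_skip,
      Test.holds_ne, State.setReg_reg, State.setReg_arr, h7, h2, h13, if_true,
      Nat.reduceEqDiff, if_false]
  refine ⟨fun hne => ⟨i, trivial, trivial, rfl, trivial, ?_, by omega⟩,
    fun heq => ⟨j₀, trivial, trivial, hk.base_eq, ?_, ?_, by omega⟩⟩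
  -- No layer is skipped: the predecessor of the new vertex comes earlier in the queue. Hence the
  -- distance grows by exactly one and the side flips.
  · have hle : s.arr 7 (s.arr 6 i) ≤ s.reg 15 + 1 := by
      by_contra! hlt
      have := hk.prev_pos
      obtain ⟨u, hu, -, hDu⟩ := hbfs.pred (s.arr 6 i) (by omega)
      obtain ⟨j, hj, rfl⟩ := hbfs.surj u hu
      have hji : j < i := by
        by_contra! hij
        have := hbfs.mono i j hij hj
        omega
      have := hk.prev_ge j hji
      omega
    have h₁ := hk.par_lt
    have h₂ := hk.par_add
    refine ⟨by omega, rfl, fun j hj => ?_, fun j hj hjn => hbfs.mono i j hj hjn,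
      fun j hj => hbfs.mono j i (by omega) hi, by omega, by omega, by omega⟩
    have := hk.prev_ge j hj
    omega
  · simp only [ne_eq, not_not] at heq
    exact heq.symm
  · simp only [ne_eq, not_not] at heq
    refine ⟨by have := hk.le; omega, hk.base_eq, hk.lt, hk.ge, fun j hj => ?_, hk.prev_pos,
      hk.par_lt, hk.par_add⟩
    rw [← heq]
    exact hbfs.mono j i (by omega) hi

theorem wp_keyStep {r i j₀ : ℕ} (hs : Context n nb s) (h2 : s.reg 2 = 1)
    (hbfs : BFSResult n nb r (s.arr 6) (s.arr 7)) (hi : i < n) (h7 : s.reg 7 = i)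
    (h13 : s.reg 13 = 2 * i) (h17 : s.reg 17 = 3 * i)
    (hk : KeyInv n (s.arr 6) (s.arr 7) i j₀ (s.reg 14) (s.reg 15) (s.reg 16))
    (hb : ∀ v < n, behind nb (s.arr 7) v ≤ below n (s.arr 7) v)
    (hR : ∀ s' τ' j₁ κ c, Frame keyStep s s' → s'.reg 13 = 2 * (i + 1) → s'.reg 17 = 3 * (i + 1) →
      KeyInv n (s.arr 6) (s.arr 7) (i + 1) j₁ (s'.reg 14) (s'.reg 15) (s'.reg 16) →
      s'.arr 8 = Function.update (s.arr 8) (s.arr 6 i) κ →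
      s'.arr 9 = Function.update (s.arr 9) (s.arr 6 i) c →
      κ + behind nb (s.arr 7) (s.arr 6 i) =
        2 * below n (s.arr 7) (s.arr 6 i) + ahead nb (s.arr 7) (s.arr 6 i) →
      c < 2 → (c + s.arr 7 (s.arr 6 i)) % 2 = 1 →
      τ' ≤ τ + 20 * ((nb (s.arr 6 i)).length + 1) → R τ' s') :
    Wp keyStep R τ s := by
  refine Wp.mono (Q := fun τ' s' => ∃ j₁ κ c, s'.reg 13 = 2 * (i + 1) ∧ s'.reg 17 = 3 * (i + 1) ∧
      KeyInv n (s.arr 6) (s.arr 7) (i + 1) j₁ (s'.reg 14) (s'.reg 15) (s'.reg 16) ∧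
      s'.arr 8 = Function.update (s.arr 8) (s.arr 6 i) κ ∧
      s'.arr 9 = Function.update (s.arr 9) (s.arr 6 i) c ∧
      κ + behind nb (s.arr 7) (s.arr 6 i) =
        2 * below n (s.arr 7) (s.arr 6 i) + ahead nb (s.arr 7) (s.arr 6 i) ∧
      c < 2 ∧ (c + s.arr 7 (s.arr 6 i)) % 2 = 1 ∧
      τ' ≤ τ + 20 * ((nb (s.arr 6 i)).length + 1)) ?_
    fun τ' s' _ hf ⟨j₁, κ, c, g₁, g₂, g₃, g₄, g₅, g₆, g₇, g₈, g₉⟩ =>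
      hR s' τ' j₁ κ c hf g₁ g₂ g₃ g₄ g₅ g₆ g₇ g₈ g₉
  set v := s.arr 6 i with hv
  have hvn := hbfs.lt i hi
  rw [← hv] at hvn
  unfold keyStep
  rw [wp_seq]
  refine wp_keyHead h2 hbfs hi h7 h13 hk fun s₁ τ₁ j₁ hf₁ e3 e9 e10 e15 hk₁ hτ₁ => ?_
  have hs₁ := hs.of_frame hf₁ (by decide) (by decide) (by decide) (by decide)
  have hbel : below n (s.arr 7) v = j₁ := by
    refine hbfs.below_eq hk₁.lt hk₁.ge (by have := hk₁.le; omega) (by rw [e15])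
  have hbv := hb v hvn
  rw [hbel] at hbv
  rw [wp_seq]
  refine wp_forList (n := n) (v := v) (nb := nb)
    (fun l s' => s'.reg 10 + l.countP (fun w => ¬ s.arr 7 v < s.arr 7 w) =
      2 * j₁ + l.countP (fun w => s.arr 7 v < s.arr 7 w)) 3 hs₁.lists e3 hvn (by decide) (by decide)
    (by decide) ?_ ?_ ?_ ?_
  · rintro l s' x r hr h
    have h8r : (10 : ℕ) ≠ r := by
      simp only [List.mem_cons, List.not_mem_nil, or_false] at hr
      omega
    simpa [h8r] using h
  · simp [e10]
  · rintro l w l' s' τ' hl hf hw h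
    have e9' : s'.reg 9 = s.arr 7 v := by rw [hf.reg 9 (by decide), e9]
    have e2' : s'.reg 2 = 1 := by rw [hf.reg 2 (by decide), hf₁.reg 2 (by decide), h2]
    have e7' : s'.arr 7 = s.arr 7 := by rw [hf.arr 7 (by decide), hf₁.arr 7 (by decide)]
    simp only [keyVisit, wp_seq, wp_load, wp_ite, wp_sub, wp_succ,
      Test.holds_lt, State.setReg_reg, hw, e9', e2', e7', if_true,
      Nat.reduceEqDiff, if_false, List.countP_append,
      List.countP_singleton]
    refine ⟨fun hlt => ⟨by omega, ?_⟩, fun hlt => ⟨by omega, ?_⟩⟩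
    · simp only [hlt, not_true_eq_false, decide_true, decide_false, if_true, Bool.false_eq_true,
        if_false]
      omega
    -- The base of the key is twice `below`, which is at least `behind`; hence the register is
    -- positive here and the truncated subtraction is exact.
    · have hbound : l.countP (fun w => ¬ s.arr 7 v < s.arr 7 w) + 1 ≤ j₁ := by
        refine le_trans ?_ hbv
        unfold behind
        rw [hl, List.countP_append, List.countP_cons]
        simp only [hlt, not_false_eq_true, decide_true, if_true]
        omega
      simp only [hlt, not_false_eq_true, decide_true, decide_false, if_true, Bool.false_eq_true,
        if_false]
      omega
  · rintro s' τ' hf h hτ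
    have e3' : s'.reg 3 = v := by rw [hf.reg 3 (by decide), e3]
    have e13' : s'.reg 13 = 2 * i := by rw [hf.reg 13 (by decide), hf₁.reg 13 (by decide), h13]
    have e17' : s'.reg 17 = 3 * i := by rw [hf.reg 17 (by decide), hf₁.reg 17 (by decide), h17]
    have e14' : s'.reg 14 = s₁.reg 14 := hf.reg 14 (by decide)
    have e15' : s'.reg 15 = s₁.reg 15 := hf.reg 15 (by decide)
    have e16' : s'.reg 16 = s₁.reg 16 := hf.reg 16 (by decide)
    have a8 : s'.arr 8 = s.arr 8 := by rw [hf.arr 8 (by decide), hf₁.arr 8 (by decide)]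
    have a9 : s'.arr 9 = s.arr 9 := by rw [hf.arr 9 (by decide), hf₁.arr 9 (by decide)]
    simp only [keyStore, wp_seq, wp_store, wp_succ, State.setReg_reg, State.setReg_arr,
      State.setArr_reg, State.setArr_arr, e3', e13', e17', e14', e15', e16', a8, a9, if_true,
      Nat.reduceEqDiff, if_false]
    refine ⟨j₁, _, _, by omega, by omega, hk₁, rfl, rfl, ?_, hk₁.par_lt, ?_, by omega⟩
    · rw [hbel]; exact h
    · rw [← e15]; exact hk₁.par_add

/-- The equation for the keys is additive because machine subtraction is truncated. Register 17
grows by three per vertex, as there is no multiplication, and becomes the number of buckets. -/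
theorem wp_keys {r : ℕ} (hs : Context n nb s) (h2 : s.reg 2 = 1)
    (hbfs : BFSResult n nb r (s.arr 6) (s.arr 7))
    (hb : ∀ v < n, behind nb (s.arr 7) v ≤ below n (s.arr 7) v)
    (hR : ∀ s' τ', Frame keys s s' → s'.reg 17 = 3 * n →
      (∀ v < n, s'.arr 8 v + behind nb (s.arr 7) v =
        2 * below n (s.arr 7) v + ahead nb (s.arr 7) v) →
      (∀ v < n, s'.arr 9 v < 2 ∧ (s'.arr 9 v + s.arr 7 v) % 2 = 1) →
      τ' ≤ τ + 22 * inputSize n nb + 7 → R τ' s') :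
    Wp keys R τ s := by
  refine Wp.mono (Q := fun τ' s' => s'.reg 17 = 3 * n ∧
      (∀ v < n, s'.arr 8 v + behind nb (s.arr 7) v =
        2 * below n (s.arr 7) v + ahead nb (s.arr 7) v) ∧
      (∀ v < n, s'.arr 9 v < 2 ∧ (s'.arr 9 v + s.arr 7 v) % 2 = 1) ∧
      τ' ≤ τ + 22 * inputSize n nb + 7) ?_
    fun τ' s' _ hf ⟨g₁, g₂, g₃, g₄⟩ => hR s' τ' hf g₁ g₂ g₃ g₄
  unfold keys
  simp only [wp_seq, wp_const]
  set s₀ := (((((s.setReg 13 0).setReg 14 0).setReg 15 1).setReg 16 0).setReg 17 0).setReg 7 0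
    with hs₀
  refine wp_forUp (N := n) (k₀ := 0) (fun i s' => s'.reg 13 = 2 * i ∧ s'.reg 17 = 3 * i ∧
    (∃ j₀, KeyInv n (s.arr 6) (s.arr 7) i j₀ (s'.reg 14) (s'.reg 15) (s'.reg 16)) ∧
    (∀ j < i, s'.arr 8 (s.arr 6 j) + behind nb (s.arr 7) (s.arr 6 j) =
        2 * below n (s.arr 7) (s.arr 6 j) + ahead nb (s.arr 7) (s.arr 6 j)) ∧
    (∀ j < i, s'.arr 9 (s.arr 6 j) < 2 ∧ (s'.arr 9 (s.arr 6 j) + s.arr 7 (s.arr 6 j)) % 2 = 1))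
    (fun i => 20 * ((nb (s.arr 6 i)).length + 1)) (by decide) (by decide)
    (by decide) (by simp [hs₀, hs.size]) (by simp [hs₀]) (by omega) ?_ ?_ ?_
  · refine ⟨by simp [hs₀], by simp [hs₀], ⟨0, ?_⟩, by simp, by simp⟩
    refine ⟨le_rfl, by simp [hs₀], by omega, fun j _ hj => ?_, by omega, by simp [hs₀],
      by simp [hs₀], by simp [hs₀]⟩
    have := hbfs.pos _ (hbfs.lt j hj)
    simpa [hs₀, Nat.one_le_iff_ne_zero] using this.ne'
  · rintro i s' τ' hf hi - hin ⟨h₁, h₂, ⟨j₀, h₃⟩, h₄, h₅⟩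
    have hs₀c : Context n nb s₀ := ⟨by simp [hs₀, hs.size], by simp [hs₀, hs.zero], hs.lists⟩
    have hc := hs₀c.of_frame hf (by decide) (by decide) (by decide) (by decide)
    have a6 : s'.arr 6 = s.arr 6 := by rw [hf.arr 6 (by decide)]; simp [hs₀]
    have a7 : s'.arr 7 = s.arr 7 := by rw [hf.arr 7 (by decide)]; simp [hs₀]
    have e2 : s'.reg 2 = 1 := by rw [hf.reg 2 (by decide)]; simp [hs₀, h2]
    refine wp_keyStep hc e2 (r := r) (by rwa [a6, a7]) hin hi h₁ h₂ (j₀ := j₀) (by rwa [a6, a7])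
      (by rwa [a7]) ?_
    rw [a6, a7]
    rintro s'' τ'' j₁ κ c hf' g₁ g₂ g₃ g₄ g₅ g₆ g₇ g₈ g₉
    refine ⟨by omega, by simp [g₁], by simp [g₂], ⟨j₁, by simpa using g₃⟩, fun j hj => ?_,
      fun j hj => ?_⟩
    · rw [State.setReg_arr, g₄]
      rcases Nat.lt_succ_iff_lt_or_eq.1 hj with hj | rfl
      · rw [Function.update_of_ne fun h => hj.ne (hbfs.inj j (by omega) i hin h)]
        exact h₄ j hj
      · rwa [Function.update_self]
    · rw [State.setReg_arr, g₅]
      rcases Nat.lt_succ_iff_lt_or_eq.1 hj with hj | rfl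
      · rw [Function.update_of_ne fun h => hj.ne (hbfs.inj j (by omega) i hin h)]
        exact h₅ j hj
      · rw [Function.update_self]
        exact ⟨g₇, g₈⟩
  · rintro s' τ' hf hi ⟨h₁, h₂, -, h₄, h₅⟩ hτ
    have hle := sum_le_inputSize (nb := nb) hbfs.lt hbfs.inj
    have hsum : ∑ k ∈ Finset.Ico 0 n, (20 * ((nb (s.arr 6 k)).length + 1) + 2) ≤
        22 * ∑ i ∈ Finset.range n, ((nb (s.arr 6 i)).length + 1) := by
      rw [Finset.mul_sum, Finset.range_eq_Ico]
      exact Finset.sum_le_sum fun k _ => by omega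
    refine ⟨h₂, fun v hv => ?_, fun v hv => ?_, by omega⟩ <;>
      obtain ⟨j, hj, rfl⟩ := hbfs.surj v hv
    · exact h₄ j hj
    · exact h₅ j hj

end RAM

/-! ### Bucket sort, and the two sides in sorted order -/

namespace RAM

variable {n : ℕ} {nb : ℕ → List ℕ} {s : State} {τ : ℕ} {R : ℕ → State → Prop}

/-- The cells of `A` from `0` on hold the list `l`. -/
def Holds (A : ℕ → ℕ) (l : List ℕ) : Prop := ∀ i (h : i < l.length), A i = l[i]

theorem Holds.append {A : ℕ → ℕ} {l : List ℕ} (h : Holds A l) (v : ℕ) :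
    Holds (Function.update A l.length v) (l ++ [v]) := by
  intro i hi
  rw [List.length_append, List.length_singleton] at hi
  rcases Nat.lt_succ_iff_lt_or_eq.1 hi with hi' | rfl
  · rw [Function.update_of_ne hi'.ne, h i hi', List.getElem_append_left hi']
  · simp

/-- The linked list with first cell `h` and successors `N` (both shifted by one) is `l`. -/
def Chain (N : ℕ → ℕ) : ℕ → List ℕ → Prop
  | h, [] => h = 0
  | h, v :: l => h = v + 1 ∧ Chain N (N v) l

theorem Chain.update {N : ℕ → ℕ} {k x : ℕ} {l : List ℕ} {h : ℕ} (hc : Chain N h l) (hk : k ∉ l) :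
    Chain (Function.update N k x) h l := by
  induction l generalizing h with
  | nil => exact hc
  | cons v l ih =>
    rw [List.mem_cons, not_or] at hk
    refine ⟨hc.1, ?_⟩
    rw [Function.update_of_ne (Ne.symm hk.1)]
    exact ih hc.2 hk.2

/-- The numbers below `k` with key `κ`, in decreasing order. -/
def bucket (K : ℕ → ℕ) (k κ : ℕ) : List ℕ := ((List.range k).filter fun v => K v = κ).reverse

theorem mem_bucket {K : ℕ → ℕ} {k κ v : ℕ} : v ∈ bucket K k κ ↔ v < k ∧ K v = κ := by
  simp [bucket]

theorem bucket_succ (K : ℕ → ℕ) (k κ : ℕ) :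
    bucket K (k + 1) κ = if K k = κ then k :: bucket K k κ else bucket K k κ := by
  unfold bucket
  rw [List.range_succ, List.filter_append, List.reverse_append]
  by_cases h : K k = κ <;> simp [h]

/-- The numbers below `n` with a key below `m`, sorted by key. -/
def sorted (K : ℕ → ℕ) (n m : ℕ) : List ℕ := (List.range m).flatMap (bucket K n)

theorem sorted_succ (K : ℕ → ℕ) (n m : ℕ) : sorted K n (m + 1) = sorted K n m ++ bucket K n m := by
  simp [sorted, List.range_succ]

theorem mem_sorted {K : ℕ → ℕ} {n m v : ℕ} : v ∈ sorted K n m ↔ v < n ∧ K v < m := by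
  simp [sorted, mem_bucket, and_comm]

theorem nodup_sorted (K : ℕ → ℕ) (n m : ℕ) : (sorted K n m).Nodup := by
  induction m with
  | zero => simp [sorted]
  | succ m ih =>
    rw [sorted_succ, List.nodup_append']
    refine ⟨ih, List.nodup_reverse.2 (List.nodup_range.filter _), fun v hv hv' => ?_⟩
    rw [mem_sorted] at hv
    rw [mem_bucket] at hv'
    omega

theorem pairwise_sorted (K : ℕ → ℕ) (n m : ℕ) : (sorted K n m).Pairwise fun u v => K u ≤ K v := by
  induction m with
  | zero => simp [sorted]
  | succ m ih =>
    rw [sorted_succ, List.pairwise_append]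
    refine ⟨ih, ?_, fun u hu v hv => ?_⟩
    · refine List.Pairwise.imp_of_mem (R := fun _ _ => True) (fun {u v} hu hv _ => ?_)
        (by rw [List.pairwise_iff_getElem]; simp)
      rw [mem_bucket] at hu hv
      omega
    · rw [mem_sorted] at hu
      rw [mem_bucket] at hv
      omega

theorem length_sorted {K : ℕ → ℕ} {n m : ℕ} (h : ∀ v < n, K v < m) : (sorted K n m).length = n := by
  have : (sorted K n m).Perm (List.range n) := by
    rw [List.perm_ext_iff_of_nodup (nodup_sorted K n m) List.nodup_range]
    intro v
    rw [mem_sorted, List.mem_range]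
    exact ⟨fun h' => h'.1, fun h' => ⟨h', h v h'⟩⟩
  simpa using this.length_eq

theorem sum_length_bucket (K : ℕ → ℕ) (n m : ℕ) :
    ∑ κ ∈ Finset.range m, (bucket K n κ).length = (sorted K n m).length := by
  induction m with
  | zero => simp [sorted]
  | succ m ih => rw [Finset.sum_range_succ, ih, sorted_succ, List.length_append]

/-- The body of the loop of `buckets`. -/
def bucketStep : Program :=
  .seq (.load 9 8 7) (.seq (.load 10 10 9) (.seq (.store 11 7 10) (.seq (.succ 11 7)
    (.store 10 9 11))))

/-- Put the vertices into buckets by the keys in the array `8`. The buckets are linked lists: the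
first elements are in the array `10`, the successors in the array `11`. -/
def buckets : Program := .seq (.const 7 0) (forUp 7 0 bucketStep)

/-- Links are shifted by one, so the zeroed array 10 represents empty buckets. Vertices are
prepended, which explains the decreasing order in `bucket`; the order of ties plays no role later.
-/
theorem wp_buckets (hs : Context n nb s) (h10 : s.arr 10 = fun _ => 0)
    (hR : ∀ s' τ', Frame buckets s s' →
      (∀ κ, Chain (s'.arr 11) (s'.arr 10 κ) (bucket (s.arr 8) n κ)) →
      τ' ≤ τ + 7 * n + 2 → R τ' s') :
    Wp buckets R τ s := by
  refine Wp.mono (Q := fun τ' s' => (∀ κ, Chain (s'.arr 11) (s'.arr 10 κ) (bucket (s.arr 8) n κ)) ∧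
      τ' ≤ τ + 7 * n + 2) ?_ fun τ' s' _ hf ⟨g₁, g₂⟩ => hR s' τ' hf g₁ g₂
  unfold buckets
  simp only [wp_seq, wp_const]
  refine wp_forUp (N := n) (k₀ := 0)
    (fun k s' => ∀ κ, Chain (s'.arr 11) (s'.arr 10 κ) (bucket (s.arr 8) k κ)) (fun _ => 5)
    (by decide) (by decide) (by decide) (by simp [hs.size]) (by simp) (by omega) ?_ ?_ ?_
  · intro κ
    simp [bucket, Chain, h10]
  · rintro k s' τ' hf hk - hkn hI
    have a8 : s'.arr 8 = s.arr 8 := by rw [hf.arr 8 (by decide)]; simp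
    simp only [bucketStep, wp_seq, wp_load, wp_store, wp_succ, State.setReg_reg, State.setReg_arr,
      State.setArr_reg, State.setArr_arr, hk, a8, if_true, Nat.reduceEqDiff, if_false]
    refine ⟨by omega, fun κ => ?_⟩
    have hnot : k ∉ bucket (s.arr 8) k κ := fun h => by
      rw [mem_bucket] at h
      omega
    rw [bucket_succ]
    split_ifs with h
    · rw [h, Function.update_self]
      refine ⟨rfl, ?_⟩
      rw [Function.update_self]
      exact (hI κ).update hnot
    · rw [Function.update_of_ne (Ne.symm h)]
      exact (hI κ).update hnot
  · intro s' τ' hf hk hI hτ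
    simp only [Finset.sum_const, Nat.card_Ico, smul_eq_mul] at hτ
    exact ⟨hI, by omega⟩

/-- Append the first element of the current bucket to the array `12`. -/
def collectOne : Program :=
  .seq (.sub 3 9 2) (.seq (.store 12 8 3) (.seq (.succ 8 8) (.load 9 11 3)))

/-- The body of the loop of `collect`. -/
def collectStep : Program := .seq (.load 9 10 7) (.loop (.ne 9 1) collectOne)

/-- Concatenate the buckets with numbers below the number in register `17`. -/
def collect : Program := .seq (.const 8 0) (.seq (.const 7 0) (forUp 7 17 collectStep))

theorem wp_collect {K : ℕ → ℕ} {m : ℕ} (hs : Context n nb s) (h2 : s.reg 2 = 1)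
    (h17 : s.reg 17 = m) (hK : ∀ v < n, K v < m)
    (hc : ∀ κ, Chain (s.arr 11) (s.arr 10 κ) (bucket K n κ))
    (hR : ∀ s' τ', Frame collect s s' → Holds (s'.arr 12) (sorted K n m) →
      τ' ≤ τ + 5 * n + 4 * m + 3 → R τ' s') :
    Wp collect R τ s := by
  refine Wp.mono (Q := fun τ' s' => Holds (s'.arr 12) (sorted K n m) ∧
      τ' ≤ τ + 5 * n + 4 * m + 3) ?_ fun τ' s' _ hf ⟨g₁, g₂⟩ => hR s' τ' hf g₁ g₂
  unfold collect
  simp only [wp_seq, wp_const]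
  refine wp_forUp (N := m) (k₀ := 0)
    (fun k s' => s'.reg 8 = (sorted K n k).length ∧ Holds (s'.arr 12) (sorted K n k))
    (fun κ => 5 * (bucket K n κ).length + 2)
    (by decide) (by decide) (by decide) (by simp [h17]) (by simp) (by omega) ?_ ?_ ?_
  · refine ⟨by simp [sorted], fun i hi => ?_⟩
    simp [sorted] at hi
  · rintro k s' τ' hf hk - hkn ⟨h₁, h₃⟩
    have a10 : s'.arr 10 = s.arr 10 := by rw [hf.arr 10 (by decide)]; simp
    have a11 : s'.arr 11 = s.arr 11 := by rw [hf.arr 11 (by decide)]; simp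
    have e1 : s'.reg 1 = 0 := by rw [hf.reg 1 (by decide)]; simp [hs.zero]
    have e2 : s'.reg 2 = 1 := by rw [hf.reg 2 (by decide)]; simp [h2]
    simp only [collectStep, wp_seq, wp_load, hk, a10]
    refine wp_loop (fun B t => ∃ l l', l ++ l' = bucket K n k ∧
      t.reg 8 = (sorted K n k ++ l).length ∧ Holds (t.arr 12) (sorted K n k ++ l) ∧
      Chain (s.arr 11) (t.reg 9) l' ∧ B = 5 * l'.length) (5 * (bucket K n k).length) ?_ ?_ ?_
    · exact ⟨[], bucket K n k, by simp, by simpa using h₁, by simpa using h₃, by simpa using hc k, rfl⟩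
    · rintro B t τ'' hft ⟨l, l', hl, t₁, t₂, t₃, rfl⟩ hb
      have f1 : t.reg 1 = 0 := by rw [hft.reg 1 (by decide)]; simp [e1]
      have f2 : t.reg 2 = 1 := by rw [hft.reg 2 (by decide)]; simp [e2]
      have f11 : t.arr 11 = s.arr 11 := by rw [hft.arr 11 (by decide)]; simp [a11]
      rw [Test.holds_ne, f1] at hb
      cases l' with
      | nil => exact absurd t₃ hb
      | cons v l' =>
        obtain ⟨t₄, t₅⟩ := t₃
        simp only [collectOne, wp_seq, wp_load, wp_store, wp_succ, wp_sub, State.setReg_reg,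
          State.setReg_arr, State.setArr_reg, State.setArr_arr, t₄, f2, f11, t₁, if_true,
          Nat.reduceEqDiff, if_false, Nat.add_sub_cancel]
        refine ⟨5 * l'.length, ⟨l ++ [v], l', by simpa using hl, by simp; omega, ?_, t₅, rfl⟩, ?_⟩
        · rw [← List.append_assoc]
          exact t₂.append v
        · rw [List.length_cons]; omega
    · rintro t τ'' B hft ⟨l, l', hl, t₁, t₂, t₃, rfl⟩ hb hτ
      have f1 : t.reg 1 = 0 := by rw [hft.reg 1 (by decide)]; simp [e1]
      rw [Test.holds_ne, f1, not_not] at hb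
      have : l' = [] := by
        cases l' with
        | nil => rfl
        | cons v l' => exact absurd (t₃.1.symm.trans hb) (by omega)
      subst this
      rw [List.append_nil] at hl
      rw [sorted_succ, ← hl]
      exact ⟨by rw [← hl] at hτ; omega, by simpa using t₁, by simpa using t₂⟩
  · rintro s' τ' hf hk ⟨h₁, h₃⟩ hτ
    refine ⟨h₃, ?_⟩
    -- The buckets partition the vertices, so the inner loops cost five steps per vertex in all, not
    -- per bucket.
    have hsum : ∑ k ∈ Finset.Ico 0 m, (5 * (bucket K n k).length + 2 + 2) = 5 * n + 4 * m := by
      have h := sum_length_bucket K n m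
      rw [length_sorted hK] at h
      rw [← Finset.range_eq_Ico]
      simp only [Nat.add_assoc, Finset.sum_add_distrib, ← Finset.mul_sum, h, Finset.sum_const,
        Finset.card_range, smul_eq_mul]
      omega
    omega

/-- `A w` is one more than the last position in `l` of an element whose list contains `w`, or zero
if there is none. -/
structure LastSeen (nb : ℕ → List ℕ) (l : List ℕ) (A : ℕ → ℕ) : Prop where
  le : ∀ i (h : i < l.length), ∀ w ∈ nb l[i], i + 1 ≤ A w
  eq : ∀ w, A w = 0 ∨ ∃ i, ∃ h : i < l.length, A w = i + 1 ∧ w ∈ nb l[i]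

/-- Positions are written in increasing order, so overwriting keeps the maximum. -/
theorem LastSeen.append {l : List ℕ} {A : ℕ → ℕ} (H : LastSeen nb l A) (v : ℕ) :
    LastSeen nb (l ++ [v]) fun w => if w ∈ nb v then l.length + 1 else A w where
  le i h w hw := by
    rw [List.length_append, List.length_singleton] at h
    rcases Nat.lt_succ_iff_lt_or_eq.1 h with hi | rfl
    · rw [List.getElem_append_left hi] at hw
      have := H.le i hi w hw
      split_ifs <;> omega
    · simp only [List.getElem_concat_length] at hw
      simp [hw]
  eq w := by
    by_cases hw : w ∈ nb v
    · refine Or.inr ⟨l.length, by simp, by simp [hw], ?_⟩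
      rwa [List.getElem_concat_length rfl]
    · simp only [hw, if_false]
      rcases H.eq w with h | ⟨i, hi, h₁, h₂⟩
      · exact Or.inl h
      · refine Or.inr ⟨i, by simp; omega, h₁, ?_⟩
        rwa [List.getElem_append_left hi]

/-- Append the vertex in register `3` to the array `a`, of length in register `c`, and note its
position at all its neighbours in the array `h`. -/
def appendSide (a c h : ℕ) : Program :=
  .seq (.store a c 3) (.seq (.succ c c) (forList (.store h 6 c)))

theorem wp_appendSide {a c h v : ℕ} {l : List ℕ} (hs : Context n nb s) (h3 : s.reg 3 = v)
    (hv : v < n) (hc : 6 < c) (ha0 : a ≠ 0) (ha1 : a ≠ 1) (hh1 : h ≠ 1) (hah : a ≠ h)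
    (hreg : s.reg c = l.length) (ha : Holds (s.arr a) l) (hh : LastSeen nb l (s.arr h))
    (hR : ∀ s' τ', Frame (appendSide a c h) s s' → s'.reg c = (l ++ [v]).length →
      Holds (s'.arr a) (l ++ [v]) → LastSeen nb (l ++ [v]) (s'.arr h) →
      τ' ≤ τ + 4 * (nb v).length + 6 → R τ' s') :
    Wp (appendSide a c h) R τ s := by
  refine Wp.mono (Q := fun τ' s' => s'.reg c = (l ++ [v]).length ∧
      Holds (s'.arr a) (l ++ [v]) ∧ LastSeen nb (l ++ [v]) (s'.arr h) ∧
      τ' ≤ τ + 4 * (nb v).length + 6) ?_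
    fun τ' s' _ hf ⟨g₁, g₂, g₃, g₄⟩ => hR s' τ' hf g₁ g₂ g₃ g₄
  unfold appendSide
  simp only [wp_seq, wp_store, wp_succ]
  have hc3 : c ≠ 3 := by omega
  have hfc : c ∉ (forList (.store h 6 c)).regs := by
    simp [forList, forUp, Program.regs]
    omega
  have hfa : a ∉ (forList (.store h 6 c)).arrs := by
    simp [forList, forUp, Program.arrs, hah]
  refine wp_forList (n := n) (v := v) (nb := nb)
    (fun k s' => s'.arr h = fun w => if w ∈ k then l.length + 1 else s.arr h w) 1 ?_ ?_ hv
    (by simp [Program.regs]) (by simp [Program.regs]) (by simp [Program.arrs, hh1.symm])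
    ?_ ?_ ?_ ?_
  · simpa [ha0.symm, ha1.symm] using hs.lists
  · simp [h3, hc3.symm]
  · intro k s' x r _ hI
    simpa using hI
  · simp [hah.symm]
  · intro k w k' s' τ' hk hf hw hI
    have ec : s'.reg c = l.length + 1 := by
      rw [hf.reg c hfc]
      simp [hreg]
    rw [wp_store, hw, ec]
    refine ⟨by omega, ?_⟩
    simp only [State.setArr_arr, if_true, hI]
    funext u
    by_cases hu : u = w
    · simp [hu]
    · simp [hu]
  · intro s' τ' hf hI hτ
    refine ⟨?_, ?_, ?_, by omega⟩
    · rw [hf.reg c hfc]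
      simp [hreg]
    · rw [hf.arr a hfa]
      simpa [hreg, h3] using ha.append v
    · rw [hI]
      exact hh.append v

/-- The body of the loop of `split`. -/
def splitStep : Program :=
  .seq (.load 3 12 7) (.seq (.load 10 9 3)
    (.ite (.eq 10 1) (appendSide 13 8 15) (appendSide 14 9 16)))

/-- Split the sorted list of the vertices in the array `12` into the two sides. -/
def split : Program :=
  .seq (.const 8 0) (.seq (.const 9 0) (.seq (.const 7 0) (forUp 7 0 splitStep)))

theorem wp_split {O : List ℕ} {par : ℕ → ℕ} (hs : Context n nb s) (hO : O.length = n)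
    (hnodup : O.Nodup) (hlt : ∀ v ∈ O, v < n) (h12 : Holds (s.arr 12) O) (h9 : s.arr 9 = par)
    (h15 : s.arr 15 = fun _ => 0) (h16 : s.arr 16 = fun _ => 0)
    (hR : ∀ s' τ', Frame split s s' →
      Holds (s'.arr 13) (O.filter fun v => par v = 0) →
      Holds (s'.arr 14) (O.filter fun v => par v ≠ 0) →
      LastSeen nb (O.filter fun v => par v = 0) (s'.arr 15) →
      LastSeen nb (O.filter fun v => par v ≠ 0) (s'.arr 16) →
      τ' ≤ τ + 11 * inputSize n nb + 4 → R τ' s') :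
    Wp split R τ s := by
  refine Wp.mono (Q := fun τ' s' => Holds (s'.arr 13) (O.filter fun v => par v = 0) ∧
      Holds (s'.arr 14) (O.filter fun v => par v ≠ 0) ∧
      LastSeen nb (O.filter fun v => par v = 0) (s'.arr 15) ∧
      LastSeen nb (O.filter fun v => par v ≠ 0) (s'.arr 16) ∧
      τ' ≤ τ + 11 * inputSize n nb + 4) ?_
    fun τ' s' _ hf ⟨g₁, g₂, g₃, g₄, g₅⟩ => hR s' τ' hf g₁ g₂ g₃ g₄ g₅
  unfold split
  simp only [wp_seq, wp_const]
  set s₀ := ((s.setReg 8 0).setReg 9 0).setReg 7 0 with hs₀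
  have hs₀c : Context n nb s₀ := ⟨by simp [hs₀, hs.size], by simp [hs₀, hs.zero], hs.lists⟩
  have hget : ∀ i < n, s.arr 12 i < n := fun i hi => by
    rw [h12 i (by omega)]
    exact hlt _ (List.getElem_mem _)
  refine wp_forUp (N := n) (k₀ := 0) (fun k s' =>
      s'.reg 8 = ((O.take k).filter fun v => par v = 0).length ∧
      s'.reg 9 = ((O.take k).filter fun v => par v ≠ 0).length ∧
      Holds (s'.arr 13) ((O.take k).filter fun v => par v = 0) ∧
      Holds (s'.arr 14) ((O.take k).filter fun v => par v ≠ 0) ∧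
      LastSeen nb ((O.take k).filter fun v => par v = 0) (s'.arr 15) ∧
      LastSeen nb ((O.take k).filter fun v => par v ≠ 0) (s'.arr 16))
    (fun k => 4 * (nb (s.arr 12 k)).length + 9)
    (by decide) (by decide) (by decide) (by simp [hs₀, hs.size]) (by simp [hs₀]) (by omega) ?_ ?_ ?_
  · refine ⟨by simp [hs₀], by simp [hs₀], fun i hi => ?_, fun i hi => ?_, ?_, ?_⟩
    · simp at hi
    · simp at hi
    · exact ⟨fun i hi => by simp at hi, fun w => Or.inl (by simp [hs₀, h15])⟩
    · exact ⟨fun i hi => by simp at hi, fun w => Or.inl (by simp [hs₀, h16])⟩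
  · rintro k s' τ' hf hk - hkn ⟨i₁, i₂, i₃, i₄, i₅, i₆⟩
    have hc := hs₀c.of_frame hf (by decide) (by decide) (by decide) (by decide)
    have a9 : s'.arr 9 = par := by rw [hf.arr 9 (by decide)]; simp [hs₀, h9]
    have a12 : s'.arr 12 = s.arr 12 := by rw [hf.arr 12 (by decide)]; simp [hs₀]
    have htake : O.take (k + 1) = O.take k ++ [s.arr 12 k] := by
      rw [h12 k (by omega), List.take_succ_eq_append_getElem]
    rw [htake, List.filter_append, List.filter_append]
    simp only [splitStep, wp_seq, wp_load, wp_ite, Test.holds_eq]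
    set s₁ := (s'.setReg 3 (s'.arr 12 (s'.reg 7))).setReg 10
      ((s'.setReg 3 (s'.arr 12 (s'.reg 7))).arr 9 ((s'.setReg 3 (s'.arr 12 (s'.reg 7))).reg 3))
      with hs₁
    have hc₁ : Context n nb s₁ := ⟨by simp [hs₁, hc.size], by simp [hs₁, hc.zero], hc.lists⟩
    have e3 : s₁.reg 3 = s.arr 12 k := by simp [hs₁, a12, hk]
    have e10 : s₁.reg 10 = par (s.arr 12 k) := by simp [hs₁, a12, a9, hk]
    have e1 : s₁.reg 1 = 0 := hc₁.zero
    have e8 : s₁.reg 8 = s'.reg 8 := by simp [hs₁]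
    have e9 : s₁.reg 9 = s'.reg 9 := by simp [hs₁]
    rw [e10, e1]
    refine ⟨fun hp => ?_, fun hp => ?_⟩
    · have f₁ : List.filter (fun v => decide (par v = 0)) [s.arr 12 k] = [s.arr 12 k] := by simp [hp]
      have f₂ : List.filter (fun v => decide (par v ≠ 0)) [s.arr 12 k] = [] := by simp [hp]
      rw [f₁, f₂, List.append_nil]
      refine wp_appendSide hc₁ e3 (hget k hkn) (by decide) (by decide) (by decide)
        (by decide) (by decide) (e8.trans i₁) i₃ i₅ ?_
      intro s'' τ'' hf' g₁ g₂ g₃ g₄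
      refine ⟨by omega, by simpa using g₁, ?_, g₂, ?_, g₃, ?_⟩
      · rw [State.setReg_reg, if_neg (by decide), hf'.reg 9 (by decide), e9, i₂]
      · rw [State.setReg_arr, hf'.arr 14 (by decide)]; exact i₄
      · rw [State.setReg_arr, hf'.arr 16 (by decide)]; exact i₆
    · have f₁ : List.filter (fun v => decide (par v = 0)) [s.arr 12 k] = [] := by simp [hp]
      have f₂ : List.filter (fun v => decide (par v ≠ 0)) [s.arr 12 k] = [s.arr 12 k] := by simp [hp]
      rw [f₁, f₂, List.append_nil]
      refine wp_appendSide hc₁ e3 (hget k hkn) (by decide) (by decide) (by decide)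
        (by decide) (by decide) (e9.trans i₂) i₄ i₆ ?_
      intro s'' τ'' hf' g₁ g₂ g₃ g₄
      refine ⟨by omega, ?_, by simpa using g₁, ?_, g₂, ?_, g₃⟩
      · rw [State.setReg_reg, if_neg (by decide), hf'.reg 8 (by decide), e8, i₁]
      · rw [State.setReg_arr, hf'.arr 13 (by decide)]; exact i₃
      · rw [State.setReg_arr, hf'.arr 15 (by decide)]; exact i₅
  · rintro s' τ' hf hk ⟨-, -, i₃, i₄, i₅, i₆⟩ hτ
    rw [List.take_of_length_le hO.le] at i₃ i₄ i₅ i₆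
    have hle := sum_le_inputSize (nb := nb) (Q := s.arr 12) hget fun i hi j hj hij => by
      rw [h12 i (by omega), h12 j (by omega)] at hij
      exact (List.Nodup.getElem_inj_iff hnodup).1 hij
    have hsum : ∑ k ∈ Finset.Ico 0 n, (4 * (nb (s.arr 12 k)).length + 9 + 2) ≤
        11 * ∑ i ∈ Finset.range n, ((nb (s.arr 12 i)).length + 1) := by
      rw [Finset.mul_sum, Finset.range_eq_Ico]
      exact Finset.sum_le_sum fun k _ => by omega
    exact ⟨i₃, i₄, i₅, i₆, by omega⟩

end RAM

/-! ### The start direction and the greedy path -/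

namespace RAM

variable {n : ℕ} {nb : ℕ → List ℕ} {s : State} {τ : ℕ} {R : ℕ → State → Prop}

/-- The body of the loop of `startDirection`. -/
def diagStep : Program :=
  .seq (.load 9 13 7) (.seq (.load 10 14 7) (.seq (.load 9 16 9) (.seq (.load 10 15 10)
    (.seq (.succ 11 7) (.ite (.lt 11 9)
      (.ite (.lt 11 10) (.move 7 11) (.seq (.const 8 0) (.const 18 1))) (.const 8 0))))))

/-- Find the first place on the diagonal where one of the two next cells is missing. Register `18`
becomes `0` for a path that starts downwards, `1` for a path that starts to the right. -/
def startDirection : Program :=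
  .seq (.const 7 0) (.seq (.const 8 1) (.seq (.const 18 0) (.loop (.eq 8 2) diagStep)))

/-- A successful round at `k` has `k + 1 < H₂ (X k) ≤ n`, which bounds the number of rounds. That
the positions visited are cells is not needed here. -/
theorem wp_startDirection {X Y H₁ H₂ : ℕ → ℕ} (h2 : s.reg 2 = 1) (hX : s.arr 13 = X)
    (hY : s.arr 14 = Y) (h15 : s.arr 15 = H₁) (h16 : s.arr 16 = H₂) (hbound : ∀ v, H₂ v ≤ n)
    (hR : ∀ s' τ' k (b : Bool), Frame startDirection s s' →
      (∀ t < k, t + 1 < H₂ (X t) ∧ t + 1 < H₁ (Y t)) →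
      s'.reg 18 = (if b then 0 else 1) →
      ((b = true ∧ ¬ k + 1 < H₂ (X k)) ∨ (b = false ∧ ¬ k + 1 < H₁ (Y k))) →
      τ' ≤ τ + 12 * n + 16 → R τ' s') :
    Wp startDirection R τ s := by
  refine Wp.mono (Q := fun τ' s' => ∃ k, ∃ b : Bool,
      (∀ t < k, t + 1 < H₂ (X t) ∧ t + 1 < H₁ (Y t)) ∧ s'.reg 18 = (if b then 0 else 1) ∧
      ((b = true ∧ ¬ k + 1 < H₂ (X k)) ∨ (b = false ∧ ¬ k + 1 < H₁ (Y k))) ∧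
      τ' ≤ τ + 12 * n + 16) ?_
    fun τ' s' _ hf ⟨k, b, g₁, g₂, g₃, g₄⟩ => hR s' τ' k b hf g₁ g₂ g₃ g₄
  unfold startDirection
  simp only [wp_seq, wp_const]
  refine wp_loop (fun B s' => ∃ k, (∀ t < k, t + 1 < H₂ (X t) ∧ t + 1 < H₁ (Y t)) ∧
      ((s'.reg 8 = 1 ∧ s'.reg 7 = k ∧ s'.reg 18 = 0 ∧ k ≤ n ∧ B = 12 * (n - k) + 12) ∨
        (s'.reg 8 = 0 ∧ B = 0 ∧ ∃ b : Bool, s'.reg 18 = (if b then 0 else 1) ∧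
          ((b = true ∧ ¬ k + 1 < H₂ (X k)) ∨ (b = false ∧ ¬ k + 1 < H₁ (Y k))))))
    (12 * n + 12) ?_ ?_ ?_
  · exact ⟨0, by omega, Or.inl ⟨by simp, by simp, by simp, by omega, by omega⟩⟩
  · rintro B s' τ' hf ⟨k, hk, h⟩ hb
    have e2 : s'.reg 2 = 1 := by rw [hf.reg 2 (by decide)]; simp [h2]
    rw [Test.holds_eq, e2] at hb
    have a13 : s'.arr 13 = X := by rw [hf.arr 13 (by decide)]; simp [hX]
    have a14 : s'.arr 14 = Y := by rw [hf.arr 14 (by decide)]; simp [hY]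
    have a15 : s'.arr 15 = H₁ := by rw [hf.arr 15 (by decide)]; simp [h15]
    have a16 : s'.arr 16 = H₂ := by rw [hf.arr 16 (by decide)]; simp [h16]
    rcases h with ⟨-, h7, h18, hkn, rfl⟩ | ⟨h8, -⟩
    swap
    · rw [h8] at hb; omega
    simp only [diagStep, wp_seq, wp_load, wp_succ, wp_ite, wp_move, wp_const, Test.holds_lt,
      State.setReg_reg, State.setReg_arr, h7, h18, a13, a14, a15, a16, hb, if_true,
      Nat.reduceEqDiff, if_false]
    refine ⟨fun h₁ => ⟨fun h₂ => ?_, fun h₂ => ?_⟩, fun h₁ => ?_⟩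
    · have := hbound (X k)
      refine ⟨12 * (n - (k + 1)) + 12, ⟨k + 1, fun t ht => ?_,
        Or.inl ⟨trivial, rfl, trivial, by omega, rfl⟩⟩, by omega⟩
      rcases Nat.lt_succ_iff_lt_or_eq.1 ht with ht | rfl
      · exact hk t ht
      · exact ⟨h₁, h₂⟩
    · exact ⟨0, ⟨k, hk, Or.inr ⟨trivial, rfl, false, rfl, Or.inr ⟨rfl, h₂⟩⟩⟩, by omega⟩
    · exact ⟨0, ⟨k, hk, Or.inr ⟨trivial, rfl, true, rfl, Or.inl ⟨rfl, h₁⟩⟩⟩, by omega⟩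
  · rintro s' τ' B hf ⟨k, hk, h⟩ hb hτ
    have e2 : s'.reg 2 = 1 := by rw [hf.reg 2 (by decide)]; simp [h2]
    rw [Test.holds_eq, e2] at hb
    rcases h with ⟨h8, -⟩ | ⟨-, -, b, h₁, h₂⟩
    · exact absurd h8 hb
    · exact ⟨k, b, hk, h₁, h₂, by omega⟩

/-- One step of the greedy path; the last component tells whether it would like to go down. -/
def greedyNext (X Y H₁ H₂ : ℕ → ℕ) : ℕ × ℕ × Bool → ℕ × ℕ × Bool
  | (i, j, true) => if i + 1 < H₁ (Y j) then (i + 1, j, false) else (i, j + 1, true)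
  | (i, j, false) => if j + 1 < H₂ (X i) then (i, j + 1, true) else (i + 1, j, false)

/-- The greedy path. -/
def greedyPath (X Y H₁ H₂ : ℕ → ℕ) (b : Bool) (e : ℕ) : ℕ × ℕ × Bool :=
  (greedyNext X Y H₁ H₂)^[e] (0, 0, b)

theorem greedyPath_succ (X Y H₁ H₂ : ℕ → ℕ) (b : Bool) (e : ℕ) :
    greedyPath X Y H₁ H₂ b (e + 1) = greedyNext X Y H₁ H₂ (greedyPath X Y H₁ H₂ b e) :=
  Function.iterate_succ_apply' _ _ _

/-- The body of the loop of `greedy`. -/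
def greedyStep : Program :=
  .seq (.load 3 13 7) (.seq (.load 6 14 8) (.seq (.store 2 12 3) (.seq (.store 3 12 6)
    (.seq (.load 9 16 3) (.seq (.load 10 15 6) (.seq (.succ 11 7) (.seq (.succ 14 8)
      (.ite (.eq 18 1)
        (.ite (.lt 11 10) (.seq (.move 7 11) (.const 18 1)) (.move 8 14))
        (.ite (.lt 14 9) (.seq (.move 8 14) (.const 18 0)) (.move 7 11))))))))))

/-- Output the cells of the greedy path. -/
def greedy : Program :=
  .seq (.sub 13 0 2) (.seq (.const 7 0) (.seq (.const 8 0) (.seq (.const 12 0)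
    (.seq (forUp 12 13 greedyStep) (.move 0 13)))))

theorem wp_greedy {X Y H₁ H₂ : ℕ → ℕ} {b : Bool} (hs : Context n nb s) (h2 : s.reg 2 = 1)
    (hX : s.arr 13 = X) (hY : s.arr 14 = Y) (h15 : s.arr 15 = H₁) (h16 : s.arr 16 = H₂)
    (h18 : s.reg 18 = if b then 0 else 1)
    (hR : ∀ s' τ', s'.reg 0 = n - 1 →
      (∀ e < n - 1, s'.arr 2 e = X (greedyPath X Y H₁ H₂ b e).1 ∧
        s'.arr 3 e = Y (greedyPath X Y H₁ H₂ b e).2.1) →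
      τ' ≤ τ + 14 * n + 6 → R τ' s') :
    Wp greedy R τ s := by
  unfold greedy
  simp only [wp_seq, wp_const, wp_sub]
  refine wp_forUp (N := n - 1) (k₀ := 0) (fun k s' =>
      s'.reg 7 = (greedyPath X Y H₁ H₂ b k).1 ∧ s'.reg 8 = (greedyPath X Y H₁ H₂ b k).2.1 ∧
      s'.reg 18 = (if (greedyPath X Y H₁ H₂ b k).2.2 then 0 else 1) ∧
      ∀ e < k, s'.arr 2 e = X (greedyPath X Y H₁ H₂ b e).1 ∧
        s'.arr 3 e = Y (greedyPath X Y H₁ H₂ b e).2.1) (fun _ => 12)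
    (by decide) (by decide) (by decide) (by simp [hs.size, h2]) (by simp) (by omega) ?_ ?_ ?_
  · cases b <;> simpa [greedyPath] using h18
  · rintro k s' τ' hf hk - hkn ⟨i₁, i₂, i₃, i₄⟩
    have a13 : s'.arr 13 = X := by rw [hf.arr 13 (by decide)]; simp [hX]
    have a14 : s'.arr 14 = Y := by rw [hf.arr 14 (by decide)]; simp [hY]
    have a15 : s'.arr 15 = H₁ := by rw [hf.arr 15 (by decide)]; simp [h15]
    have a16 : s'.arr 16 = H₂ := by rw [hf.arr 16 (by decide)]; simp [h16]
    have e1 : s'.reg 1 = 0 := by rw [hf.reg 1 (by decide)]; simp [hs.zero]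
    rw [greedyPath_succ]
    have hout : ∀ e < k + 1,
        Function.update (s'.arr 2) k (X (greedyPath X Y H₁ H₂ b k).1) e =
          X (greedyPath X Y H₁ H₂ b e).1 ∧
        Function.update (s'.arr 3) k (Y (greedyPath X Y H₁ H₂ b k).2.1) e =
          Y (greedyPath X Y H₁ H₂ b e).2.1 := by
      intro e he
      rcases Nat.lt_succ_iff_lt_or_eq.1 he with he | rfl
      · rw [Function.update_of_ne he.ne, Function.update_of_ne he.ne]
        exact i₄ e he
      · simp
    revert i₁ i₂ i₃ hout
    generalize greedyPath X Y H₁ H₂ b k = g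
    obtain ⟨i, j, b'⟩ := g
    intro i₁ i₂ i₃ hout
    cases b' <;>
    simp only [greedyStep, wp_seq, wp_load, wp_succ, wp_store, wp_ite, wp_move, wp_const,
      Test.holds_lt, Test.holds_eq, greedyNext, Bool.false_eq_true,
      State.setReg_reg, State.setReg_arr, State.setArr_reg, State.setArr_arr, i₁, i₂, i₃, e1, hk,
      a13, a14, a15, a16, if_true, Nat.reduceEqDiff, if_false, one_ne_zero, false_imp_iff,
      true_imp_iff, not_true_eq_false, not_false_eq_true, and_true, true_and] <;>
    refine ⟨fun h => ?_, fun h => ?_⟩ <;>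
    simp only [h, if_true, if_false, Bool.false_eq_true, true_and] <;>
    refine ⟨by omega, hout⟩
  · rintro s' τ' hf hk ⟨-, -, -, i₄⟩ hτ
    have e13 : s'.reg 13 = n - 1 := by rw [hf.reg 13 (by decide)]; simp [hs.size, h2]
    rw [wp_move, e13]
    simp only [Finset.sum_const, Nat.card_Ico, smul_eq_mul] at hτ
    exact hR _ _ (by simp) (by simpa using i₄) (by omega)

/-- The whole algorithm. -/
def mist : Program :=
  .seq (bfs 4 5) (.seq selectEnd (.seq (bfs 6 7) (.seq keys (.seq buckets (.seq collect
    (.seq split (.seq startDirection greedy)))))))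

end RAM

/-! ### From lists of numbers to graphs -/

namespace MIST

open RAM

variable {n : ℕ} {G : SimpleGraph (Fin n)} {L : Fin n → List (Fin n)}

/-- The adjacency lists `L`, as lists of numbers. -/
def adjList (L : Fin n → List (Fin n)) (v : ℕ) : List ℕ :=
  if h : v < n then (L ⟨v, h⟩).map Fin.val else []

theorem adjList_fin (L : Fin n → List (Fin n)) (v : Fin n) : adjList L v = (L v).map Fin.val := by
  simp [adjList]

theorem mem_adjList (hL : IsAdjacencyLists G L) {v w : ℕ} :
    w ∈ adjList L v ↔ ∃ (hv : v < n) (hw : w < n), G.Adj ⟨v, hv⟩ ⟨w, hw⟩ := by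
  by_cases hv : v < n
  · simp only [adjList, hv, dif_pos, List.mem_map, (hL _).2, exists_true_left]
    constructor
    · rintro ⟨u, hu, rfl⟩
      exact ⟨u.2, hu⟩
    · rintro ⟨hw, h⟩
      exact ⟨⟨w, hw⟩, h, rfl⟩
  · simp [adjList, hv]

theorem mem_adjList_fin (hL : IsAdjacencyLists G L) {v w : Fin n} :
    (w : ℕ) ∈ adjList L v ↔ G.Adj v w := by
  simp [mem_adjList hL]

theorem countP_adjList (hL : IsAdjacencyLists G L) (v : Fin n) (φ : ℕ → Prop) [DecidablePred φ] :
    (adjList L v).countP (fun w => φ w) = {u : Fin n | G.Adj v u ∧ φ u}.ncard := by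
  have h : {u : Fin n | G.Adj v u ∧ φ u} =
      (((L v).filter fun u : Fin n => φ u).toFinset : Finset (Fin n)) := by
    ext u
    simp [(hL v).2]
  rw [h, Set.ncard_coe_finset, List.toFinset_card_of_nodup ((hL v).1.filter _), adjList_fin,
    List.countP_map, List.countP_eq_length_filter]
  rfl

theorem length_adjList (hL : IsAdjacencyLists G L) (v : Fin n) :
    (adjList L v).length = (G.neighborSet v).ncard := by
  have h := countP_adjList hL v (fun _ => True)
  simp only [decide_true, List.countP_true, and_true] at h
  exact h

theorem length_adjList_lt (hL : IsAdjacencyLists G L) (v : Fin n) : (adjList L v).length < n := by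
  rw [length_adjList hL]
  have h : G.neighborSet v ⊆ Set.univ \ {v} := fun u hu => by
    refine ⟨trivial, ?_⟩
    rintro rfl
    exact G.loopless.irrefl _ hu
  have h₁ := Set.ncard_le_ncard h (Set.toFinite _)
  have h₂ := Set.ncard_sdiff_singleton_lt_of_mem (Set.mem_univ v)
  rw [Set.ncard_univ, Nat.card_eq_fintype_card, Fintype.card_fin] at h₂
  omega

theorem inputSize_adjList (hL : IsAdjacencyLists G L) :
    inputSize n (adjList L) = n + 2 * G.edgeSet.ncard := by
  classical
  have h : ∀ v : Fin n, (adjList L v).length = G.degree v := fun v => by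
    rw [length_adjList hL, ← SimpleGraph.card_neighborSet_eq_degree, ← Nat.card_eq_fintype_card]
    rfl
  rw [inputSize, Finset.sum_add_distrib, Finset.sum_range, Finset.sum_congr rfl fun v _ => h v,
    G.sum_degrees_eq_twice_card_edges, ← SimpleGraph.coe_edgeFinset, Set.ncard_coe_finset]
  simp [add_comm]

theorem lists_inputState (L : Fin n → List (Fin n)) :
    Lists ((inputState L).arr 0) ((inputState L).arr 1) n (adjList L) := by
  have hoff : ∀ v ≤ n, (inputState L).arr 0 v = (((List.ofFn L).take v).flatten).length :=
    fun v hv => by simp [inputState, hv]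
  have htake : ∀ v (hv : v < n), (List.ofFn L).take (v + 1) = (List.ofFn L).take v ++ [L ⟨v, hv⟩] :=
    fun v hv => by rw [List.take_succ_eq_append_getElem (by simpa using hv), List.getElem_ofFn]
  refine ⟨fun v hv => ?_, fun v hv i hi => ?_⟩
  · rw [hoff _ hv, hoff _ hv.le, htake v hv, List.flatten_append, List.length_append]
    simp [adjList, hv]
  · rw [hoff _ hv.le]
    have h1 : (inputState L).arr 1 = fun i => (((List.ofFn L).flatten).map Fin.val).getD i 0 := rfl
    have hflat : (List.ofFn L).flatten = ((List.ofFn L).take v).flatten ++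
        (L ⟨v, hv⟩ ++ ((List.ofFn L).drop (v + 1)).flatten) := by
      conv_lhs => rw [← List.take_append_drop (v + 1) (List.ofFn L), htake v hv]
      simp
    have hi' : i < (L ⟨v, hv⟩).length := by simpa [adjList, hv] using hi
    rw [h1]
    simp only [hflat, List.map_append]
    rw [List.getD_eq_getElem?_getD, List.getElem?_append_right
      (by rw [List.length_map]; exact Nat.le_add_right _ _), List.length_map,
      Nat.add_sub_cancel_left, List.getElem?_append_left (by simpa using hi')]
    simp [adjList, hv, hi']

theorem adjList_closed (hL : IsAdjacencyLists G L) (hG : G.Connected) {r : ℕ} (hr : r < n)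
    (φ : ℕ → Prop) (h0 : φ r) (h : ∀ u < n, φ u → ∀ w ∈ adjList L u, φ w) : ∀ v < n, φ v := by
  intro v hv
  obtain ⟨p⟩ := hG.preconnected ⟨r, hr⟩ ⟨v, hv⟩
  have key : ∀ {a b : Fin n}, G.Walk a b → φ a → φ b := by
    intro a b p
    induction p with
    | nil => exact id
    | cons hadj _ ih => exact fun ha => ih (h _ (Fin.is_lt _) ha _ ((mem_adjList_fin hL).2 hadj))
  exact key p h0

theorem layering_of_bfsResult (hL : IsAdjacencyLists G L) {r : ℕ} (hr : r < n) {Q D : ℕ → ℕ}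
    (H : BFSResult n (adjList L) r Q D) : Layering G ⟨r, hr⟩ fun v => D v - 1 where
  root := by simp [H.root]
  eq_root {v} hv := by
    have := H.pos v v.2
    exact Fin.ext (H.eq_root v (by omega))
  le {u v} huv := by
    have := H.pos u u.2
    have := H.le u u.2 v ((mem_adjList_fin hL).2 huv)
    omega
  pred {v} hv := by
    obtain ⟨u, hu, h₁, h₂⟩ := H.pred v (by omega)
    have := H.pos u hu
    exact ⟨⟨u, hu⟩, (mem_adjList_fin hL (v := ⟨u, hu⟩)).1 h₁, by simp only; omega⟩

section keys

variable {c : Fin n → Bool} {f : Fin n → ℤ} {r : ℕ} {Q D : ℕ → ℕ}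

/-- Adjacent vertices never share a layer of a bipartite graph, so a single comparison separates
next from previous neighbours. -/
theorem not_lt_iff (hL : IsAdjacencyLists G L) (hr : r < n) (hf : StrongOrder G c f)
    (H : BFSResult n (adjList L) r Q D) {v w : Fin n} (h : G.Adj v w) :
    ¬ D v < D w ↔ D w < D v := by
  have h₁ := (layering_of_bfsResult hL hr H).adj_ne hf h
  have h₂ := H.pos v v.2
  have h₃ := H.pos w w.2
  omega

theorem behind_eq (hL : IsAdjacencyLists G L) (hr : r < n) (hf : StrongOrder G c f)
    (H : BFSResult n (adjList L) r Q D) (v : Fin n) :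
    behind (adjList L) D v = {u : Fin n | G.Adj v u ∧ D u < D v}.ncard := by
  rw [behind, countP_adjList hL v (fun w => ¬ D v < D w)]
  congr 1
  ext u
  exact and_congr_right fun h => not_lt_iff hL hr hf H h

theorem below_eq_ncard (D : ℕ → ℕ) (v : Fin n) :
    below n D v = {u : Fin n | D u < D v}.ncard := by
  have h : (Finset.range n).filter (fun u => D u < D v) =
      (Finset.univ.filter fun u : Fin n => D u < D v).image Fin.val := by
    ext u
    simp only [Finset.mem_filter, Finset.mem_range, Finset.mem_image, Finset.mem_univ, true_and]
    exact ⟨fun h => ⟨⟨u, h.1⟩, h.2, rfl⟩, by rintro ⟨u, hu, rfl⟩; exact ⟨u.2, hu⟩⟩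
  rw [below, h, Finset.card_image_of_injective _ Fin.val_injective, ← Set.ncard_coe_finset]
  simp

/-- This is what keeps the truncated subtractions in the computation of the keys exact. -/
theorem behind_le_below (hL : IsAdjacencyLists G L) (hr : r < n) (hf : StrongOrder G c f)
    (H : BFSResult n (adjList L) r Q D) : ∀ v < n, behind (adjList L) D v ≤ below n D v := by
  intro v hv
  rw [behind_eq hL hr hf H ⟨v, hv⟩, below_eq_ncard D ⟨v, hv⟩]
  exact Set.ncard_le_ncard (fun u hu => hu.2) (Set.toFinite _)

theorem layerKey_eq (hL : IsAdjacencyLists G L) (hr : r < n) (hf : StrongOrder G c f)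
    (H : BFSResult n (adjList L) r Q D) {K : ℕ → ℕ} (v : Fin n)
    (hK : K v + behind (adjList L) D v = 2 * below n D v + ahead (adjList L) D v) :
    layerKey G (fun v : Fin n => D v - 1) v = K v := by
  have hpos : ∀ u : Fin n, 0 < D u := fun u => H.pos u u.2
  have hlt : ∀ u w : Fin n, D u - 1 < D w - 1 ↔ D u < D w := fun u w => by
    have := hpos u
    have := hpos w
    omega
  rw [behind_eq hL hr hf H, below_eq_ncard, ahead, countP_adjList hL v (fun w => D v < D w)] at hK
  unfold layerKey
  simp only [hlt]
  omega

/-- Both `below` and `ahead` are at most `n - 1`. -/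
theorem key_lt (hL : IsAdjacencyLists G L) {K : ℕ → ℕ}
    (hK : ∀ v < n, K v + behind (adjList L) D v = 2 * below n D v + ahead (adjList L) D v) :
    ∀ v < n, K v < 3 * n := by
  intro v hv
  have h₁ := hK v hv
  have h₂ : below n D v < n := by
    have : (Finset.range n).filter (fun u => D u < D v) ⊂ Finset.range n :=
      Finset.filter_ssubset.2 ⟨v, Finset.mem_range.2 hv, lt_irrefl _⟩
    simpa [below] using Finset.card_lt_card this
  have h₃ : ahead (adjList L) D v < n :=
    lt_of_le_of_lt List.countP_le_length (length_adjList_lt hL ⟨v, hv⟩)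
  omega

end keys

/-- The vertex number `i` of the list `l`. -/
def vertexAt (hn : 0 < n) (l : List ℕ) (i : ℕ) : Fin n :=
  if h : l.getD i 0 < n then ⟨l.getD i 0, h⟩ else ⟨0, hn⟩

theorem vertexAt_val (hn : 0 < n) {l : List ℕ} (hl : ∀ v ∈ l, v < n) {i : ℕ} (hi : i < l.length) :
    (vertexAt hn l i : ℕ) = l[i] := by
  have h := hl _ (List.getElem_mem hi)
  simp [vertexAt, hi, h]

theorem stair_of_sorted (hn : 1 < n) (hG : G.Connected) {c : Fin n → Bool} {F : Fin n → ℤ}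
    (hF : StrongOrder G c F) {O : List ℕ} (hnodup : O.Nodup) (hmem : ∀ v, v ∈ O ↔ v < n)
    {K : ℕ → ℕ} (hK : ∀ v : Fin n, F v = K v) (hsort : O.Pairwise fun u v => K u ≤ K v)
    {par : ℕ → ℕ} {c₀ : Bool} (hpar : ∀ v : Fin n, par v = 0 ↔ c v = c₀) :
    Stair G (O.filter fun v => par v = 0).length (O.filter fun v => par v ≠ 0).length
      (vertexAt (by omega) (O.filter fun v => par v = 0))
      (vertexAt (by omega) (O.filter fun v => par v ≠ 0)) := by
  have hn0 : 0 < n := by omega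
  set lX := O.filter fun v => par v = 0 with hlX
  set lY := O.filter fun v => par v ≠ 0 with hlY
  have hX : ∀ v, v ∈ lX ↔ v < n ∧ par v = 0 := fun v => by simp [hlX, hmem]
  have hY : ∀ v, v ∈ lY ↔ v < n ∧ par v ≠ 0 := fun v => by simp [hlY, hmem]
  have hXn : ∀ v ∈ lX, v < n := fun v hv => ((hX v).1 hv).1
  have hYn : ∀ v ∈ lY, v < n := fun v hv => ((hY v).1 hv).1
  have hXc : ∀ i < lX.length, c (vertexAt hn0 lX i) = c₀ := fun i hi => by
    rw [← hpar, vertexAt_val hn0 hXn hi]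
    exact ((hX _).1 (List.getElem_mem hi)).2
  have hYc : ∀ i < lY.length, c (vertexAt hn0 lY i) ≠ c₀ := fun i hi => by
    rw [ne_eq, ← hpar, vertexAt_val hn0 hYn hi]
    exact ((hY _).1 (List.getElem_mem hi)).2
  have hinj : ∀ l : List ℕ, l.Nodup → (∀ v ∈ l, v < n) → ∀ i < l.length, ∀ j < l.length,
      vertexAt hn0 l i = vertexAt hn0 l j → i = j := by
    intro l hl hln i hi j hj hij
    have := congrArg Fin.val hij
    rw [vertexAt_val hn0 hln hi, vertexAt_val hn0 hln hj] at this
    exact (List.Nodup.getElem_inj_iff hl).1 this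
  have hmono : ∀ l : List ℕ, (l.Pairwise fun u v => K u ≤ K v) → (∀ v ∈ l, v < n) →
      ∀ i j, i ≤ j → j < l.length → F (vertexAt hn0 l i) ≤ F (vertexAt hn0 l j) := by
    intro l hl hln i j hij hj
    rw [hK, hK, vertexAt_val hn0 hln (by omega), vertexAt_val hn0 hln hj, Nat.cast_le]
    rcases hij.eq_or_lt with rfl | hlt
    · exact le_rfl
    · exact List.pairwise_iff_getElem.1 hl i j (by omega) hj hlt
  have hcover : ∀ l : List ℕ, (∀ v ∈ l, v < n) → ∀ v : Fin n, (v : ℕ) ∈ l →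
      ∃ i < l.length, vertexAt hn0 l i = v := by
    intro l hln v hv
    obtain ⟨i, hi, hiv⟩ := List.mem_iff_getElem.1 hv
    exact ⟨i, hi, Fin.ext (by rw [vertexAt_val hn0 hln hi, hiv])⟩
  have hnx : lX.Nodup := hnodup.filter _
  have hny : lY.Nodup := hnodup.filter _
  have hbool : ∀ a b : Bool, a ≠ c₀ → b ≠ c₀ → a = b := by cases c₀ <;> decide
  -- With two vertices and connectedness there is an edge, and its ends are on different sides.
  have hne : lX ≠ [] ∧ lY ≠ [] := by
    obtain ⟨w, hw⟩ := exists_adj_of_connected hG (u := ⟨0, hn0⟩) (v := ⟨1, hn⟩) (by simp)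
    have hc := hF.proper hw
    by_cases h0 : c ⟨0, hn0⟩ = c₀
    · have h1 : c w ≠ c₀ := fun h => hc (h0.trans h.symm)
      exact ⟨List.ne_nil_of_mem ((hX 0).2 ⟨hn0, (hpar ⟨0, hn0⟩).2 h0⟩),
        List.ne_nil_of_mem ((hY w).2 ⟨w.2, fun h => h1 ((hpar w).1 h)⟩)⟩
    · have h1 : c w = c₀ := by
        by_contra h1
        exact hc (hbool _ _ h0 h1)
      exact ⟨List.ne_nil_of_mem ((hX w).2 ⟨w.2, (hpar w).2 h1⟩),
        List.ne_nil_of_mem ((hY 0).2 ⟨hn0, fun h => h0 ((hpar ⟨0, hn0⟩).1 h)⟩)⟩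
  exact {
    x_inj := hinj lX hnx hXn
    y_inj := hinj lY hny hYn
    x_ne_y := fun i hi j hj h => hYc j hj (h ▸ hXc i hi)
    cover := fun v => by
      by_cases h : par v = 0
      · exact Or.inl (hcover lX hXn v ((hX v).2 ⟨v.2, h⟩))
      · exact Or.inr (hcover lY hYn v ((hY v).2 ⟨v.2, h⟩))
    not_adj_x := fun i hi j hj h => hF.proper h ((hXc i hi).trans (hXc j hj).symm)
    not_adj_y := fun i hi j hj h => hF.proper h (hbool _ _ (hYc i hi) (hYc j hj))
    cross := fun i i' j j' hi hi' hj hj' h h' =>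
      hF.cross ((hXc i (by omega)).trans (hXc i' hi').symm) (hbool _ _ (hYc j (by omega)) (hYc j' hj'))
        (hmono lX (hsort.filter _) hXn i i' hi hi') (hmono lY (hsort.filter _) hYn j j' hj hj') h h'
    conn := hG
    p_pos := List.length_pos_iff.2 hne.1
    q_pos := List.length_pos_iff.2 hne.2 }

/-- The test of the algorithm for the next cell in a row. -/
theorem Stair.lt_lastSeen_iff (hL : IsAdjacencyLists G L) {p : ℕ} {x : ℕ → Fin n} {lY : List ℕ}
    {hn : 0 < n} (hY : ∀ v ∈ lY, v < n) (S : Stair G p lY.length x (vertexAt hn lY))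
    {H : ℕ → ℕ} (hH : LastSeen (adjList L) lY H) {i j : ℕ}
    (h : Cell G p lY.length x (vertexAt hn lY) i j) :
    j + 1 < H (x i) ↔ Cell G p lY.length x (vertexAt hn lY) i (j + 1) := by
  constructor
  · intro hlt
    rcases hH.eq (x i) with h0 | ⟨j', hj', h₁, h₂⟩
    · omega
    · rw [← vertexAt_val hn hY hj', mem_adjList_fin hL] at h₂
      -- Row `i` is an interval, so everything between a cell and its last column is in the shape.
      exact S.interval (b := j') (Nat.le_succ j) (by omega) h ⟨h.1, hj', h₂.symm⟩
  · intro h'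
    refine hH.le (j + 1) h'.2.1 (x i) ?_
    rw [← vertexAt_val hn hY h'.2.1, mem_adjList_fin hL]
    exact h'.2.2.symm

section greedy

variable {V : Type*} {G : SimpleGraph V} {p q : ℕ} {x y : ℕ → V} {X Y H₁ H₂ : ℕ → ℕ}

/-- The stored tests are meaningful only at cells of the shape, so staying in the shape is proved by
induction along the iteration before the greedy rules can be read off. -/
theorem Stair.isGreedy_greedyPath (S : Stair G p q x y) (b : Bool)
    (hr : ∀ i j, Cell G p q x y i j → (j + 1 < H₂ (X i) ↔ Cell G p q x y i (j + 1)))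
    (hd : ∀ i j, Cell G p q x y i j → (i + 1 < H₁ (Y j) ↔ Cell G p q x y (i + 1) j)) :
    IsGreedy (Cell G p q x y) (p + q - 1) (fun e => (greedyPath X Y H₁ H₂ b e).1)
      (fun e => (greedyPath X Y H₁ H₂ b e).2.1) (fun e => (greedyPath X Y H₁ H₂ b e).2.2) := by
  have hcell : ∀ e < p + q - 1, Cell G p q x y (greedyPath X Y H₁ H₂ b e).1
      (greedyPath X Y H₁ H₂ b e).2.1 ∧
        (greedyPath X Y H₁ H₂ b e).1 + (greedyPath X Y H₁ H₂ b e).2.1 = e := by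
    intro e
    induction e with
    | zero => exact fun _ => ⟨S.cell_zero, rfl⟩
    | succ e ih =>
      intro he
      have h := ih (by omega)
      rw [greedyPath_succ]
      revert h
      generalize greedyPath X Y H₁ H₂ b e = g
      obtain ⟨i, j, b'⟩ := g
      rintro ⟨hc, hs⟩
      simp only at hc hs
      have ha := S.advance hc (by omega)
      have h₁ := hr i j hc
      have h₂ := hd i j hc
      cases b' <;> simp only [greedyNext] <;> split_ifs with h <;>
        simp only <;> refine ⟨by tauto, by omega⟩
  refine ⟨rfl, rfl, fun e he => ?_, fun e he => ?_⟩ <;>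
  · have h := (hcell e (by omega)).1
    rw [greedyPath_succ]
    revert h
    generalize greedyPath X Y H₁ H₂ b e = g
    obtain ⟨i, j, b'⟩ := g
    intro hc
    simp only at hc
    simp only [← hr i j hc, ← hd i j hc]
    cases b' <;> simp only [greedyNext, Bool.false_eq_true, false_and,
      false_or, true_and, or_false, reduceCtorEq] <;> intro h <;> simp [h]

theorem Stair.cell_diag (S : Stair G p q x y) {k : ℕ}
    (hr : ∀ i j, Cell G p q x y i j → (j + 1 < H₂ (X i) ↔ Cell G p q x y i (j + 1)))
    (hd : ∀ i j, Cell G p q x y i j → (i + 1 < H₁ (Y j) ↔ Cell G p q x y (i + 1) j))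
    (hk : ∀ t < k, t + 1 < H₂ (X t) ∧ t + 1 < H₁ (Y t)) (t : ℕ) (ht : t ≤ k) :
    Cell G p q x y t t := by
  induction t with
  | zero => exact S.cell_zero
  | succ t ih =>
    have hc := ih (by omega)
    obtain ⟨h₁, h₂⟩ := hk t (by omega)
    exact (S.cell_cross (Nat.le_succ t) (Nat.le_succ t) ((hr t t hc).1 h₁) ((hd t t hc).1 h₂)).2

theorem Stair.isMIST_greedyPath (S : Stair G p q x y) {b : Bool} {k : ℕ}
    (hr : ∀ i j, Cell G p q x y i j → (j + 1 < H₂ (X i) ↔ Cell G p q x y i (j + 1)))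
    (hd : ∀ i j, Cell G p q x y i j → (i + 1 < H₁ (Y j) ↔ Cell G p q x y (i + 1) j))
    (hk : ∀ t < k, t + 1 < H₂ (X t) ∧ t + 1 < H₁ (Y t))
    (hb : (b = true ∧ ¬ k + 1 < H₂ (X k)) ∨ (b = false ∧ ¬ k + 1 < H₁ (Y k))) :
    IsMIST G (pathGraph x y (p + q - 1) (fun e => (greedyPath X Y H₁ H₂ b e).1)
      (fun e => (greedyPath X Y H₁ H₂ b e).2.1)) := by
  have hdiag := S.cell_diag hr hd hk
  refine S.isMIST_pathGraph (S.isGreedy_greedyPath b hr hd) (k := k) (fun t ht => ?_) ?_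
  · have hc := hdiag t ht.le
    exact ⟨(hd t t hc).1 (hk t ht).2, (hr t t hc).1 (hk t ht).1⟩
  · have hc := hdiag k le_rfl
    rwa [hr k k hc, hd k k hc] at hb

end greedy

end MIST

/-! ### The algorithm is correct -/

namespace MIST

open RAM

variable {n : ℕ} {G : SimpleGraph (Fin n)} {L : Fin n → List (Fin n)}

/-- The output of the last phase is a maximum internal spanning tree. -/
theorem exists_isMIST_holdsEdgeList (hn : 0 < n) (hG : G.Connected) (hL : IsAdjacencyLists G L)
    {c : Fin n → Bool} {F : Fin n → ℤ} (hF : StrongOrder G c F) {K par : ℕ → ℕ}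
    (hK : ∀ v : Fin n, F v = K v) (hKlt : ∀ v < n, K v < 3 * n) {c₀ : Bool}
    (hpar : ∀ v : Fin n, par v = 0 ↔ c v = c₀) {X Y H₁ H₂ : ℕ → ℕ}
    (hX : Holds X ((sorted K n (3 * n)).filter fun v => par v = 0))
    (hY : Holds Y ((sorted K n (3 * n)).filter fun v => par v ≠ 0))
    (hH₁ : LastSeen (adjList L) ((sorted K n (3 * n)).filter fun v => par v = 0) H₁)
    (hH₂ : LastSeen (adjList L) ((sorted K n (3 * n)).filter fun v => par v ≠ 0) H₂)
    {b : Bool} {k : ℕ} (hk : ∀ t < k, t + 1 < H₂ (X t) ∧ t + 1 < H₁ (Y t))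
    (hb : (b = true ∧ ¬ k + 1 < H₂ (X k)) ∨ (b = false ∧ ¬ k + 1 < H₁ (Y k))) {s : State}
    (h0 : s.reg 0 = n - 1)
    (hs : ∀ e < n - 1, s.arr 2 e = X (greedyPath X Y H₁ H₂ b e).1 ∧
        s.arr 3 e = Y (greedyPath X Y H₁ H₂ b e).2.1) :
    ∃ T : SimpleGraph (Fin n), IsMIST G T ∧ HoldsEdgeList T s := by
  -- A single vertex leaves one side empty, so there is no staircase; the output has no edges and is
  -- correct.
  rcases (show n = 1 ∨ 1 < n by omega) with rfl | hn1
  · have hbot : ∀ T : SimpleGraph (Fin 1), T = G := fun T => by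
      ext u v
      rw [Subsingleton.elim u v]
      simp
    refine ⟨G, ⟨⟨le_rfl, SimpleGraph.IsTree.of_subsingleton⟩,
      fun T' _ => by rw [hbot T']⟩, ?_, fun u v => ?_⟩
    · rw [h0, ← hbot ⊥]
      simp
    · rw [Subsingleton.elim u v, h0]
      simp
  set O := sorted K n (3 * n) with hO
  have hmem : ∀ v, v ∈ O ↔ v < n := fun v => by
    rw [hO, mem_sorted]
    exact ⟨fun h => h.1, fun h => ⟨h, hKlt v h⟩⟩
  have S := stair_of_sorted hn1 hG hF (nodup_sorted K n (3 * n)) hmem hK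
    (pairwise_sorted K n (3 * n)) hpar
  set lX := O.filter fun v => par v = 0 with hlX
  set lY := O.filter fun v => par v ≠ 0 with hlY
  have hXn : ∀ v ∈ lX, v < n := fun v hv => (hmem v).1 (List.mem_of_mem_filter hv)
  have hYn : ∀ v ∈ lY, v < n := fun v hv => (hmem v).1 (List.mem_of_mem_filter hv)
  have hXv : ∀ i < lX.length, X i = vertexAt hn lX i := fun i hi => by
    rw [vertexAt_val hn hXn hi, hX i hi]
  have hYv : ∀ j < lY.length, Y j = vertexAt hn lY j := fun j hj => by
    rw [vertexAt_val hn hYn hj, hY j hj]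
  have hr : ∀ i j, Cell G lX.length lY.length (vertexAt hn lX) (vertexAt hn lY) i j →
      (j + 1 < H₂ (X i) ↔
        Cell G lX.length lY.length (vertexAt hn lX) (vertexAt hn lY) i (j + 1)) := fun i j h => by
    rw [hXv i h.1]
    exact S.lt_lastSeen_iff hL hYn hH₂ h
  have hd : ∀ i j, Cell G lX.length lY.length (vertexAt hn lX) (vertexAt hn lY) i j →
      (i + 1 < H₁ (Y j) ↔
        Cell G lX.length lY.length (vertexAt hn lX) (vertexAt hn lY) (i + 1) j) := fun i j h => by
    rw [hYv j h.2.1, ← cell_swap]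
    exact S.swap.lt_lastSeen_iff hL hXn hH₁ h.swap
  have hgreedy := S.isGreedy_greedyPath b hr hd
  have hcard := S.card_eq
  rw [Nat.card_eq_fintype_card, Fintype.card_fin] at hcard
  have hM := S.isMIST_greedyPath hr hd hk hb
  refine ⟨_, hM, ?_, fun u v => ?_⟩
  · have := (SimpleGraph.isTree_iff_connected_and_card.1 hM.1.2).2
    rw [Nat.card_coe_set_eq, Nat.card_eq_fintype_card, Fintype.card_fin] at this
    omega
  · rw [S.pathGraph_adj hgreedy, h0, ← hcard]
    refine exists_congr fun e => and_congr_right fun he => ?_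
    obtain ⟨hc, -⟩ := S.greedy_cell hgreedy e (by omega)
    rw [(hs e he).1, (hs e he).2, hXv _ hc.1, hYv _ hc.2.1]
    simp only [Fin.val_inj]

theorem wp_mist (hG : G.Connected) (hP : IsBipartitePermutationGraph G)
    (hL : IsAdjacencyLists G L) :
    Wp mist (fun t s => t ≤ 172 * (n + G.edgeSet.ncard) ∧
      ∃ T : SimpleGraph (Fin n), IsMIST G T ∧ HoldsEdgeList T s) 0 (inputState L) := by
  obtain ⟨c, f, hf⟩ := exists_strongOrder hP
  have hn : 0 < n := by
    obtain ⟨v⟩ := hG.nonempty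
    exact lt_of_le_of_lt (Nat.zero_le _) v.2
  have hnb : ∀ v < n, ∀ w ∈ adjList L v, w < n := fun v _ w hw => ((mem_adjList hL).1 hw).2.1
  have hzero : ∀ a, 1 < a → (inputState L).arr a = fun _ => 0 := fun a ha => by
    funext i
    simp [inputState, show a ≠ 0 by omega, show a ≠ 1 by omega]
  have hsize := inputSize_adjList hL
  set s₀ := inputState L with hs₀
  have c₀ : Context n (adjList L) s₀ := ⟨rfl, rfl, lists_inputState L⟩
  unfold mist
  rw [wp_seq]
  refine wp_bfs (by decide) (by decide) (by decide) (by decide) (by decide) c₀ hnb rfl hn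
    (hzero 4 (by decide)) (hzero 5 (by decide)) (adjList_closed hL hG hn) ?_
  intro s₁ τ₁ f₁ o₁ b₁ t₁
  have c₁ := c₀.of_frame f₁ (by decide) (by decide) (by decide) (by decide)
  rw [wp_seq]
  refine wp_selectEnd c₁ o₁ b₁ hn (fun v hv => length_adjList_lt hL ⟨v, hv⟩) ?_
  intro s₂ τ₂ r f₂ r₂ hr hmax hdeg t₂
  have c₂ := c₁.of_frame f₂ (by decide) (by decide) (by decide) (by decide)
  -- The ordering `g` with `r` at its end is only known to exist; the second search is rooted at
  -- `r`, so that its keys recover a strong ordering.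
  obtain ⟨g, hg, hmin⟩ := hf.exists_min (layering_of_bfsResult hL hn b₁) (v := ⟨r, hr⟩)
    (fun u => Nat.sub_le_sub_right (hmax u u.2) 1) fun u hu => by
      have h₁ := b₁.pos u u.2
      have h₂ := b₁.pos r hr
      rw [← length_adjList hL, ← length_adjList hL]
      exact hdeg u u.2 (by simp only at hu; omega)
  rw [wp_seq]
  refine wp_bfs (by decide) (by decide) (by decide) (by decide) (by decide) c₂ hnb r₂ hr
    (by rw [f₂.arr 6 (by decide), f₁.arr 6 (by decide), hzero 6 (by decide)])
    (by rw [f₂.arr 7 (by decide), f₁.arr 7 (by decide), hzero 7 (by decide)])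
    (adjList_closed hL hG hr) ?_
  intro s₃ τ₃ f₃ o₃ b₃ t₃
  have c₃ := c₂.of_frame f₃ (by decide) (by decide) (by decide) (by decide)
  rw [wp_seq]
  refine wp_keys c₃ o₃ b₃ (behind_le_below hL hr hg b₃) ?_
  intro s₄ τ₄ f₄ e₄ hK hpar t₄
  have c₄ := c₃.of_frame f₄ (by decide) (by decide) (by decide) (by decide)
  rw [wp_seq]
  refine wp_buckets c₄ (by
    rw [f₄.arr 10 (by decide), f₃.arr 10 (by decide), f₂.arr 10 (by decide), f₁.arr 10 (by decide),
      hzero 10 (by decide)]) ?_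
  intro s₅ τ₅ f₅ h₅ t₅
  have c₅ := c₄.of_frame f₅ (by decide) (by decide) (by decide) (by decide)
  have o₅ : s₅.reg 2 = 1 := by rw [f₅.reg 2 (by decide), f₄.reg 2 (by decide), o₃]
  have hKlt := key_lt hL hK
  rw [wp_seq]
  refine wp_collect c₅ o₅ (by rw [f₅.reg 17 (by decide), e₄]) hKlt h₅ ?_
  intro s₆ τ₆ f₆ h₆ t₆
  have c₆ := c₅.of_frame f₆ (by decide) (by decide) (by decide) (by decide)
  rw [wp_seq]
  refine wp_split (par := s₄.arr 9) c₆ (length_sorted hKlt) (nodup_sorted _ _ _)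
    (fun v hv => (mem_sorted.1 hv).1) h₆ (by rw [f₆.arr 9 (by decide), f₅.arr 9 (by decide)])
    (by rw [f₆.arr 15 (by decide), f₅.arr 15 (by decide), f₄.arr 15 (by decide),
      f₃.arr 15 (by decide), f₂.arr 15 (by decide), f₁.arr 15 (by decide), hzero 15 (by decide)])
    (by rw [f₆.arr 16 (by decide), f₅.arr 16 (by decide), f₄.arr 16 (by decide),
      f₃.arr 16 (by decide), f₂.arr 16 (by decide), f₁.arr 16 (by decide), hzero 16 (by decide)]) ?_
  intro s₇ τ₇ f₇ hX hY hH₁ hH₂ t₇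
  have c₇ := c₆.of_frame f₇ (by decide) (by decide) (by decide) (by decide)
  have o₇ : s₇.reg 2 = 1 := by rw [f₇.reg 2 (by decide), f₆.reg 2 (by decide), o₅]
  rw [wp_seq]
  refine wp_startDirection (n := n) o₇ rfl rfl rfl rfl (fun v => ?_) ?_
  · rcases hH₂.eq v with h | ⟨i, hi, h, -⟩
    · omega
    · have h₁ := List.length_filter_le (fun v => decide (s₄.arr 9 v ≠ 0))
        (sorted (s₄.arr 8) n (3 * n))
      rw [length_sorted hKlt] at h₁
      omega
  intro s₈ τ₈ k b f₈ hk e₈ hb t₈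
  have c₈ := c₇.of_frame f₈ (by decide) (by decide) (by decide) (by decide)
  have o₈ : s₈.reg 2 = 1 := by rw [f₈.reg 2 (by decide), o₇]
  refine wp_greedy c₈ o₈ (f₈.arr 13 (by decide)) (f₈.arr 14 (by decide)) (f₈.arr 15 (by decide))
    (f₈.arr 16 (by decide)) e₈ ?_
  intro s₉ τ₉ h0 hout t₉
  -- The phases add up to `55 * inputSize + 61 * n + 56` steps, where the input size is `n + 2 * m`;
  -- since `n ≥ 1`, this is at most `172 * n + 110 * m`.
  refine ⟨by omega, ?_⟩
  have hlay := layering_of_bfsResult hL hr b₃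
  refine exists_isMIST_holdsEdgeList hn hG hL (hg.strongOrder_layerKey hlay hmin)
    (fun v => layerKey_eq hL hr hg b₃ v (hK v v.2)) hKlt (c₀ := c ⟨r, hr⟩) (fun v => ?_)
    hX hY hH₁ hH₂ hk hb h0 hout
  -- The stored side is the parity of the distance from `r`, hence the colour relative to that of
  -- `r`; the stored distances are one too large, which flips the parity.
  rw [hlay.color_eq_iff hg v, Nat.even_iff]
  have h₁ := hpar v v.2
  have h₂ := b₃.pos v v.2
  omega

end MIST

theorem mainTheorem2 :
    ∃ (P : RAM.Program) (c : ℕ), ∀ (n : ℕ) (G : SimpleGraph (Fin n)),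
      G.Connected → MIST.IsBipartitePermutationGraph G →
      ∀ L : Fin n → List (Fin n), MIST.IsAdjacencyLists G L →
        ∃ (t : ℕ) (s : RAM.State),
          RAM.Exec P (MIST.inputState L) t s ∧
          t ≤ c * (n + G.edgeSet.ncard) ∧
          ∃ T : SimpleGraph (Fin n), MIST.IsMIST G T ∧ MIST.HoldsEdgeList T s := by
  refine ⟨RAM.mist, 172, fun n G hG hP L hL => ?_⟩
  obtain ⟨t, s, hexec, ht, hT⟩ := MIST.wp_mist hG hP hL
  exact ⟨t, s, hexec, by rwa [Nat.zero_add] at ht, hT⟩
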